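/- Let $E=\mathbb R^n$ with its Borel $\sigma$-algebra, let $\delta>0$, and let $X=(X_t)_{t\ge 0}$ be a (conservative, time-homogeneous) Feller--Markov process with values in $E$: for every $x\in E$ there is a probability measure $\mathbb P_x$ (with expectation $\mathbb E_x$) under which $X_0=x$ almost surely, the paths are right-continuous with left limits, $X$ has the Markov property, and its transition semigroup $g\mapsto (x\mapsto\mathbb E_x[g(X_t)])$ maps $C_0(E)$, the continuous functions vanishing at infinity, into itself for each $t\geq 0$. For $\gamma\in\mathbb R$ and a random variable $Z$ let $\mu^\gamma_x(Z)=\frac1\gamma\ln\mathbb E_x[e^{\gamma Z}]$ if $\gamma\ne0$ and $\mu^0_x(Z)=\mathbb E_x[Z]$ (extended-real valued). Let $U\subseteq E$ be compact, let $\omega:E\to[0,\infty)$ be continuous, put $\|g\|_\omega=\sup_{x\in E}\frac{|g(x)|}{1+\omega(x)}$, and let $C_\omega(E)$ be the set of continuous $g:E\to\mathbb R$ with $\|g\|_\omega<\infty$. Let $f:E\to\mathbb R$ and $c:E\times U\to\mathbb R$, and assume: (A.1) $f$ is continuous and $\|f\|_\omega<\infty$. (A.2) $c$ is continuous, there is $c_0<0$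 with $c(x,\xi)\le c_0$ for all $x\in E$, $\xi\in U$, and $\|\hat c\|_\omega<\infty$ for $\hat c(x):=\inf_{\xi\in U}c(x,\xi)$. (A.3) There are $b_1\in(0,1)$ and functions $M_1,M_2:\mathbb R\to\mathbb R$ such that for all $\gamma\in\mathbb R$ and $x\in E$ $$\mu^\gamma_x\Big(\int_0^\delta\omega(X_s)\,ds\Big)\le\omega(x)+M_1(\gamma),\qquad \mu^\gamma_x(\omega(X_\delta))\le b_1\omega(x)+M_2(\gamma).$$ (A.4) For every $R>0$ there are $d>0$ and a probability measure $\nu$ on $E$ with $\nu(U)>0$ such that $\mathbb P_x[X_\delta\in A]\ge d\,\nu(A)$ for all Borel $A\subseteq E$ and all $x\in E$ with $\omega(x)\le R$. Then for every $\gamma<0$ there are $w\in C_\omega(E)$ and $\lambda\in\mathbb R$ such that, for all $x\in E$, $$w(x)+\lambda=\max\Big\{\mu^\gamma_x\Big(\int_0^\delta f(X_s)\,ds+w(X_\delta)\Big),\ \sup_{\xi\in U}\Big(\mu^\gamma_\xi\Big(\int_0^\delta f(X_s)\,ds+w(X_\delta)\Big)+c(x,\xi)\Big)\Big\},$$ and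 the solution is unique up to an additive constant in $w$: if $w'\in C_\omega(E)$ and $\lambda'\in\mathbb R$ also satisfy this equation, then $\lambda'=\lambda$ and $w'-w$ is constant. -/

import Mathlib

open MeasureTheory Filter Topology
open scoped NNReal ENNReal

noncomputable section

/-- Entropic utility of `Z` with parameter `γ` under the probability measure `P`, with values in
the extended reals: `(1/γ) ln E[exp (γ Z)]` for `γ ≠ 0`, and `E[Z] = E[Z⁺] - E[Z⁻]` for `γ = 0`. -/
def entropicUtility {Ω : Type*} [MeasurableSpace Ω] (P : Measure Ω) (γ : ℝ) (Z : Ω → ℝ) : EReal :=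
  if γ = 0 then
    ((∫⁻ o, ENNReal.ofReal (Z o) ∂P : ℝ≥0∞) : EReal)
      - ((∫⁻ o, ENNReal.ofReal (-Z o) ∂P : ℝ≥0∞) : EReal)
  else
    ((1 / γ : ℝ) : EReal) * ENNReal.log (∫⁻ o, ENNReal.ofReal (Real.exp (γ * Z o)) ∂P)

/-- `X` is a (conservative, time-homogeneous) Feller-Markov process with state space `E`: `P x` is
the law under which `X` starts from `x`, the paths are right-continuous with left limits, the
Markov property holds with respect to the filtration `𝓕`, and the transition semigroup
`g ↦ (x ↦ E_x[g (X_t)])` maps the continuous functions vanishing at infinity into themselves.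
(Continuity of the semigroup at `t = 0` is then automatic, the paths being right-continuous and
starting from `x`.) -/
structure IsFellerProcess {Ω E : Type*} [mΩ : MeasurableSpace Ω] [TopologicalSpace E]
    [MeasurableSpace E] (𝓕 : Filtration ℝ≥0 mΩ) (X : ℝ≥0 → Ω → E) (P : E → Measure Ω) : Prop where
  isProbabilityMeasure : ∀ x, IsProbabilityMeasure (P x)
  adapted : ∀ t, Measurable[𝓕 t] (X t)
  start : ∀ x, ∀ᵐ o ∂(P x), X 0 o = x
  right_continuous : ∀ o t, ContinuousWithinAt (fun s => X s o) (Set.Ici t) t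
  left_limits : ∀ o t, ∃ l : E, Tendsto (fun s => X s o) (𝓝[<] t) (𝓝 l)
  markov : ∀ (x : E) (s t : ℝ≥0) (A : Set Ω) (B : Set E), MeasurableSet[𝓕 s] A → MeasurableSet B →
    P x (A ∩ X (s + t) ⁻¹' B) = ∫⁻ o in A, P (X s o) (X t ⁻¹' B) ∂(P x)
  feller : ∀ (t : ℝ≥0) (g : ZeroAtInftyContinuousMap E ℝ),
    ∃ h : ZeroAtInftyContinuousMap E ℝ, ∀ x, h x = ∫ o, g (X t o) ∂(P x)

/-- `‖g‖_ω = sup_x |g x| / (1 + ω x) < ∞`. -/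
def HasFiniteWeightedNorm {E : Type*} (ω g : E → ℝ) : Prop :=
  BddAbove (Set.range fun x => |g x| / (1 + ω x))

/-- `g` belongs to `C_ω(E)`: it is continuous and `‖g‖_ω < ∞`. -/
def MemWeightedSpace {E : Type*} [TopologicalSpace E] (ω g : E → ℝ) : Prop :=
  Continuous g ∧ HasFiniteWeightedNorm ω g

/-- The random variable `∫_0^δ f(X_s) ds`. -/
def pathIntegral {Ω E : Type*} (X : ℝ≥0 → Ω → E) (δ : ℝ≥0) (f : E → ℝ) (o : Ω) : ℝ :=
  ∫ s in (0 : ℝ)..(δ : ℝ), f (X s.toNNReal o)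

/-- Conditions on the shift cost: `c` is continuous, bounded above by a negative constant, and
`x ↦ inf_{ξ ∈ U} c(x, ξ)` has a finite `ω`-norm. -/
def ShiftCostCondition {E : Type*} [TopologicalSpace E] (ω : E → ℝ) (U : Set E)
    (c : E → U → ℝ) : Prop :=
  Continuous (fun p : E × U => c p.1 p.2) ∧
    (∃ c₀ : ℝ, c₀ < 0 ∧ ∀ x ξ, c x ξ ≤ c₀) ∧
    HasFiniteWeightedNorm ω (fun x => ⨅ ξ : U, c x ξ)

/-- Geometric drift with controllable noise, for the uncontrolled process. -/
def GeometricDrift {Ω E : Type*} [MeasurableSpace Ω] (X : ℝ≥0 → Ω → E) (P : E → Measure Ω)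
    (δ : ℝ≥0) (ω : E → ℝ) : Prop :=
  ∃ b₁ : ℝ, 0 < b₁ ∧ b₁ < 1 ∧ ∃ M₁ M₂ : ℝ → ℝ, ∀ (γ : ℝ) (x : E),
    entropicUtility (P x) γ (pathIntegral X δ ω) ≤ ((ω x + M₁ γ : ℝ) : EReal) ∧
    entropicUtility (P x) γ (fun o => ω (X δ o)) ≤ ((b₁ * ω x + M₂ γ : ℝ) : EReal)

/-- Local minorization on the sublevel sets `{ω ≤ R}`, for the uncontrolled process. -/
def LocalMinorization {Ω E : Type*} [MeasurableSpace Ω] [MeasurableSpace E] (X : ℝ≥0 → Ω → E)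
    (P : E → Measure Ω) (δ : ℝ≥0) (ω : E → ℝ) (U : Set E) : Prop :=
  ∀ R : ℝ, 0 < R → ∃ d : ℝ, 0 < d ∧ ∃ ν : Measure E, IsProbabilityMeasure ν ∧ 0 < ν U ∧
    ∀ x, ω x ≤ R → ∀ A : Set E, MeasurableSet A →
      ENNReal.ofReal d * ν A ≤ P x (X δ ⁻¹' A)

/-- The value `μ_x^γ(∫_0^δ f(X_s) ds + w(X_δ))` for the uncontrolled process started from `x`. -/
def stepValue {Ω E : Type*} [MeasurableSpace Ω] (X : ℝ≥0 → Ω → E) (P : E → Measure Ω)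
    (δ : ℝ≥0) (f : E → ℝ) (γ : ℝ) (w : E → ℝ) (x : E) : EReal :=
  entropicUtility (P x) γ (fun o => pathIntegral X δ f o + w (X δ o))

/-- `(w, l)` solves the Bellman equation of the dyadic impulse control problem (an identity in the
extended reals, whose left-hand side is real). -/
def SolvesBellman {Ω E : Type*} [MeasurableSpace Ω] (X : ℝ≥0 → Ω → E) (P : E → Measure Ω)
    (δ : ℝ≥0) (f : E → ℝ) (U : Set E) (c : E → U → ℝ) (γ : ℝ) (w : E → ℝ) (l : ℝ) : Prop :=
  ∀ x : E, ((w x + l : ℝ) : EReal) =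
    max (stepValue X P δ f γ w x) (⨆ ξ : U, (stepValue X P δ f γ w ξ + ((c x ξ : ℝ) : EReal)))

end

/-!
For `γ < 0` put `m w x = (1/γ) log E_x exp (γ (∫₀^δ f(X_s) ds + w(X_δ)))` (`certaintyEquivalent`)
and `T w x = max (m w x) (sup_{ξ ∈ U} (m w ξ + c x ξ))`. For `f` and `w` of finite `ω`-norm the
drift condition, which holds for every parameter of the entropic utility, makes all exponential
moments finite (`DriftBounds`). The Bellman equation is then the real equation `T w = w + l`
(`solvesBellman_iff`), and it is solved by a fixed point argument modulo constants.

*Contraction.* Since `γ < 0`, the certainty equivalent is concave in `w`, so its increment between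
`w₂` and `w₁` is at most the expectation of `w₁ - w₂` at time `δ` under the law tilted by
`exp (γ (∫ f + w₂))`. Under tilts with `w` in a fixed ball of the weighted space, the geometric
drift survives (`DriftBounds.exists_tilted_drift`), because the drift condition for large parameters
pays for the change of measure, and so does the local minorization
(`DriftBounds.exists_tilted_minorization`), by the Cauchy–Schwarz inequality. As in Harris' theorem,
the two give a contraction of the span seminorm with weight `2 + β ω x + β ω y`
(`DriftBounds.exists_tilted_contraction`). The maximum over shifts does not spoil it, since `ω` is
bounded on `U`. The weight `β` and the rate depend on the radius of the ball
(`DriftBounds.exists_bellman_contraction`). Two solutions lie in a common ball, which gives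
uniqueness (`LocalSpanContraction.unique`).

*Invariance.* For existence the iterates `Tⁿ 0` have to stay, up to constants, in one ball
(`DriftBounds.exists_bellmanBounds`). The option of shifting to `U` bounds `T w` from below by
the supremum of `m w` over `U` plus the least cost, and costs being negative, that supremum bounds
`T w` on `U`. The upper bound uses the sign of `γ` again. Far away, Jensen's
inequality bounds the certainty equivalent by the expectation, to which the drift applies. Where `ω`
is bounded, the set `U` is reached with probability bounded below, and a soft minimum cannot exceed
by much the values of `w` on `U`. The normalized iterates then form a Cauchy sequence, and their
limit is a fixed point up to a constant (`LocalSpanContraction.exists_fixed`).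

*Continuity.* That `T` preserves continuity rests on the Feller property alone, which concerns single
times, and so has to be extended to functionals of the path
(`IsFellerProcess.continuous_integral_exp`). For bounded `f` the exponential is expanded in moments
of the path integral, which by Fubini's theorem and the Markov property are integrals of iterated
transition semigroups. For `f` of finite `ω`-norm one truncates `f` at a large distance. The error is
uniform near the starting point because there is a positive function `g` vanishing at infinity with
`P_t g ≤ e^t g` (`IsFellerProcess.exists_excessive`): a path that ends in a compact set at time `δ`
spends little time far away, in expectation.
-/

set_option linter.unusedSectionVars false

noncomputable section

/-! ### Paths of right-continuous processes -/

/-- A process with right-continuous paths is jointly measurable in time and randomness: it is the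
limit of the processes sampled at the next point of the grid `(ℕ + 1) / (k + 1)`. -/
theorem measurable_uncurry_of_right_continuous {Ω E : Type*} [MeasurableSpace Ω]
    [TopologicalSpace E] [TopologicalSpace.PseudoMetrizableSpace E] [MeasurableSpace E]
    [BorelSpace E] {X : ℝ≥0 → Ω → E} (hX : ∀ t, Measurable (X t))
    (hr : ∀ o t, ContinuousWithinAt (fun s => X s o) (Set.Ici t) t) :
    Measurable (fun p : ℝ≥0 × Ω => X p.1 p.2) := by
  obtain ⟨r, hr_def⟩ : ∃ r : ℕ → ℝ≥0 → ℝ≥0,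
      ∀ k s, r k s = ((⌊s * (k + 1)⌋₊ : ℝ≥0) + 1) / (k + 1) := ⟨_, fun _ _ => rfl⟩
  have hr_ge : ∀ k s, s ≤ r k s := fun k s => by
    have : (0 : ℝ≥0) < k + 1 := by positivity
    rw [hr_def, le_div_iff₀ this]
    exact (Nat.lt_floor_add_one _).le
  have hr_le : ∀ k s, r k s ≤ s + 1 / (k + 1) := fun k s => by
    have h0 : (0 : ℝ≥0) < k + 1 := by positivity
    have : s + 1 / (k + 1) = (s * (k + 1) + 1) / (k + 1) := by field_simp
    rw [this, hr_def]
    have h1 : (⌊s * (k + 1)⌋₊ : ℝ≥0) ≤ s * (k + 1) := Nat.floor_le zero_le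
    gcongr
  refine measurable_of_tendsto_metrizable (f := fun k p => X (r k p.1) p.2) (fun k => ?_) ?_
  · have h1 : Measurable (fun q : ℕ × Ω => X (((q.1 : ℝ≥0) + 1) / (k + 1)) q.2) :=
      measurable_from_prod_countable_right fun m => hX (((m : ℝ≥0) + 1) / (k + 1))
    have h2 : Measurable (fun p : ℝ≥0 × Ω => (⌊p.1 * ((k : ℝ≥0) + 1)⌋₊, p.2)) := by
      refine Measurable.prodMk (Nat.measurable_floor.comp ?_) measurable_snd
      exact measurable_fst.mul_const _
    have h3 : (fun p : ℝ≥0 × Ω => X (r k p.1) p.2) =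
        (fun q : ℕ × Ω => X (((q.1 : ℝ≥0) + 1) / (k + 1)) q.2) ∘
          (fun p : ℝ≥0 × Ω => (⌊p.1 * ((k : ℝ≥0) + 1)⌋₊, p.2)) := by
      funext p
      rw [hr_def, Function.comp_apply]
    rw [h3]
    exact h1.comp h2
  · refine tendsto_pi_nhds.2 fun p => ?_
    refine (hr p.2 p.1).tendsto.comp (tendsto_nhdsWithin_iff.2 ⟨?_, .of_forall fun k => hr_ge k _⟩)
    refine tendsto_of_tendsto_of_tendsto_of_le_of_le tendsto_const_nhds ?_
      (fun k => hr_ge k p.1) (fun k => hr_le k p.1)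
    have : Tendsto (fun k : ℕ => (1 : ℝ≥0) / (k + 1)) atTop (𝓝 0) :=
      tendsto_one_div_add_atTop_nhds_zero_nat
    simpa using this.const_add p.1

/-- A path with one-sided limits is bounded on compact time intervals. -/
theorem exists_bound_of_cadlag {E : Type*} [TopologicalSpace E] {x : ℝ≥0 → E}
    (hr : ∀ t, ContinuousWithinAt x (Set.Ici t) t)
    (hl : ∀ t, ∃ l : E, Tendsto x (𝓝[<] t) (𝓝 l)) {g : E → ℝ} (hg : Continuous g) (T : ℝ≥0) :
    ∃ C : ℝ, ∀ s ≤ T, |g (x s)| ≤ C := by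
  have key : ∃ C : ℝ, ∀ s ∈ Set.Icc 0 T, |g (x s)| ≤ C := by
    refine isCompact_Icc.induction_on (p := fun S => ∃ C : ℝ, ∀ s ∈ S, |g (x s)| ≤ C)
      ⟨0, by simp⟩ ?_ ?_ ?_
    · rintro s t hst ⟨C, hC⟩
      exact ⟨C, fun u hu => hC u (hst hu)⟩
    · rintro s t ⟨C, hC⟩ ⟨D, hD⟩
      refine ⟨max C D, ?_⟩
      rintro u (hu | hu)
      · exact (hC u hu).trans (le_max_left _ _)
      · exact (hD u hu).trans (le_max_right _ _)
    · intro t _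
      obtain ⟨l, hl⟩ := hl t
      have h1 : ∀ᶠ s in 𝓝[<] t, |g (x s)| < |g l| + 1 :=
        ((hg.abs.tendsto l).comp hl).eventually_lt_const (by simp)
      have h2 : ∀ᶠ s in 𝓝[≥] t, |g (x s)| < |g (x t)| + 1 :=
        ((hg.abs.tendsto (x t)).comp (hr t).tendsto).eventually_lt_const (by simp)
      refine ⟨{s | |g (x s)| ≤ max (|g l| + 1) (|g (x t)| + 1)}, mem_nhdsWithin_of_mem_nhds ?_, _,
        fun s hs => hs⟩
      rw [← nhdsLT_sup_nhdsGE t]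
      refine mem_sup.2 ⟨?_, ?_⟩
      · filter_upwards [h1] with s hs using hs.le.trans (le_max_left _ _)
      · filter_upwards [h2] with s hs using hs.le.trans (le_max_right _ _)
  obtain ⟨C, hC⟩ := key
  exact ⟨C, fun s hs => hC s ⟨zero_le, hs⟩⟩

/-- Continuity at every point follows from approximation, near each point, by continuous functions
up to an arbitrarily small constant. -/
theorem continuous_of_forall_exists_abs_sub_le {E : Type*} [TopologicalSpace E] {f : E → ℝ}
    (h : ∀ x, ∀ ε > 0, ∃ F : E → ℝ, Continuous F ∧ ∀ᶠ y in 𝓝 x, |f y - F y| ≤ ε) :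
    Continuous f := by
  refine continuous_of_locally_uniform_approx_of_continuousAt fun x u hu => ?_
  obtain ⟨ε, hε, hu⟩ := Metric.mem_uniformity_dist.1 hu
  obtain ⟨F, hF, hfF⟩ := h x (ε / 2) (half_pos hε)
  refine ⟨_, hfF, F, hF.continuousAt, fun y hy => hu ?_⟩
  rw [Real.dist_eq]
  exact lt_of_le_of_lt hy (half_lt_self hε)

/-- A continuous cutoff function with values in `[0, 1]`, equal to `1` on the ball of radius `N` and
to `0` outside the ball of radius `N + 1`. -/
def cutoff {E : Type*} [NormedAddCommGroup E] (N : ℕ) (x : E) : ℝ :=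
  max 0 (min 1 (N + 1 - ‖x‖))

section Cutoff

variable {E : Type*} [NormedAddCommGroup E]

theorem continuous_cutoff (N : ℕ) : Continuous (cutoff N : E → ℝ) := by
  unfold cutoff
  fun_prop

theorem cutoff_nonneg (N : ℕ) (x : E) : 0 ≤ cutoff N x := le_max_left _ _

theorem cutoff_le_one (N : ℕ) (x : E) : cutoff N x ≤ 1 := max_le zero_le_one (min_le_left _ _)

theorem cutoff_eq_one {N : ℕ} {x : E} (h : ‖x‖ ≤ N) : cutoff N x = 1 := by
  rw [cutoff, min_eq_left (by linarith), max_eq_right zero_le_one]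

theorem cutoff_eq_zero {N : ℕ} {x : E} (h : (N : ℝ) + 1 ≤ ‖x‖) : cutoff N x = 0 := by
  rw [cutoff, max_eq_left ((min_le_right _ _).trans (by linarith))]

theorem tendsto_cutoff (x : E) : Tendsto (fun N => cutoff N x) atTop (𝓝 1) := by
  obtain ⟨N₀, hN₀⟩ := exists_nat_ge ‖x‖
  refine tendsto_const_nhds.congr' ?_
  filter_upwards [eventually_ge_atTop N₀] with N hN
  exact (cutoff_eq_one (hN₀.trans (by exact_mod_cast hN))).symm

theorem hasCompactSupport_cutoff [ProperSpace E] (N : ℕ) :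
    HasCompactSupport (cutoff N : E → ℝ) := by
  refine HasCompactSupport.intro (isCompact_closedBall (0 : E) (N + 1)) fun x hx => ?_
  refine cutoff_eq_zero ?_
  simpa using (not_le.1 (fun h => hx (mem_closedBall_zero_iff.2 h))).le

end Cutoff

/-! ### The transition semigroup on bounded continuous functions and the Markov property -/

namespace IsFellerProcess

variable {Ω E : Type*} [mΩ : MeasurableSpace Ω] [NormedAddCommGroup E] [ProperSpace E]
  [MeasurableSpace E] [BorelSpace E] {𝓕 : Filtration ℝ≥0 mΩ} {X : ℝ≥0 → Ω → E}
  {P : E → Measure Ω}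

theorem measurable (hX : IsFellerProcess 𝓕 X P) (t : ℝ≥0) : Measurable (X t) :=
  (hX.adapted t).mono (𝓕.le t) le_rfl

theorem measurable_uncurry (hX : IsFellerProcess 𝓕 X P) :
    Measurable (fun p : ℝ≥0 × Ω => X p.1 p.2) :=
  measurable_uncurry_of_right_continuous hX.measurable hX.right_continuous

theorem integrable_comp (hX : IsFellerProcess 𝓕 X P) {g : E → ℝ} (hg : Measurable g) {C : ℝ}
    (hC : ∀ x, |g x| ≤ C) (t : ℝ≥0) (x : E) : Integrable (fun o => g (X t o)) (P x) := by
  have := hX.isProbabilityMeasure x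
  exact Integrable.of_bound (hg.comp (hX.measurable t)).aestronglyMeasurable C
    (.of_forall fun o => hC _)

theorem continuous_integral_of_tendsto_zero (hX : IsFellerProcess 𝓕 X P) {g : E → ℝ}
    (hg : Continuous g) (h0 : Tendsto g (cocompact E) (𝓝 0)) (t : ℝ≥0) :
    Continuous fun x => ∫ o, g (X t o) ∂(P x) := by
  obtain ⟨h, hh⟩ := hX.feller t ⟨⟨g, hg⟩, h0⟩
  exact h.continuous.congr hh

theorem tendsto_integral_of_tendsto_zero (hX : IsFellerProcess 𝓕 X P) {g : E → ℝ}
    (hg : Continuous g) (h0 : Tendsto g (cocompact E) (𝓝 0)) (t : ℝ≥0) :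
    Tendsto (fun x => ∫ o, g (X t o) ∂(P x)) (cocompact E) (𝓝 0) := by
  obtain ⟨h, hh⟩ := hX.feller t ⟨⟨g, hg⟩, h0⟩
  exact h.zero_at_infty'.congr hh

/-- Tightness of the laws of `X t`, locally uniformly in the starting point. -/
theorem exists_eventually_integral_cutoff (hX : IsFellerProcess 𝓕 X P) (t : ℝ≥0) (x : E) {ε : ℝ}
    (hε : 0 < ε) : ∃ N : ℕ, ∀ᶠ y in 𝓝 x, ∫ o, (1 - cutoff N (X t o)) ∂(P y) ≤ ε := by
  have hP := hX.isProbabilityMeasure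
  have hint : ∀ N y, Integrable (fun o => cutoff N (X t o)) (P y) := fun N y =>
    hX.integrable_comp (continuous_cutoff N).measurable (C := 1)
      (fun z => by rw [abs_of_nonneg (cutoff_nonneg N z)]; exact cutoff_le_one N z) t y
  have hlim : Tendsto (fun N => ∫ o, cutoff N (X t o) ∂(P x)) atTop (𝓝 (∫ _, 1 ∂(P x))) := by
    refine tendsto_integral_of_dominated_convergence (fun _ => (1 : ℝ))
      (fun N => (hint N x).aestronglyMeasurable) (integrable_const _)
      (fun N => .of_forall fun o => ?_) (.of_forall fun o => tendsto_cutoff _)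
    rw [Real.norm_of_nonneg (cutoff_nonneg N _)]
    exact cutoff_le_one N _
  simp only [integral_const, probReal_univ, smul_eq_mul, mul_one] at hlim
  obtain ⟨N, hN⟩ := (hlim.eventually_const_lt (show 1 - ε < 1 by linarith)).exists
  refine ⟨N, ?_⟩
  have hcont : Continuous fun y => ∫ o, cutoff N (X t o) ∂(P y) :=
    hX.continuous_integral_of_tendsto_zero (continuous_cutoff N)
      (hasCompactSupport_cutoff N).is_zero_at_infty t
  filter_upwards [(hcont.tendsto x).eventually_const_lt hN] with y hy
  rw [integral_sub (integrable_const _) (hint N y)]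
  simp only [integral_const, probReal_univ, smul_eq_mul, mul_one]
  linarith

/-- The transition semigroup maps bounded continuous functions to continuous functions. -/
theorem continuous_integral_of_bounded (hX : IsFellerProcess 𝓕 X P) {g : E → ℝ}
    (hg : Continuous g) {C : ℝ} (hC : ∀ x, |g x| ≤ C) (t : ℝ≥0) :
    Continuous fun x => ∫ o, g (X t o) ∂(P x) := by
  have hP := hX.isProbabilityMeasure
  refine continuous_of_forall_exists_abs_sub_le fun x ε hε => ?_
  have hC0 : 0 ≤ C := (abs_nonneg _).trans (hC x)
  obtain ⟨N, hN⟩ := hX.exists_eventually_integral_cutoff t x (ε := ε / (C + 1)) (by positivity)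
  have hgc : Continuous fun z => g z * cutoff N z := hg.mul (continuous_cutoff N)
  have hbd : ∀ z, |g z * cutoff N z| ≤ C := fun z => by
    rw [abs_mul, abs_of_nonneg (cutoff_nonneg N z)]
    simpa using mul_le_mul (hC z) (cutoff_le_one N z) (cutoff_nonneg N z) hC0
  have hcb : ∀ z : E, |1 - cutoff N z| ≤ 1 := fun z => by
    rw [abs_of_nonneg (sub_nonneg.2 (cutoff_le_one N z))]
    linarith [cutoff_nonneg N z]
  refine ⟨_, hX.continuous_integral_of_tendsto_zero hgc
    (HasCompactSupport.mul_left (hasCompactSupport_cutoff N)).is_zero_at_infty t, ?_⟩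
  filter_upwards [hN] with y hy
  rw [← integral_sub (hX.integrable_comp hg.measurable hC t y)
    (hX.integrable_comp hgc.measurable hbd t y)]
  calc |∫ o, (g (X t o) - g (X t o) * cutoff N (X t o)) ∂(P y)|
      ≤ ∫ o, C * (1 - cutoff N (X t o)) ∂(P y) := by
        refine norm_integral_le_of_norm_le (f := fun o => g (X t o) - g (X t o) * cutoff N (X t o))
          ((hX.integrable_comp (g := fun z => 1 - cutoff N z)
          (by have := continuous_cutoff (E := E) N; fun_prop) hcb t y).const_mul C)
          (.of_forall fun o => ?_)
        have : g (X t o) - g (X t o) * cutoff N (X t o)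
            = g (X t o) * (1 - cutoff N (X t o)) := by ring
        rw [this, Real.norm_eq_abs, abs_mul,
          abs_of_nonneg (sub_nonneg.2 (cutoff_le_one N (X t o)))]
        exact mul_le_mul_of_nonneg_right (hC _) (sub_nonneg.2 (cutoff_le_one N _))
    _ = C * ∫ o, (1 - cutoff N (X t o)) ∂(P y) := integral_const_mul _ _
    _ ≤ C * (ε / (C + 1)) := by gcongr
    _ ≤ ε := by
        rw [mul_div_assoc', div_le_iff₀ (by positivity)]
        nlinarith

/-- The transition probabilities form a measurable kernel. -/
theorem measurable_map (hX : IsFellerProcess 𝓕 X P) (t : ℝ≥0) :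
    Measurable fun x => (P x).map (X t) := by
  have hP := hX.isProbabilityMeasure
  have hmap : ∀ x, IsProbabilityMeasure ((P x).map (X t)) := fun x =>
    Measure.isProbabilityMeasure_map (hX.measurable t).aemeasurable
  refine Measurable.measure_of_isPiSystem_of_isProbabilityMeasure
    (S := {s : Set E | IsClosed s}) ?_ isPiSystem_isClosed fun F hF => ?_
  · rw [BorelSpace.measurable_eq (α := E), borel_eq_generateFrom_isClosed]
  · refine measurable_of_tendsto_metrizable
      (f := fun n x => ∫⁻ y, (hF.apprSeq n y : ℝ≥0∞) ∂((P x).map (X t))) (fun n => ?_)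
      (tendsto_pi_nhds.2 fun x =>
        HasOuterApproxClosed.tendsto_lintegral_apprSeq hF _)
    have hcont : Continuous fun y : E => (hF.apprSeq n y : ℝ) :=
      NNReal.continuous_coe.comp (hF.apprSeq n).continuous
    have hbd : ∀ y, |(hF.apprSeq n y : ℝ)| ≤ 1 := fun y => by
      rw [abs_of_nonneg (NNReal.coe_nonneg _)]
      exact_mod_cast HasOuterApproxClosed.apprSeq_apply_le_one hF n y
    have heq : (fun x => ∫⁻ y, (hF.apprSeq n y : ℝ≥0∞) ∂((P x).map (X t)))
        = fun x => ENNReal.ofReal (∫ o, (hF.apprSeq n (X t o) : ℝ) ∂(P x)) := by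
      funext x
      rw [lintegral_map (by fun_prop) (hX.measurable t),
        ofReal_integral_eq_lintegral_ofReal (hX.integrable_comp hcont.measurable hbd t x)
          (.of_forall fun _ => NNReal.coe_nonneg _)]
      simp
    rw [heq]
    exact (hX.continuous_integral_of_bounded hcont hbd t).measurable.ennreal_ofReal

theorem measurable_lintegral (hX : IsFellerProcess 𝓕 X P) {G : E → ℝ≥0∞} (hG : Measurable G)
    (t : ℝ≥0) : Measurable fun x => ∫⁻ o, G (X t o) ∂(P x) := by
  simp_rw [← lintegral_map hG (hX.measurable t)]
  exact (Measure.measurable_lintegral hG).comp (hX.measurable_map t)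

/-- The Markov property for nonnegative functions of the past and of the state at a later time. -/
theorem lintegral_mul_comp_add (hX : IsFellerProcess 𝓕 X P) (x : E) (s t : ℝ≥0) {Y : Ω → ℝ≥0∞}
    (hY : Measurable[𝓕 s] Y) {G : E → ℝ≥0∞} (hG : Measurable G) :
    ∫⁻ o, Y o * G (X (s + t) o) ∂(P x) =
      ∫⁻ o, Y o * ∫⁻ o', G (X t o') ∂(P (X s o)) ∂(P x) := by
  have hset : ∀ A : Set Ω, MeasurableSet[𝓕 s] A → ∫⁻ o in A, G (X (s + t) o) ∂(P x) =
      ∫⁻ o in A, ∫⁻ o', G (X t o') ∂(P (X s o)) ∂(P x) := by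
    intro A hA
    have hA' : MeasurableSet A := 𝓕.le s A hA
    have hκ : Measurable fun o => (P (X s o)).map (X t) :=
      (hX.measurable_map t).comp (hX.measurable s)
    have hm : ((P x).restrict A).map (X (s + t))
        = ((P x).restrict A).bind fun o => (P (X s o)).map (X t) := by
      ext B hB
      rw [Measure.map_apply (hX.measurable _) hB, Measure.bind_apply hB hκ.aemeasurable,
        Measure.restrict_apply ((hX.measurable _) hB), Set.inter_comm, hX.markov x s t A B hA hB]
      exact lintegral_congr fun o => (Measure.map_apply (hX.measurable t) hB).symm
    rw [← lintegral_map hG (hX.measurable (s + t)), hm,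
      Measure.lintegral_bind hκ.aemeasurable hG.aemeasurable]
    exact lintegral_congr fun o => lintegral_map hG (hX.measurable t)
  have hG1 : Measurable fun o => G (X (s + t) o) := hG.comp (hX.measurable _)
  have hG2 : Measurable fun o => ∫⁻ o', G (X t o') ∂(P (X s o)) :=
    (hX.measurable_lintegral hG t).comp (hX.measurable s)
  have hle := 𝓕.le s
  refine @Measurable.ennreal_induction Ω (𝓕 s) (fun Y => ∫⁻ o, Y o * G (X (s + t) o) ∂(P x) =
      ∫⁻ o, Y o * ∫⁻ o', G (X t o') ∂(P (X s o)) ∂(P x)) ?_ ?_ ?_ Y hY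
  · intro a A hA
    have h : ∀ H : Ω → ℝ≥0∞, Measurable H → ∫⁻ o, A.indicator (fun _ => a) o * H o ∂(P x)
        = a * ∫⁻ o in A, H o ∂(P x) := by
      intro H hH
      rw [← lintegral_const_mul a hH, ← lintegral_indicator (hle A hA)]
      refine lintegral_congr fun o => ?_
      by_cases ho : o ∈ A <;> simp [ho]
    rw [h _ hG1, h _ hG2, hset A hA]
  · intro f g _ hf hg hf' hg'
    have hfm : Measurable f := hf.mono hle le_rfl
    have h1 : Measurable fun o => f o * G (X (s + t) o) := hfm.mul hG1
    have h2 : Measurable fun o => f o * ∫⁻ o', G (X t o') ∂(P (X s o)) := hfm.mul hG2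
    simp only [Pi.add_apply, add_mul]
    rw [lintegral_add_left h1, lintegral_add_left h2, hf', hg']
  · intro f hf hmono hf'
    have hfm : ∀ n, Measurable (f n) := fun n => (hf n).mono hle le_rfl
    have h1 : ∀ n, Measurable fun o => f n o * G (X (s + t) o) := fun n => (hfm n).mul hG1
    have h2 : ∀ n, Measurable fun o => f n o * ∫⁻ o', G (X t o') ∂(P (X s o)) :=
      fun n => (hfm n).mul hG2
    simp only [ENNReal.iSup_mul]
    rw [lintegral_iSup h1 fun i j hij o => mul_le_mul_left (hmono hij o) _,
      lintegral_iSup h2 fun i j hij o => mul_le_mul_left (hmono hij o) _]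
    simp_rw [hf']

/-- The Markov property for bounded nonnegative functions. -/
theorem integral_mul_comp_add (hX : IsFellerProcess 𝓕 X P) (x : E) (s t : ℝ≥0) {Y : Ω → ℝ}
    (hY : Measurable[𝓕 s] Y) (hY0 : ∀ o, 0 ≤ Y o) {G : E → ℝ} (hG : Measurable G)
    (hG0 : ∀ y, 0 ≤ G y) {C : ℝ} (hGC : ∀ y, |G y| ≤ C) :
    ∫ o, Y o * G (X (s + t) o) ∂(P x) = ∫ o, Y o * ∫ o', G (X t o') ∂(P (X s o)) ∂(P x) := by
  have hYm : Measurable Y := hY.mono (𝓕.le s) le_rfl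
  have hinner : ∀ y, ENNReal.ofReal (∫ o', G (X t o') ∂(P y))
      = ∫⁻ o', ENNReal.ofReal (G (X t o')) ∂(P y) := fun y =>
    ofReal_integral_eq_lintegral_ofReal (hX.integrable_comp hG hGC t y)
      (.of_forall fun _ => hG0 _)
  have hinner_meas : Measurable fun y => ∫ o', G (X t o') ∂(P y) := by
    have : (fun y => ∫ o', G (X t o') ∂(P y))
        = fun y => (∫⁻ o', ENNReal.ofReal (G (X t o')) ∂(P y)).toReal := by
      funext y
      rw [← hinner, ENNReal.toReal_ofReal (integral_nonneg fun _ => hG0 _)]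
    rw [this]
    exact (hX.measurable_lintegral hG.ennreal_ofReal t).ennreal_toReal
  rw [integral_eq_lintegral_of_nonneg_ae (.of_forall fun o => mul_nonneg (hY0 o) (hG0 _))
      (hYm.mul (hG.comp (hX.measurable _))).aestronglyMeasurable,
    integral_eq_lintegral_of_nonneg_ae
      (.of_forall fun o => mul_nonneg (hY0 o) (integral_nonneg fun _ => hG0 _))
      (hYm.mul (hinner_meas.comp (hX.measurable s))).aestronglyMeasurable]
  simp_rw [ENNReal.ofReal_mul (hY0 _), hinner]
  rw [hX.lintegral_mul_comp_add x s t (Y := fun o => ENNReal.ofReal (Y o)) hY.ennreal_ofReal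
    hG.ennreal_ofReal]

end IsFellerProcess

/-! ### Exponential functionals of bounded path integrals -/

namespace IsFellerProcess

variable {Ω E : Type*} [mΩ : MeasurableSpace Ω] [NormedAddCommGroup E] [ProperSpace E]
  [MeasurableSpace E] [BorelSpace E] {𝓕 : Filtration ℝ≥0 mΩ} {X : ℝ≥0 → Ω → E}
  {P : E → Measure Ω}

/-- Joint moments at finitely many times depend continuously on the starting point: the latest
factor is absorbed into the state at the previous time by the Markov property. -/
theorem continuous_integral_prod (hX : IsFellerProcess 𝓕 X P) {h : E → ℝ} (hh : Continuous h)
    (h0 : ∀ x, 0 ≤ h x) {C : ℝ} (hC : ∀ x, h x ≤ C) {ι : Type*} (s : Finset ι) (t : ι → ℝ≥0) :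
    ∀ T, (∀ i ∈ s, t i ≤ T) → ∀ g : E → ℝ, Continuous g → (∀ x, 0 ≤ g x) →
      (∃ D, ∀ x, g x ≤ D) →
      Continuous fun x => ∫ o, (∏ i ∈ s, h (X (t i) o)) * g (X T o) ∂(P x) := by
  classical
  have hP := hX.isProbabilityMeasure
  induction s using Finset.induction_on_max_value t with
  | empty =>
    rintro T - g hg g0 ⟨D, hD⟩
    simp only [Finset.prod_empty, one_mul]
    exact hX.continuous_integral_of_bounded hg
      (fun x => by rw [abs_of_nonneg (g0 x)]; exact hD x) T
  | insert a s ha hmax ih =>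
    rintro T hT g hg g0 ⟨D, hD⟩
    have hgD : ∀ x, |g x| ≤ D := fun x => by rw [abs_of_nonneg (g0 x)]; exact hD x
    have haT : t a + (T - t a) = T := add_tsub_cancel_of_le (hT a (Finset.mem_insert_self a s))
    have key : ∀ x, ∫ o, (∏ i ∈ insert a s, h (X (t i) o)) * g (X T o) ∂(P x)
        = ∫ o, (∏ i ∈ s, h (X (t i) o)) *
          (fun y => h y * ∫ o', g (X (T - t a) o') ∂(P y)) (X (t a) o) ∂(P x) := by
      intro x
      have hY : Measurable[𝓕 (t a)] fun o => ∏ i ∈ insert a s, h (X (t i) o) := by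
        refine Finset.measurable_prod _ fun i hi => ?_
        have hia : t i ≤ t a := by
          rcases Finset.mem_insert.1 hi with rfl | hi
          · exact le_rfl
          · exact hmax i hi
        exact hh.measurable.comp ((hX.adapted (t i)).mono (𝓕.mono hia) le_rfl)
      have := hX.integral_mul_comp_add x (t a) (T - t a) hY
        (fun o => Finset.prod_nonneg fun i _ => h0 _) hg.measurable g0 hgD
      rw [haT] at this
      rw [this]
      refine integral_congr_ae (.of_forall fun o => ?_)
      simp only [Finset.prod_insert ha]
      ring
    simp_rw [key]
    refine ih (t a) hmax _ (hh.mul (hX.continuous_integral_of_bounded hg hgD _))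
      (fun x => mul_nonneg (h0 x) (integral_nonneg fun _ => g0 _)) ⟨C * D, fun x => ?_⟩
    refine mul_le_mul (hC x) ?_ (integral_nonneg fun _ => g0 _) ((h0 x).trans (hC x))
    calc ∫ o', g (X (T - t a) o') ∂(P x) ≤ ∫ _, D ∂(P x) :=
          integral_mono (hX.integrable_comp hg.measurable hgD _ _) (integrable_const _)
            fun o => hD _
      _ = D := by simp

theorem measurable_comp_toNNReal (hX : IsFellerProcess 𝓕 X P) :
    Measurable (fun p : ℝ × Ω => X p.1.toNNReal p.2) := by
  have h : Measurable (fun p : ℝ × Ω => (p.1.toNNReal, p.2)) :=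
    (measurable_real_toNNReal.comp measurable_fst).prodMk measurable_snd
  exact hX.measurable_uncurry.comp h

theorem measurable_pathIntegral (hX : IsFellerProcess 𝓕 X P) {f : E → ℝ} (hf : Measurable f)
    (δ : ℝ≥0) : Measurable (pathIntegral X δ f) := by
  have h : StronglyMeasurable (fun p : Ω × ℝ => f (X p.2.toNNReal p.1)) :=
    (hf.comp (hX.measurable_comp_toNNReal.comp measurable_swap)).stronglyMeasurable
  unfold pathIntegral
  simp_rw [intervalIntegral.integral_of_le δ.coe_nonneg]
  exact h.integral_prod_right.measurable

theorem intervalIntegrable_comp (hX : IsFellerProcess 𝓕 X P) {f : E → ℝ} (hf : Continuous f)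
    (δ : ℝ≥0) (o : Ω) :
    IntervalIntegrable (fun s : ℝ => f (X s.toNNReal o)) volume 0 δ := by
  obtain ⟨C, hC⟩ := exists_bound_of_cadlag (hX.right_continuous o) (hX.left_limits o) hf δ
  rw [intervalIntegrable_iff_integrableOn_Ioc_of_le δ.coe_nonneg]
  have hm : Measurable (fun s : ℝ => f (X s.toNNReal o)) :=
    hf.measurable.comp (hX.measurable_comp_toNNReal.comp (measurable_id.prodMk measurable_const))
  refine Measure.integrableOn_of_bounded (M := C) (by simp) hm.aestronglyMeasurable ?_
  refine (ae_restrict_iff' measurableSet_Ioc).2 (.of_forall fun s hs => hC _ ?_)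
  exact Real.toNNReal_le_iff_le_coe.2 hs.2

/-- Moments of the path integral of a bounded function depend continuously on the starting
point. -/
theorem continuous_integral_pow_mul (hX : IsFellerProcess 𝓕 X P) {h : E → ℝ} (hh : Continuous h)
    (h0 : ∀ x, 0 ≤ h x) {C : ℝ} (hC : ∀ x, h x ≤ C) {g : E → ℝ} (hg : Continuous g)
    (g0 : ∀ x, 0 ≤ g x) {D : ℝ} (hD : ∀ x, g x ≤ D) (δ : ℝ≥0) (k : ℕ) :
    Continuous fun x => ∫ o, pathIntegral X δ h o ^ k * g (X δ o) ∂(P x) := by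
  have hP := hX.isProbabilityMeasure
  set lam : Measure (Fin k → ℝ) := Measure.pi fun _ => volume.restrict (Set.Ioc (0 : ℝ) δ)
    with hlam
  let F : Ω → (Fin k → ℝ) → ℝ := fun o s =>
    (∏ i, h (X (min (s i).toNNReal δ) o)) * g (X δ o)
  have hC0 : ∀ x : E, 0 ≤ C := fun x => (h0 x).trans (hC x)
  have hFm : Measurable (Function.uncurry F) := by
    refine (Finset.measurable_prod _ fun i _ => ?_).mul
      (hg.measurable.comp ((hX.measurable δ).comp measurable_fst))
    have hi : Measurable fun p : Ω × (Fin k → ℝ) => (min (p.2 i).toNNReal δ, p.1) :=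
      (((measurable_real_toNNReal.comp ((measurable_pi_apply i).comp measurable_snd))).min
        measurable_const).prodMk measurable_fst
    exact hh.measurable.comp (hX.measurable_uncurry.comp hi)
  have hFb : ∀ o s, ‖F o s‖ ≤ C ^ k * D := fun o s => by
    have hp : ∏ i, h (X (min (s i).toNNReal δ) o) ≤ C ^ k := by
      calc ∏ i, h (X (min (s i).toNNReal δ) o) ≤ ∏ _i : Fin k, C :=
            Finset.prod_le_prod (fun _ _ => h0 _) fun _ _ => hC _
        _ = C ^ k := by simp
    rw [Real.norm_of_nonneg (mul_nonneg (Finset.prod_nonneg fun _ _ => h0 _) (g0 _))]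
    exact mul_le_mul hp (hD _) (g0 _)
      (pow_nonneg (hC0 (X δ o)) k)
  have hFint : ∀ x, Integrable (Function.uncurry F) ((P x).prod lam) := fun x =>
    Integrable.of_bound hFm.aestronglyMeasurable (C ^ k * D) (.of_forall fun p => hFb _ _)
  have hpow : ∀ o, pathIntegral X δ h o ^ k * g (X δ o) = ∫ s, F o s ∂lam := by
    intro o
    have h1 : pathIntegral X δ h o
        = ∫ s in Set.Ioc (0 : ℝ) δ, h (X (min s.toNNReal δ) o) := by
      rw [pathIntegral, intervalIntegral.integral_of_le δ.coe_nonneg]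
      refine setIntegral_congr_fun measurableSet_Ioc fun s hs => ?_
      simp only [min_eq_left (Real.toNNReal_le_iff_le_coe.2 hs.2)]
    rw [integral_mul_const, h1]
    congr 1
    have := integral_fintype_prod_eq_pow (ι := Fin k)
      (μ := volume.restrict (Set.Ioc (0 : ℝ) δ)) (fun s : ℝ => h (X (min s.toNNReal δ) o))
    rw [Fintype.card_fin] at this
    exact this.symm
  have hswap : ∀ x, ∫ o, pathIntegral X δ h o ^ k * g (X δ o) ∂(P x)
      = ∫ s, ∫ o, F o s ∂(P x) ∂lam := fun x => by
    simp_rw [hpow]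
    exact integral_integral_swap (hFint x)
  simp_rw [hswap]
  refine continuous_of_dominated (bound := fun _ => C ^ k * D) (fun x => ?_)
    (fun x => .of_forall fun s => ?_) (integrable_const _) (.of_forall fun s => ?_)
  · exact (hFint x).swap.integral_prod_left.aestronglyMeasurable
  · refine (norm_integral_le_of_norm_le_const (.of_forall fun o => hFb o s)).trans ?_
    simp
  · exact hX.continuous_integral_prod hh h0 hC Finset.univ (fun i => min (s i).toNNReal δ) δ
      (fun i _ => min_le_right _ _) g hg g0 ⟨D, hD⟩

/-- Term-by-term integration of the power series of the exponential of a bounded function. -/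
theorem _root_.MeasureTheory.integral_exp_mul_eq_tsum {μ : Measure Ω} [IsProbabilityMeasure μ]
    {A G : Ω → ℝ} (hA : Measurable A) (hG : Measurable G) {B D : ℝ} (hAB : ∀ o, |A o| ≤ B)
    (hGD : ∀ o, |G o| ≤ D) :
    (∀ k : ℕ, |∫ o, A o ^ k * G o ∂μ| ≤ B ^ k * D) ∧
    ∫ o, Real.exp (A o) * G o ∂μ = ∑' k : ℕ, (∫ o, A o ^ k * G o ∂μ) / k.factorial := by
  have hterm : ∀ (k : ℕ) o, ‖A o ^ k * G o‖ ≤ B ^ k * D := fun k o => by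
    rw [norm_mul, norm_pow]
    have hB : 0 ≤ B := (abs_nonneg _).trans (hAB o)
    exact mul_le_mul (pow_le_pow_left₀ (abs_nonneg _) (hAB o) k) (hGD o) (abs_nonneg _)
      (pow_nonneg hB k)
  have hle : ∀ k : ℕ, |∫ o, A o ^ k * G o ∂μ| ≤ B ^ k * D := fun k => by
    have := norm_integral_le_of_norm_le_const (μ := μ) (.of_forall fun o => hterm k o)
    simpa using this
  refine ⟨hle, ?_⟩
  have hterm' : ∀ (k : ℕ) o, ‖A o ^ k * G o / k.factorial‖ ≤ B ^ k / k.factorial * D :=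
    fun k o => by
      rw [norm_div, Real.norm_natCast, div_mul_eq_mul_div]
      exact div_le_div_of_nonneg_right (hterm k o) (Nat.cast_nonneg _)
  have hmeas : ∀ k : ℕ, Measurable fun o => A o ^ k * G o / k.factorial := fun k => by fun_prop
  have hsum := hasSum_integral_of_summable_integral_norm (μ := μ)
    (F := fun (k : ℕ) o => A o ^ k * G o / k.factorial)
    (fun k => Integrable.of_bound (hmeas k).aestronglyMeasurable _
      (.of_forall fun o => hterm' k o))
    (Summable.of_nonneg_of_le (fun k => integral_nonneg fun _ => norm_nonneg _) (fun k => by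
      have := norm_integral_le_of_norm_le_const (μ := μ)
        (.of_forall fun o => (norm_norm _).trans_le (hterm' k o))
      simpa using (le_abs_self _).trans this)
      ((Real.summable_pow_div_factorial B).mul_right D))
  simp_rw [integral_div] at hsum
  rw [hsum.tsum_eq]
  refine integral_congr_ae (.of_forall fun o => ?_)
  have : ∀ k : ℕ, A o ^ k * G o / k.factorial = A o ^ k / k.factorial * G o := fun k => by ring
  simp only [this, tsum_mul_right, Real.exp_eq_exp_ℝ, NormedSpace.exp_eq_tsum_div]

/-- Exponential functionals of the path integral of a bounded function depend continuously on the
starting point, by expansion into the power series of the exponential. -/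
theorem continuous_integral_exp_mul_of_bounded (hX : IsFellerProcess 𝓕 X P) {f : E → ℝ}
    (hf : Continuous f) {C : ℝ} (hC : ∀ x, |f x| ≤ C) {g : E → ℝ} (hg : Continuous g)
    (g0 : ∀ x, 0 ≤ g x) {D : ℝ} (hD : ∀ x, g x ≤ D) (δ : ℝ≥0) :
    Continuous fun x => ∫ o, Real.exp (pathIntegral X δ f o) * g (X δ o) ∂(P x) := by
  have hP := hX.isProbabilityMeasure
  -- Adding the constant `C` makes the integrand nonnegative.
  have hfC : Continuous fun x => f x + C := hf.add_const C
  have h0 : ∀ x, 0 ≤ f x + C := fun x => by linarith [neg_abs_le (f x), hC x]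
  have h2C : ∀ x, f x + C ≤ 2 * C := fun x => by linarith [le_abs_self (f x), hC x]
  obtain ⟨A, hA⟩ : ∃ A : Ω → ℝ, A = pathIntegral X δ fun x => f x + C := ⟨_, rfl⟩
  have hAm : Measurable A := hA ▸ hX.measurable_pathIntegral hfC.measurable δ
  obtain ⟨B, hB⟩ : ∃ B : ℝ, B = δ * (2 * C) := ⟨_, rfl⟩
  have hAB : ∀ o, |A o| ≤ B := fun o => by
    have hA0 : 0 ≤ pathIntegral X δ (fun x => f x + C) o :=
      intervalIntegral.integral_nonneg δ.coe_nonneg fun s _ => h0 _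
    rw [hA, abs_of_nonneg hA0]
    calc pathIntegral X δ (fun x => f x + C) o ≤ ∫ _ in (0 : ℝ)..δ, 2 * C :=
          intervalIntegral.integral_mono_on δ.coe_nonneg (hX.intervalIntegrable_comp hfC δ o)
            intervalIntegrable_const fun s _ => h2C _
      _ = B := by simp [hB, mul_left_comm]
  have hpath : ∀ o, pathIntegral X δ f o = -(δ * C) + A o := fun o => by
    rw [hA, pathIntegral, pathIntegral, intervalIntegral.integral_add
      (hX.intervalIntegrable_comp hf δ o) intervalIntegrable_const]
    simp
  have hgD : ∀ o, |g (X δ o)| ≤ D := fun o => by rw [abs_of_nonneg (g0 _)]; exact hD _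
  have hseries : ∀ x, (∀ k : ℕ, |∫ o, A o ^ k * g (X δ o) ∂(P x)| ≤ B ^ k * D) ∧
      ∫ o, Real.exp (A o) * g (X δ o) ∂(P x)
        = ∑' k : ℕ, (∫ o, A o ^ k * g (X δ o) ∂(P x)) / k.factorial := fun x =>
    integral_exp_mul_eq_tsum hAm (hg.measurable.comp (hX.measurable δ)) hAB hgD
  have hcont : Continuous fun x => ∑' k : ℕ, (∫ o, A o ^ k * g (X δ o) ∂(P x)) / k.factorial := by
    have hs : Summable fun k : ℕ => B ^ k / (k.factorial : ℝ) * D :=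
      (Real.summable_pow_div_factorial B).mul_right D
    refine continuous_tsum (fun k => ?_) hs fun k x => ?_
    · have hk := hX.continuous_integral_pow_mul hfC h0 h2C hg g0 hD δ k
      have hk' : Continuous fun x => ∫ o, A o ^ k * g (X δ o) ∂(P x) :=
        hk.congr fun x => by simp only [hA]
      exact hk'.div_const (k.factorial : ℝ)
    · rw [norm_div, Real.norm_natCast, div_mul_eq_mul_div]
      exact div_le_div_of_nonneg_right ((hseries x).1 k) (Nat.cast_nonneg _)
  refine (hcont.const_mul (Real.exp (-(δ * C)))).congr fun x => ?_
  simp_rw [hpath, Real.exp_add, mul_assoc]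
  rw [integral_const_mul, (hseries x).2]

end IsFellerProcess

/-! ### An excessive function vanishing at infinity -/

namespace IsFellerProcess

variable {Ω E : Type*} [mΩ : MeasurableSpace Ω] [NormedAddCommGroup E] [ProperSpace E]
  [MeasurableSpace E] [BorelSpace E] {𝓕 : Filtration ℝ≥0 mΩ} {X : ℝ≥0 → Ω → E}
  {P : E → Measure Ω}

/-- There is a strictly positive continuous function `g`, vanishing at infinity, which the semigroup
`P_t` multiplies at most by `exp t`. It is the resolvent `∫₀^∞ exp (-s) P_s h ds` of a strictly
positive `h` vanishing at infinity. Since `g` is bounded below on compact sets, it controls,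
uniformly over bounded times, the probability of returning from far away to a compact set. -/
theorem exists_excessive (hX : IsFellerProcess 𝓕 X P) :
    ∃ g : E → ℝ, Continuous g ∧ (∀ x, 0 < g x) ∧ (∀ x, g x ≤ 1) ∧
      Tendsto g (cocompact E) (𝓝 0) ∧
      ∀ (t : ℝ≥0) (x : E), ∫ o, g (X t o) ∂(P x) ≤ Real.exp t * g x := by
  have hP := hX.isProbabilityMeasure
  obtain ⟨h, hh⟩ : ∃ h : E → ℝ, ∀ x, h x = Real.exp (-‖x‖) := ⟨_, fun _ => rfl⟩
  have hcont : Continuous h := by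
    rw [show h = fun x => Real.exp (-‖x‖) from funext hh]
    fun_prop
  have h_pos : ∀ x, 0 < h x := fun x => hh x ▸ Real.exp_pos _
  have h_le : ∀ x, h x ≤ 1 := fun x => by
    rw [hh, Real.exp_le_one_iff]
    simp
  have h_abs : ∀ x, |h x| ≤ 1 := fun x => by rw [abs_of_pos (h_pos x)]; exact h_le x
  have h_zero : Tendsto h (cocompact E) (𝓝 0) := by
    rw [show h = fun x => Real.exp (-‖x‖) from funext hh]
    exact Real.tendsto_exp_neg_atTop_nhds_zero.comp tendsto_norm_cocompact_atTop
  obtain ⟨u, hu⟩ : ∃ u : E → ℝ → ℝ, ∀ x s, u x s = ∫ o, h (X s.toNNReal o) ∂(P x) :=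
    ⟨_, fun _ _ => rfl⟩
  have hint : ∀ (t : ℝ≥0) x, Integrable (fun o => h (X t o)) (P x) := fun t x =>
    hX.integrable_comp hcont.measurable h_abs t x
  have u_pos : ∀ x s, 0 < u x s := fun x s => by
    rw [hu, integral_pos_iff_support_of_nonneg (fun o => (h_pos _).le) (hint _ _)]
    have : Function.support (fun o => h (X s.toNNReal o)) = Set.univ :=
      Set.eq_univ_of_forall fun o => (h_pos _).ne'
    simp [this]
  have u_le : ∀ x s, u x s ≤ 1 := fun x s => by
    rw [hu]
    calc ∫ o, h (X s.toNNReal o) ∂(P x) ≤ ∫ _, 1 ∂(P x) :=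
          integral_mono (hint _ _) (integrable_const _) fun o => h_le _
      _ = 1 := by simp
  have u_cont : ∀ s, Continuous fun x => u x s := fun s => by
    simp_rw [hu]
    exact hX.continuous_integral_of_bounded hcont h_abs _
  have u_meas : ∀ x, Measurable (u x) := fun x => by
    have : StronglyMeasurable fun p : ℝ × Ω => h (X p.1.toNNReal p.2) :=
      (hcont.measurable.comp hX.measurable_comp_toNNReal).stronglyMeasurable
    rw [show u x = fun s => ∫ o, h (X s.toNNReal o) ∂(P x) from funext (hu x)]
    exact this.integral_prod_right.measurable
  have u_meas2 : Measurable (Function.uncurry u) :=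
    measurable_uncurry_of_continuous_of_measurable u_cont u_meas
  have hexp : IntegrableOn (fun s : ℝ => Real.exp (-s)) (Set.Ioi 0) := integrableOn_exp_neg_Ioi 0
  have hF_meas : ∀ x, Measurable fun s => Real.exp (-s) * u x s := fun x =>
    (by fun_prop : Measurable fun s : ℝ => Real.exp (-s)).mul (u_meas x)
  have hF_le : ∀ x s, ‖Real.exp (-s) * u x s‖ ≤ Real.exp (-s) := fun x s => by
    rw [Real.norm_of_nonneg (mul_nonneg (Real.exp_pos _).le (u_pos _ _).le)]
    exact mul_le_of_le_one_right (Real.exp_pos _).le (u_le _ _)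
  have hF_int : ∀ x, IntegrableOn (fun s => Real.exp (-s) * u x s) (Set.Ioi 0) := fun x =>
    hexp.mono' (hF_meas x).aestronglyMeasurable (.of_forall (hF_le x))
  have hF_nonneg : ∀ x s, 0 ≤ Real.exp (-s) * u x s := fun x s =>
    mul_nonneg (Real.exp_pos _).le (u_pos _ _).le
  obtain ⟨g, hg⟩ : ∃ g : E → ℝ, ∀ x, g x = ∫ s in Set.Ioi (0 : ℝ), Real.exp (-s) * u x s :=
    ⟨_, fun _ => rfl⟩
  have hg' : g = fun x => ∫ s in Set.Ioi (0 : ℝ), Real.exp (-s) * u x s := funext hg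
  have g_cont : Continuous g := by
    rw [hg']
    exact continuous_of_dominated (fun x => (hF_meas x).aestronglyMeasurable)
      (fun x => .of_forall (hF_le x)) hexp
      (.of_forall fun s => continuous_const.mul (u_cont s))
  refine ⟨g, g_cont, fun x => ?_, fun x => ?_, ?_, fun t x => ?_⟩
  · rw [hg, setIntegral_pos_iff_support_of_nonneg_ae (.of_forall (hF_nonneg x)) (hF_int x)]
    have : Function.support (fun s => Real.exp (-s) * u x s) = Set.univ :=
      Set.eq_univ_of_forall fun s => (mul_pos (Real.exp_pos _) (u_pos _ _)).ne'
    simp [this]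
  · calc g x ≤ ∫ s in Set.Ioi (0 : ℝ), Real.exp (-s) := by
          rw [hg]
          exact integral_mono (hF_int x) hexp fun s => (le_abs_self _).trans (hF_le x s)
      _ = 1 := integral_exp_neg_Ioi_zero
  · rw [hg', ← Metric.cobounded_eq_cocompact, ← comap_norm_atTop]
    rw [show 𝓝 (0 : ℝ) = 𝓝 (∫ s in Set.Ioi (0 : ℝ), (0 : ℝ)) by simp]
    refine tendsto_integral_filter_of_dominated_convergence (fun s => Real.exp (-s))
      (.of_forall fun x => (hF_meas x).aestronglyMeasurable)
      (.of_forall fun x => .of_forall (hF_le x)) hexp (.of_forall fun s => ?_)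
    rw [comap_norm_atTop, Metric.cobounded_eq_cocompact]
    simp_rw [hu]
    simpa using (hX.tendsto_integral_of_tendsto_zero hcont h_zero s.toNNReal).const_mul
      (Real.exp (-s))
  · have hshift : ∀ s ∈ Set.Ioi (0 : ℝ), ∫ o, u (X t o) s ∂(P x) = u x (t + s) := by
      intro s hs
      have hs' : (t + s : ℝ).toNNReal = t + s.toNNReal := by
        rw [Real.toNNReal_add t.coe_nonneg (le_of_lt hs), Real.toNNReal_coe]
      have := hX.integral_mul_comp_add x t s.toNNReal (Y := fun _ => 1) measurable_const
        (fun _ => zero_le_one) hcont.measurable (fun y => (h_pos y).le) h_abs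
      simp only [one_mul] at this
      simp_rw [hu]
      rw [hs', this]
    have hprod : Integrable (Function.uncurry fun o s => Real.exp (-s) * u (X t o) s)
        ((P x).prod (volume.restrict (Set.Ioi (0 : ℝ)))) := by
      have h1 : Integrable (fun p : Ω × ℝ => (1 : ℝ) * Real.exp (-p.2))
          ((P x).prod (volume.restrict (Set.Ioi (0 : ℝ)))) :=
        (integrable_const (1 : ℝ)).mul_prod hexp
      refine h1.mono' (Measurable.aestronglyMeasurable ?_) (.of_forall fun p => ?_)
      · have hm : Measurable fun p : Ω × ℝ => (X t p.1, p.2) :=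
          ((hX.measurable t).comp measurable_fst).prodMk measurable_snd
        exact (by fun_prop : Measurable fun p : Ω × ℝ => Real.exp (-p.2)).mul (u_meas2.comp hm)
      · rw [one_mul]
        exact hF_le _ _
    have hset : (fun s : ℝ => (t : ℝ) + s) ⁻¹' Set.Ioi (t : ℝ) = Set.Ioi 0 := by
      ext s
      simp
    calc ∫ o, g (X t o) ∂(P x)
        = ∫ s in Set.Ioi (0 : ℝ), ∫ o, Real.exp (-s) * u (X t o) s ∂(P x) := by
          simp_rw [hg]
          exact integral_integral_swap hprod
      _ = ∫ s in Set.Ioi (0 : ℝ), Real.exp t * (Real.exp (-(t + s)) * u x (t + s)) := by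
          refine setIntegral_congr_fun measurableSet_Ioi fun s hs => ?_
          have he : Real.exp (-s) = Real.exp t * Real.exp (-(t + s)) := by
            rw [← Real.exp_add]
            ring_nf
          rw [integral_const_mul, hshift s hs, ← mul_assoc, ← he]
      _ = Real.exp t * ∫ s in Set.Ioi (t : ℝ), Real.exp (-s) * u x s := by
          rw [integral_const_mul, ← hset,
            (measurePreserving_add_left volume (t : ℝ)).setIntegral_preimage_emb
              (measurableEmbedding_addLeft (t : ℝ)) (fun s => Real.exp (-s) * u x s)]
      _ ≤ Real.exp t * g x := by
          rw [hg]
          refine mul_le_mul_of_nonneg_left ?_ (Real.exp_pos _).le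
          exact setIntegral_mono_set (hF_int x) (.of_forall (hF_nonneg x))
            (LE.le.eventuallyLE (Set.Ioi_subset_Ioi t.coe_nonneg))

/-- The time spent far away on paths that end in a compact set: if `F` is supported where the
excessive function `g` is at most `η`, then so is the `g (X δ)`-weighted path integral of `F`, up to
the factor `exp δ`, relative to the unweighted one. -/
theorem integral_pathIntegral_mul_le (hX : IsFellerProcess 𝓕 X P) {g : E → ℝ}
    (hg : Continuous g) (g0 : ∀ x, 0 ≤ g x) (g1 : ∀ x, g x ≤ 1)
    (hexc : ∀ (t : ℝ≥0) (x : E), ∫ o, g (X t o) ∂(P x) ≤ Real.exp t * g x)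
    {F : E → ℝ} (hF : Continuous F) (F0 : ∀ x, 0 ≤ F x) {η : ℝ} (hη : 0 ≤ η)
    (hFη : ∀ x, F x ≠ 0 → g x ≤ η) (δ : ℝ≥0) (x : E)
    (hint : Integrable (pathIntegral X δ F) (P x)) :
    ∫ o, pathIntegral X δ F o * g (X δ o) ∂(P x)
      ≤ Real.exp δ * η * ∫ o, pathIntegral X δ F o ∂(P x) := by
  have hP := hX.isProbabilityMeasure
  have hgabs : ∀ y, |g y| ≤ 1 := fun y => by rw [abs_of_nonneg (g0 y)]; exact g1 y
  have hpath : ∀ o, ENNReal.ofReal (pathIntegral X δ F o)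
      = ∫⁻ s in Set.Ioc (0 : ℝ) δ, ENNReal.ofReal (F (X s.toNNReal o)) := fun o => by
    rw [pathIntegral, intervalIntegral.integral_of_le δ.coe_nonneg,
      ofReal_integral_eq_lintegral_ofReal ?_ (.of_forall fun s => F0 _)]
    exact (intervalIntegrable_iff_integrableOn_Ioc_of_le δ.coe_nonneg).1
      (hX.intervalIntegrable_comp hF δ o)
  have hpath0 : ∀ o, 0 ≤ pathIntegral X δ F o := fun o =>
    intervalIntegral.integral_nonneg δ.coe_nonneg fun s _ => F0 _
  have hm : Measurable fun p : Ω × ℝ => ENNReal.ofReal (F (X p.2.toNNReal p.1)) :=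
    (hF.measurable.comp (hX.measurable_comp_toNNReal.comp measurable_swap)).ennreal_ofReal
  have hgm : Measurable fun y => ENNReal.ofReal (g y) := hg.measurable.ennreal_ofReal
  have hFm : Measurable fun y => ENNReal.ofReal (F y) := hF.measurable.ennreal_ofReal
  -- The estimate at a fixed time, from the Markov property and excessivity.
  have hpt : ∀ s ∈ Set.Ioc (0 : ℝ) δ,
      ∫⁻ o, ENNReal.ofReal (F (X s.toNNReal o)) * ENNReal.ofReal (g (X δ o)) ∂(P x)
        ≤ ∫⁻ o, ENNReal.ofReal (Real.exp δ * η) * ENNReal.ofReal (F (X s.toNNReal o)) ∂(P x) := by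
    intro s hs
    have hsδ : s.toNNReal ≤ δ := Real.toNNReal_le_iff_le_coe.2 hs.2
    have hadd : s.toNNReal + (δ - s.toNNReal) = δ := add_tsub_cancel_of_le hsδ
    have hmk := hX.lintegral_mul_comp_add x s.toNNReal (δ - s.toNNReal)
      (Y := fun o => ENNReal.ofReal (F (X s.toNNReal o)))
      (hFm.comp (hX.adapted s.toNNReal)) hgm
    rw [hadd] at hmk
    rw [hmk]
    refine lintegral_mono fun o => ?_
    set y := X s.toNNReal o
    rw [← ofReal_integral_eq_lintegral_ofReal (hX.integrable_comp hg.measurable hgabs _ _)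
      (.of_forall fun _ => g0 _), ← ENNReal.ofReal_mul (F0 _), ← ENNReal.ofReal_mul (by positivity)]
    refine ENNReal.ofReal_le_ofReal ?_
    rcases eq_or_ne (F y) 0 with h | h
    · simp [h]
    · rw [mul_comm]
      refine mul_le_mul_of_nonneg_right ((hexc _ y).trans ?_) (F0 y)
      refine mul_le_mul (Real.exp_le_exp.2 ?_) (hFη y h) (g0 y) (Real.exp_pos _).le
      exact_mod_cast tsub_le_self
  have hpm : Measurable (pathIntegral X δ F) := hX.measurable_pathIntegral hF.measurable δ
  have hlin : ∫⁻ o, ENNReal.ofReal (pathIntegral X δ F o * g (X δ o)) ∂(P x)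
      ≤ ENNReal.ofReal (Real.exp δ * η) * ∫⁻ o, ENNReal.ofReal (pathIntegral X δ F o) ∂(P x) := by
    calc ∫⁻ o, ENNReal.ofReal (pathIntegral X δ F o * g (X δ o)) ∂(P x)
        = ∫⁻ o, (∫⁻ s in Set.Ioc (0 : ℝ) δ,
            ENNReal.ofReal (F (X s.toNNReal o)) * ENNReal.ofReal (g (X δ o))) ∂(P x) := by
          refine lintegral_congr fun o => ?_
          rw [ENNReal.ofReal_mul (hpath0 o), hpath, lintegral_mul_const]
          exact hm.comp (measurable_const.prodMk measurable_id)
      _ = ∫⁻ s in Set.Ioc (0 : ℝ) δ, ∫⁻ o,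
            ENNReal.ofReal (F (X s.toNNReal o)) * ENNReal.ofReal (g (X δ o)) ∂(P x) :=
          lintegral_lintegral_swap
            (hm.mul (hgm.comp ((hX.measurable δ).comp measurable_fst))).aemeasurable
      _ ≤ ∫⁻ s in Set.Ioc (0 : ℝ) δ, ∫⁻ o,
            ENNReal.ofReal (Real.exp δ * η) * ENNReal.ofReal (F (X s.toNNReal o)) ∂(P x) :=
          setLIntegral_mono' measurableSet_Ioc hpt
      _ = ∫⁻ o, (∫⁻ s in Set.Ioc (0 : ℝ) δ,
            ENNReal.ofReal (Real.exp δ * η) * ENNReal.ofReal (F (X s.toNNReal o))) ∂(P x) :=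
          (lintegral_lintegral_swap (hm.const_mul _).aemeasurable).symm
      _ = _ := by
          rw [← lintegral_const_mul _ hpm.ennreal_ofReal]
          refine lintegral_congr fun o => ?_
          rw [hpath, lintegral_const_mul]
          exact hm.comp (measurable_const.prodMk measurable_id)
  rw [integral_eq_lintegral_of_nonneg_ae (.of_forall fun o => mul_nonneg (hpath0 o) (g0 _))
    (hpm.mul (hg.measurable.comp (hX.measurable δ))).aestronglyMeasurable]
  rw [← ofReal_integral_eq_lintegral_ofReal hint (.of_forall hpath0),
    ← ENNReal.ofReal_mul (by positivity)] at hlin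
  refine ENNReal.toReal_le_of_le_ofReal ?_ hlin
  exact mul_nonneg (by positivity) (integral_nonneg hpath0)

end IsFellerProcess

/-! ### Exponential moments from the drift condition -/

/-- The consequences of the geometric drift condition for a family of laws `P x`, a terminal state
`Y` and an accumulated weight `A` (the path integral of `ω`), as real-valued exponential and first
moment bounds. -/
structure DriftBounds {Ω E : Type*} [MeasurableSpace Ω] [MeasurableSpace E] (P : E → Measure Ω)
    (Y : Ω → E) (A : Ω → ℝ) (ω : E → ℝ) (b : ℝ) (M₁ M₂ : ℝ → ℝ) : Prop where
  prob : ∀ x, IsProbabilityMeasure (P x)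
  measurable_state : Measurable Y
  measurable_acc : Measurable A
  acc_nonneg : ∀ o, 0 ≤ A o
  measurable_weight : Measurable ω
  weight_nonneg : ∀ x, 0 ≤ ω x
  rate_pos : 0 < b
  rate_lt_one : b < 1
  exp_acc : ∀ a > 0, ∀ x, Integrable (fun o => Real.exp (a * A o)) (P x) ∧
    ∫ o, Real.exp (a * A o) ∂(P x) ≤ Real.exp (a * (ω x + M₁ a))
  exp_weight : ∀ a > 0, ∀ x, Integrable (fun o => Real.exp (a * ω (Y o))) (P x) ∧
    ∫ o, Real.exp (a * ω (Y o)) ∂(P x) ≤ Real.exp (a * (b * ω x + M₂ a))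
  mean_acc : ∀ x, Integrable A (P x) ∧ ∫ o, A o ∂(P x) ≤ ω x + M₁ 0
  mean_weight : ∀ x, Integrable (fun o => ω (Y o)) (P x) ∧
    ∫ o, ω (Y o) ∂(P x) ≤ b * ω x + M₂ 0

theorem integral_exp_le_of_entropicUtility_le {Ω : Type*} [MeasurableSpace Ω] {P : Measure Ω}
    {Z : Ω → ℝ} (hZ : Measurable Z) {a : ℝ} (ha : 0 < a) {r : ℝ}
    (h : entropicUtility P a Z ≤ (r : EReal)) :
    Integrable (fun o => Real.exp (a * Z o)) P ∧
      ∫ o, Real.exp (a * Z o) ∂P ≤ Real.exp (a * r) := by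
  have hm : Measurable fun o => Real.exp (a * Z o) := (hZ.const_mul a).exp
  have hlin : ∫⁻ o, ENNReal.ofReal (Real.exp (a * Z o)) ∂P ≤ ENNReal.ofReal (Real.exp (a * r)) := by
    rw [entropicUtility, if_neg ha.ne'] at h
    have h1 : ENNReal.log (∫⁻ o, ENNReal.ofReal (Real.exp (a * Z o)) ∂P)
        ≤ ((a * r : ℝ) : EReal) := by
      have h2 := mul_le_mul_of_nonneg_left h (show (0 : EReal) ≤ (a : ℝ) by exact_mod_cast ha.le)
      rw [← mul_assoc, ← EReal.coe_mul, mul_one_div_cancel ha.ne', EReal.coe_one, one_mul] at h2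
      exact_mod_cast h2
    have h3 : ((a * r : ℝ) : EReal) = ENNReal.log (ENNReal.ofReal (Real.exp (a * r))) := by
      rw [ENNReal.log_ofReal_of_pos (Real.exp_pos _), Real.log_exp]
    rw [h3] at h1
    exact ENNReal.log_le_log_iff.1 h1
  have hint : Integrable (fun o => Real.exp (a * Z o)) P := by
    refine ⟨hm.aestronglyMeasurable, ?_⟩
    rw [hasFiniteIntegral_iff_ofReal (.of_forall fun _ => (Real.exp_pos _).le)]
    exact hlin.trans_lt ENNReal.ofReal_lt_top
  refine ⟨hint, ?_⟩
  rw [← ofReal_integral_eq_lintegral_ofReal hint (.of_forall fun _ => (Real.exp_pos _).le)] at hlin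
  exact (ENNReal.ofReal_le_ofReal_iff (Real.exp_pos _).le).1 hlin

theorem integral_le_of_entropicUtility_le {Ω : Type*} [MeasurableSpace Ω] {P : Measure Ω}
    {Z : Ω → ℝ} (hZ : Measurable Z) (hZ0 : ∀ o, 0 ≤ Z o) {r : ℝ}
    (h : entropicUtility P 0 Z ≤ (r : EReal)) :
    Integrable Z P ∧ ∫ o, Z o ∂P ≤ r := by
  have h0 : ∫⁻ o, ENNReal.ofReal (-Z o) ∂P = 0 := by
    simp [ENNReal.ofReal_of_nonpos (neg_nonpos.2 (hZ0 _))]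
  rw [entropicUtility, if_pos rfl, h0, EReal.coe_ennreal_zero, sub_zero] at h
  have hint : Integrable Z P := by
    refine ⟨hZ.aestronglyMeasurable, ?_⟩
    rw [hasFiniteIntegral_iff_ofReal (.of_forall hZ0)]
    refine lt_top_iff_ne_top.2 fun htop => ?_
    rw [htop, EReal.coe_ennreal_top] at h
    exact (EReal.coe_lt_top r).not_ge h
  refine ⟨hint, ?_⟩
  rw [← ofReal_integral_eq_lintegral_ofReal hint (.of_forall hZ0), EReal.coe_ennreal_ofReal,
    max_eq_left (integral_nonneg hZ0)] at h
  exact_mod_cast h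

/-- The geometric drift condition gives the moment bounds collected in `DriftBounds`. -/
theorem IsFellerProcess.exists_driftBounds {Ω E : Type*} [mΩ : MeasurableSpace Ω]
    [NormedAddCommGroup E] [ProperSpace E] [MeasurableSpace E] [BorelSpace E]
    {𝓕 : Filtration ℝ≥0 mΩ} {X : ℝ≥0 → Ω → E} {P : E → Measure Ω} (hX : IsFellerProcess 𝓕 X P)
    {δ : ℝ≥0} {ω : E → ℝ} (hω : Continuous ω) (hω0 : ∀ x, 0 ≤ ω x)
    (hdrift : GeometricDrift X P δ ω) :
    ∃ b M₁ M₂, DriftBounds P (X δ) (pathIntegral X δ ω) ω b M₁ M₂ := by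
  obtain ⟨b, hb0, hb1, M₁, M₂, h⟩ := hdrift
  have hA : Measurable (pathIntegral X δ ω) := hX.measurable_pathIntegral hω.measurable δ
  have hA0 : ∀ o, 0 ≤ pathIntegral X δ ω o := fun o =>
    intervalIntegral.integral_nonneg δ.coe_nonneg fun s _ => hω0 _
  have hY : Measurable fun o => ω (X δ o) := hω.measurable.comp (hX.measurable δ)
  exact ⟨b, M₁, M₂, {
    prob := hX.isProbabilityMeasure
    measurable_state := hX.measurable δ
    measurable_acc := hA
    acc_nonneg := hA0
    measurable_weight := hω.measurable
    weight_nonneg := hω0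
    rate_pos := hb0
    rate_lt_one := hb1
    exp_acc := fun a ha x => integral_exp_le_of_entropicUtility_le hA ha (h a x).1
    exp_weight := fun a ha x => integral_exp_le_of_entropicUtility_le hY ha (h a x).2
    mean_acc := fun x => integral_le_of_entropicUtility_le hA hA0 (h 0 x).1
    mean_weight := fun x => integral_le_of_entropicUtility_le hY (fun o => hω0 _) (h 0 x).2 }⟩

/-- Exponential moments of `A + ω(Y)` grow at most exponentially in `ω`. -/
theorem DriftBounds.exists_exp_le {Ω E : Type*} [MeasurableSpace Ω] [MeasurableSpace E]
    {P : E → Measure Ω} {Y : Ω → E} {A : Ω → ℝ} {ω : E → ℝ} {b : ℝ} {M₁ M₂ : ℝ → ℝ}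
    (h : DriftBounds P Y A ω b M₁ M₂) {a : ℝ} (ha : 0 < a) :
    ∃ C, ∀ x, Integrable (fun o => Real.exp (a * (A o + ω (Y o)))) (P x) ∧
      ∫ o, Real.exp (a * (A o + ω (Y o))) ∂(P x) ≤ Real.exp (2 * a * ω x + C) := by
  have h2a : 0 < 2 * a := by positivity
  have hpt : ∀ o, Real.exp (a * (A o + ω (Y o)))
      ≤ Real.exp (2 * a * A o) + Real.exp (2 * a * ω (Y o)) := fun o => by
    rcases le_total (A o) (ω (Y o)) with hle | hle
    · refine (Real.exp_le_exp.2 ?_).trans (le_add_of_nonneg_left (Real.exp_pos _).le)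
      nlinarith
    · refine (Real.exp_le_exp.2 ?_).trans (le_add_of_nonneg_right (Real.exp_pos _).le)
      nlinarith
  have hm : Measurable fun o => Real.exp (a * (A o + ω (Y o))) :=
    ((h.measurable_acc.add (h.measurable_weight.comp h.measurable_state)).const_mul a).exp
  refine ⟨Real.log 2 + 2 * a * (|M₁ (2 * a)| + |M₂ (2 * a)|), fun x => ?_⟩
  obtain ⟨i1, l1⟩ := h.exp_acc (2 * a) h2a x
  obtain ⟨i2, l2⟩ := h.exp_weight (2 * a) h2a x
  have hint : Integrable (fun o => Real.exp (a * (A o + ω (Y o)))) (P x) :=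
    (i1.add i2).mono' hm.aestronglyMeasurable
      (.of_forall fun o => by rw [Real.norm_of_nonneg (Real.exp_pos _).le]; exact hpt o)
  refine ⟨hint, ?_⟩
  have hω := h.weight_nonneg x
  have hb := h.rate_lt_one
  have hS1 : 2 * a * (ω x + M₁ (2 * a))
      ≤ 2 * a * ω x + 2 * a * (|M₁ (2 * a)| + |M₂ (2 * a)|) := by
    rw [← mul_add]
    refine mul_le_mul_of_nonneg_left ?_ h2a.le
    linarith [le_abs_self (M₁ (2 * a)), abs_nonneg (M₂ (2 * a))]
  have hS2 : 2 * a * (b * ω x + M₂ (2 * a))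
      ≤ 2 * a * ω x + 2 * a * (|M₁ (2 * a)| + |M₂ (2 * a)|) := by
    rw [← mul_add]
    refine mul_le_mul_of_nonneg_left ?_ h2a.le
    nlinarith [le_abs_self (M₂ (2 * a)), abs_nonneg (M₁ (2 * a))]
  calc ∫ o, Real.exp (a * (A o + ω (Y o))) ∂(P x)
      ≤ ∫ o, (Real.exp (2 * a * A o) + Real.exp (2 * a * ω (Y o))) ∂(P x) :=
        integral_mono hint (i1.add i2) hpt
    _ = ∫ o, Real.exp (2 * a * A o) ∂(P x) + ∫ o, Real.exp (2 * a * ω (Y o)) ∂(P x) :=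
        integral_add i1 i2
    _ ≤ Real.exp (2 * a * ω x + 2 * a * (|M₁ (2 * a)| + |M₂ (2 * a)|))
        + Real.exp (2 * a * ω x + 2 * a * (|M₁ (2 * a)| + |M₂ (2 * a)|)) :=
        add_le_add (l1.trans (Real.exp_le_exp.2 hS1)) (l2.trans (Real.exp_le_exp.2 hS2))
    _ = Real.exp (2 * a * ω x + (Real.log 2 + 2 * a * (|M₁ (2 * a)| + |M₂ (2 * a)|))) := by
        rw [← two_mul, add_left_comm, Real.exp_add (Real.log 2), Real.exp_log two_pos]

/-! ### Exponential functionals with weighted-norm data -/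

theorem abs_exp_sub_exp_le {a b B : ℝ} (ha : a ≤ B) (hb : b ≤ B) :
    |Real.exp a - Real.exp b| ≤ Real.exp B * |a - b| := by
  wlog hab : b ≤ a generalizing a b
  · rw [abs_sub_comm, abs_sub_comm a b]
    exact this hb ha (le_of_not_ge hab)
  rw [abs_of_nonneg (sub_nonneg.2 (Real.exp_le_exp.2 hab)), abs_of_nonneg (sub_nonneg.2 hab)]
  have h1 : Real.exp b = Real.exp a * Real.exp (b - a) := by
    rw [← Real.exp_add]
    ring_nf
  have h2 := Real.add_one_le_exp (b - a)
  calc Real.exp a - Real.exp b ≤ Real.exp a * (a - b) := by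
        rw [h1]
        nlinarith [Real.exp_pos a]
    _ ≤ Real.exp B * (a - b) :=
        mul_le_mul_of_nonneg_right (Real.exp_le_exp.2 ha) (sub_nonneg.2 hab)

namespace IsFellerProcess

variable {Ω E : Type*} [mΩ : MeasurableSpace Ω] [NormedAddCommGroup E] [ProperSpace E]
  [MeasurableSpace E] [BorelSpace E] {𝓕 : Filtration ℝ≥0 mΩ} {X : ℝ≥0 → Ω → E}
  {P : E → Measure Ω}

theorem pathIntegral_mono (hX : IsFellerProcess 𝓕 X P) {f g : E → ℝ} (hf : Continuous f)
    (hg : Continuous g) (hfg : ∀ x, f x ≤ g x) (δ : ℝ≥0) (o : Ω) :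
    pathIntegral X δ f o ≤ pathIntegral X δ g o :=
  intervalIntegral.integral_mono_on δ.coe_nonneg (hX.intervalIntegrable_comp hf δ o)
    (hX.intervalIntegrable_comp hg δ o) fun _ _ => hfg _

theorem abs_pathIntegral_le (hX : IsFellerProcess 𝓕 X P) {f g : E → ℝ} (hf : Continuous f)
    (hg : Continuous g) (hfg : ∀ x, |f x| ≤ g x) (δ : ℝ≥0) (o : Ω) :
    |pathIntegral X δ f o| ≤ pathIntegral X δ g o :=
  (intervalIntegral.abs_integral_le_integral_abs δ.coe_nonneg).trans
    (hX.pathIntegral_mono hf.abs hg hfg δ o)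

theorem pathIntegral_affine (hX : IsFellerProcess 𝓕 X P) {ω : E → ℝ} (hω : Continuous ω)
    (K : ℝ) (δ : ℝ≥0) (o : Ω) :
    pathIntegral X δ (fun x => K * (1 + ω x)) o = K * (δ + pathIntegral X δ ω o) := by
  rw [pathIntegral, pathIntegral, intervalIntegral.integral_const_mul,
    intervalIntegral.integral_add intervalIntegrable_const (hX.intervalIntegrable_comp hω δ o)]
  simp

/-- Continuity in the starting point of exponential functionals killed outside a compact set at
time `δ`. Cutting off `f` at distance `N` changes the functional by at most the time-integral of `f`
over the far region on paths that end in a compact set, which is controlled by the excessive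
function. -/
theorem continuous_integral_exp_mul_of_hasCompactSupport (hX : IsFellerProcess 𝓕 X P)
    {δ : ℝ≥0} {ω : E → ℝ} {b : ℝ} {M₁ M₂ : ℝ → ℝ} (hω : Continuous ω)
    (hD : DriftBounds P (X δ) (pathIntegral X δ ω) ω b M₁ M₂) {f : E → ℝ} (hf : Continuous f)
    {K : ℝ} (hK : 0 < K) (hfK : ∀ x, |f x| ≤ K * (1 + ω x)) {g : E → ℝ} (hg : Continuous g)
    (g0 : ∀ x, 0 ≤ g x) (hgc : HasCompactSupport g) :
    Continuous fun x => ∫ o, Real.exp (pathIntegral X δ f o) * g (X δ o) ∂(P x) := by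
  have hP := hX.isProbabilityMeasure
  obtain ⟨r, r_cont, r_pos, r_le, r_zero, r_exc⟩ := hX.exists_excessive
  obtain ⟨Cg, hCg⟩ := hgc.exists_bound_of_continuous hg
  obtain ⟨c₁, hc₁⟩ : ∃ c₁, ∀ x, g x ^ 2 ≤ c₁ * r x := by
    have hq : Continuous fun x => g x * (g x / r x) :=
      hg.mul (hg.div r_cont fun x => (r_pos x).ne')
    obtain ⟨c₁, hc₁⟩ := (hgc.mul_right (f' := fun x => g x / r x)).exists_bound_of_continuous hq
    refine ⟨c₁, fun x => ?_⟩
    have h1 : g x * (g x / r x) ≤ c₁ := (Real.le_norm_self _).trans (hc₁ x)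
    rwa [mul_div_assoc', div_le_iff₀ (r_pos x), ← pow_two] at h1
  have hc₁0 : 0 ≤ c₁ := by
    by_contra hneg
    have := hc₁ 0
    nlinarith [sq_nonneg (g 0), r_pos 0]
  obtain ⟨A, hA⟩ : ∃ A : Ω → ℝ, A = pathIntegral X δ ω := ⟨_, rfl⟩
  rw [← hA] at hD
  have hA0 := hD.acc_nonneg
  refine continuous_of_forall_exists_abs_sub_le fun x₀ ε hε => ?_
  obtain ⟨W, hW⟩ : ∃ W, W = ω x₀ + 1 := ⟨_, rfl⟩
  -- Local bounds for the third exponential moment and the mean of `B = K (δ + A)`.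
  obtain ⟨C₁, hC₁⟩ : ∃ C₁, C₁ = Real.exp (3 * K * δ) * Real.exp (3 * K * (W + M₁ (3 * K))) :=
    ⟨_, rfl⟩
  have hC₁0 : 0 < C₁ := hC₁ ▸ by positivity
  obtain ⟨C₂, hC₂⟩ : ∃ C₂, C₂ = K * (δ + |W + M₁ 0|) := ⟨_, rfl⟩
  have hC₂0 : 0 ≤ C₂ := hC₂ ▸ by positivity
  obtain ⟨θ, hθ⟩ : ∃ θ, θ = ε / C₁ := ⟨_, rfl⟩
  have hθ0 : 0 < θ := hθ ▸ by positivity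
  obtain ⟨η, hη⟩ : ∃ η, η = θ * ε / (c₁ * Real.exp δ * C₂ + 1) := ⟨_, rfl⟩
  have hη0 : 0 < η := hη ▸ by positivity
  obtain ⟨N, hN⟩ : ∃ N : ℕ, ∀ x : E, (N : ℝ) < ‖x‖ → r x ≤ η := by
    have h1 := r_zero.eventually_le_const hη0
    rw [← Metric.cobounded_eq_cocompact, ← comap_norm_atTop] at h1
    obtain ⟨t, ht, hsub⟩ := mem_comap.1 h1
    obtain ⟨a, ha⟩ := mem_atTop_sets.1 ht
    obtain ⟨N, hN⟩ := exists_nat_ge a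
    exact ⟨N, fun x hx => hsub (ha _ (hN.trans hx.le))⟩
  have hcN := continuous_cutoff (E := E) N
  have hfN : Continuous fun x => f x * cutoff N x := hf.mul hcN
  have hfN_le : ∀ x, |f x * cutoff N x| ≤ K * (1 + ω x) := fun x => by
    rw [abs_mul, abs_of_nonneg (cutoff_nonneg N x)]
    exact (mul_le_of_le_one_right (abs_nonneg _) (cutoff_le_one N x)).trans (hfK x)
  obtain ⟨Cf, hCf⟩ := (HasCompactSupport.mul_left (f := f)
    (hasCompactSupport_cutoff N)).exists_bound_of_continuous hfN
  have hF : Continuous fun x => |f x| * (1 - cutoff N x) := by fun_prop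
  have hF0 : ∀ x, 0 ≤ |f x| * (1 - cutoff N x) := fun x =>
    mul_nonneg (abs_nonneg _) (sub_nonneg.2 (cutoff_le_one N x))
  have hF_le : ∀ x, |f x| * (1 - cutoff N x) ≤ K * (1 + ω x) := fun x =>
    (mul_le_of_le_one_right (abs_nonneg _) (by linarith [cutoff_nonneg N x])).trans (hfK x)
  have hKω : Continuous fun x => K * (1 + ω x) := by fun_prop
  obtain ⟨D, hDdef⟩ : ∃ D : Ω → ℝ, D = pathIntegral X δ fun x => |f x| * (1 - cutoff N x) :=
    ⟨_, rfl⟩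
  have hDm : Measurable D := hDdef ▸ hX.measurable_pathIntegral hF.measurable δ
  have hD0 : ∀ o, 0 ≤ D o := fun o => by
    rw [hDdef]
    exact intervalIntegral.integral_nonneg δ.coe_nonneg fun s _ => hF0 _
  have hDB : ∀ o, D o ≤ K * (δ + A o) := fun o => by
    rw [hDdef, hA, ← hX.pathIntegral_affine hω]
    exact hX.pathIntegral_mono hF hKω hF_le δ o
  have hfB : ∀ o, |pathIntegral X δ f o| ≤ K * (δ + A o) := fun o => by
    rw [hA, ← hX.pathIntegral_affine hω]
    exact hX.abs_pathIntegral_le hf hKω hfK δ o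
  have hfNB : ∀ o, |pathIntegral X δ (fun x => f x * cutoff N x) o| ≤ K * (δ + A o) := fun o => by
    rw [hA, ← hX.pathIntegral_affine hω]
    exact hX.abs_pathIntegral_le hfN hKω hfN_le δ o
  have hdiff : ∀ o, |pathIntegral X δ f o - pathIntegral X δ (fun x => f x * cutoff N x) o|
      ≤ D o := fun o => by
    have h1 : pathIntegral X δ f o - pathIntegral X δ (fun x => f x * cutoff N x) o
        = pathIntegral X δ (fun x => f x - f x * cutoff N x) o :=
      (intervalIntegral.integral_sub (hX.intervalIntegrable_comp hf δ o)
        (hX.intervalIntegrable_comp hfN δ o)).symm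
    rw [h1, hDdef]
    refine hX.abs_pathIntegral_le (hf.sub hfN) hF (fun x => ?_) δ o
    rw [Pi.sub_apply, ← mul_one_sub, abs_mul, abs_of_nonneg (sub_nonneg.2 (cutoff_le_one N x))]
  refine ⟨_, hX.continuous_integral_exp_mul_of_bounded hfN (C := Cf) hCf hg g0
    (D := Cg) (fun x => (Real.le_norm_self _).trans (hCg x)) δ, ?_⟩
  filter_upwards [(hω.tendsto x₀).eventually_le_const (show ω x₀ < W by linarith)] with x hx
  -- Integrability of all the functionals involved.
  have i3 : Integrable (fun o => Real.exp (3 * K * (δ + A o))) (P x) := by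
    simp_rw [mul_add, Real.exp_add]
    exact ((hD.exp_acc (3 * K) (by positivity) x).1).const_mul _
  have l3 : ∫ o, Real.exp (3 * K * (δ + A o)) ∂(P x) ≤ C₁ := by
    simp_rw [mul_add, Real.exp_add, integral_const_mul]
    rw [hC₁]
    refine mul_le_mul_of_nonneg_left ((hD.exp_acc (3 * K) (by positivity) x).2.trans ?_)
      (Real.exp_pos _).le
    rw [Real.exp_le_exp]
    gcongr
  have iB : Integrable (fun o => K * (δ + A o)) (P x) :=
    ((integrable_const _).add (hD.mean_acc x).1).const_mul K
  have lB : ∫ o, K * (δ + A o) ∂(P x) ≤ C₂ := by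
    rw [integral_const_mul, integral_add (integrable_const _) (hD.mean_acc x).1, hC₂]
    simp only [integral_const, probReal_univ, smul_eq_mul, one_mul]
    gcongr
    exact ((hD.mean_acc x).2.trans (by linarith)).trans (le_abs_self _)
  have iD : Integrable D (P x) := iB.mono' hDm.aestronglyMeasurable
    (.of_forall fun o => by rw [Real.norm_of_nonneg (hD0 o)]; exact hDB o)
  have lD : ∫ o, D o ∂(P x) ≤ C₂ := (integral_mono iD iB hDB).trans lB
  have hrm : Measurable fun o => r (X δ o) := r_cont.measurable.comp (hX.measurable δ)
  have hgm : Measurable fun o => g (X δ o) := hg.measurable.comp (hX.measurable δ)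
  have iDr : Integrable (fun o => D o * r (X δ o)) (P x) :=
    iD.mono' (hDm.mul hrm).aestronglyMeasurable (.of_forall fun o => by
      rw [Real.norm_of_nonneg (mul_nonneg (hD0 o) (r_pos _).le)]
      exact mul_le_of_le_one_right (hD0 o) (r_le _))
  have lDr : ∫ o, D o * r (X δ o) ∂(P x) ≤ Real.exp δ * η * C₂ := by
    have h1 := hX.integral_pathIntegral_mul_le r_cont (fun y => (r_pos y).le) r_le r_exc hF hF0
      hη0.le (fun y hy => hN y ?_) δ x (hDdef ▸ iD)
    · rw [← hDdef] at h1
      exact h1.trans (mul_le_mul_of_nonneg_left lD (by positivity))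
    · by_contra hle
      exact hy (by rw [cutoff_eq_one (not_lt.1 hle), sub_self, mul_zero])
  have hexp1 : ∀ o, Real.exp (K * (δ + A o)) ≤ Real.exp (3 * K * (δ + A o)) := fun o => by
    rw [Real.exp_le_exp]
    nlinarith [mul_nonneg hK.le (add_nonneg δ.coe_nonneg (hA0 o))]
  have hintg : ∀ F : E → ℝ, Continuous F →
      (∀ o, |pathIntegral X δ F o| ≤ K * (δ + A o)) →
      Integrable (fun o => Real.exp (pathIntegral X δ F o) * g (X δ o)) (P x) := by
    intro F hFc hFB
    refine (i3.mul_const Cg).mono'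
      ((hX.measurable_pathIntegral hFc.measurable δ).exp.mul hgm).aestronglyMeasurable
      (.of_forall fun o => ?_)
    rw [norm_mul, Real.norm_of_nonneg (Real.exp_pos _).le]
    exact mul_le_mul ((Real.exp_le_exp.2 ((le_abs_self _).trans (hFB o))).trans (hexp1 o))
      (hCg _) (norm_nonneg _) (Real.exp_pos _).le
  -- Pointwise, the difference is split by the arithmetic-geometric mean inequality.
  have hpt : ∀ o, ‖Real.exp (pathIntegral X δ f o) * g (X δ o)
      - Real.exp (pathIntegral X δ (fun x => f x * cutoff N x) o) * g (X δ o)‖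
      ≤ θ / 2 * Real.exp (3 * K * (δ + A o)) + c₁ / (2 * θ) * (D o * r (X δ o)) := fun o => by
    have hB0 : 0 ≤ K * (δ + A o) := mul_nonneg hK.le (add_nonneg δ.coe_nonneg (hA0 o))
    have hDe : D o ≤ Real.exp (K * (δ + A o)) :=
      (hDB o).trans ((le_add_of_nonneg_right zero_le_one).trans (Real.add_one_le_exp _))
    obtain ⟨e, he⟩ : ∃ e, e = Real.exp (K * (δ + A o)) := ⟨_, rfl⟩
    have he3 : Real.exp (3 * K * (δ + A o)) = e * e * e := by
      rw [he, ← Real.exp_add, ← Real.exp_add]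
      ring_nf
    have he0 : 0 < e := he ▸ Real.exp_pos _
    rw [← he] at hDe
    rw [← sub_mul, norm_mul, Real.norm_eq_abs, Real.norm_of_nonneg (g0 _), he3]
    have h1 : |Real.exp (pathIntegral X δ f o)
        - Real.exp (pathIntegral X δ (fun x => f x * cutoff N x) o)| ≤ e * D o := by
      rw [he]
      exact (abs_exp_sub_exp_le ((le_abs_self _).trans (hfB o))
        ((le_abs_self _).trans (hfNB o))).trans
        (mul_le_mul_of_nonneg_left (hdiff o) (Real.exp_pos _).le)
    have hgr := hc₁ (X δ o)
    have hg0 := g0 (X δ o)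
    have hD0' := hD0 o
    calc _ ≤ e * D o * g (X δ o) := mul_le_mul_of_nonneg_right h1 hg0
      _ ≤ θ / 2 * (e * e * D o) + 1 / (2 * θ) * (D o * g (X δ o) ^ 2) := by
        have h2 : θ / 2 * (e * e * D o) + 1 / (2 * θ) * (D o * g (X δ o) ^ 2)
            - e * D o * g (X δ o) = D o / (2 * θ) * (θ * e - g (X δ o)) ^ 2 := by
          field_simp
          ring
        have h3 : 0 ≤ D o / (2 * θ) * (θ * e - g (X δ o)) ^ 2 := by positivity
        linarith
      _ ≤ θ / 2 * (e * e * e) + 1 / (2 * θ) * (D o * (c₁ * r (X δ o))) := by gcongr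
      _ = _ := by ring
  rw [← integral_sub (hintg f hf hfB) (hintg _ hfN hfNB)]
  have ibound := (i3.const_mul (θ / 2)).add (iDr.const_mul (c₁ / (2 * θ)))
  refine (norm_integral_le_of_norm_le ibound (.of_forall hpt)).trans ?_
  rw [integral_add' (i3.const_mul _) (iDr.const_mul _), integral_const_mul, integral_const_mul]
  calc θ / 2 * ∫ o, Real.exp (3 * K * (δ + A o)) ∂(P x)
        + c₁ / (2 * θ) * ∫ o, D o * r (X δ o) ∂(P x)
      ≤ θ / 2 * C₁ + c₁ / (2 * θ) * (Real.exp δ * η * C₂) := by gcongr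
    _ ≤ ε / 2 + ε / 2 := by
        have h1 : θ / 2 * C₁ = ε / 2 := by rw [hθ]; field_simp
        have h2 : c₁ / (2 * θ) * (Real.exp δ * η * C₂)
            = (c₁ * Real.exp δ * C₂) / (c₁ * Real.exp δ * C₂ + 1) * (ε / 2) := by
          rw [hη]
          field_simp
        have h3 : (c₁ * Real.exp δ * C₂) / (c₁ * Real.exp δ * C₂ + 1) ≤ 1 := by
          rw [div_le_one (by positivity)]
          linarith
        rw [h1, h2]
        gcongr
        exact mul_le_of_le_one_left (by positivity) h3
    _ = ε := add_halves ε

/-- Exponential functionals of a path integral and of the terminal state depend continuously on the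
starting point, for data of finite weighted norm. -/
theorem continuous_integral_exp (hX : IsFellerProcess 𝓕 X P)
    {δ : ℝ≥0} {ω : E → ℝ} {b : ℝ} {M₁ M₂ : ℝ → ℝ} (hω : Continuous ω)
    (hD : DriftBounds P (X δ) (pathIntegral X δ ω) ω b M₁ M₂) {f w : E → ℝ} (hf : Continuous f)
    (hw : Continuous w) {K : ℝ} (hK : 0 < K) (hfK : ∀ x, |f x| ≤ K * (1 + ω x))
    (hwK : ∀ x, |w x| ≤ K * (1 + ω x)) :
    Continuous fun x => ∫ o, Real.exp (pathIntegral X δ f o + w (X δ o)) ∂(P x) := by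
  have hP := hX.isProbabilityMeasure
  obtain ⟨A, hA⟩ : ∃ A : Ω → ℝ, A = pathIntegral X δ ω := ⟨_, rfl⟩
  obtain ⟨C, hC⟩ := hD.exists_exp_le (a := 2 * K) (by positivity)
  rw [← hA] at hC
  refine continuous_of_forall_exists_abs_sub_le fun x₀ ε hε => ?_
  obtain ⟨W, hW⟩ : ∃ W, W = ω x₀ + 1 := ⟨_, rfl⟩
  obtain ⟨C₁, hC₁⟩ : ∃ C₁, C₁ = Real.exp (2 * K * (δ + 1)) * Real.exp (2 * (2 * K) * W + C) :=
    ⟨_, rfl⟩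
  have hC₁0 : 0 < C₁ := hC₁ ▸ by positivity
  obtain ⟨θ, hθ⟩ : ∃ θ, θ = ε / C₁ := ⟨_, rfl⟩
  have hθ0 : 0 < θ := hθ ▸ by positivity
  obtain ⟨N, hN⟩ := hX.exists_eventually_integral_cutoff δ x₀ (ε := θ * ε) (by positivity)
  have hcN := continuous_cutoff (E := E) N
  have hfm := hX.measurable_pathIntegral hf.measurable δ
  have hXm := hX.measurable δ
  have hcm : Measurable fun o => cutoff N (X δ o) := hcN.measurable.comp hXm
  have hwm : Measurable fun o => w (X δ o) := hw.measurable.comp hXm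
  refine ⟨_, hX.continuous_integral_exp_mul_of_hasCompactSupport hω hD hf hK hfK
    (g := fun x => Real.exp (w x) * cutoff N x) (by fun_prop)
    (fun x => mul_nonneg (Real.exp_pos _).le (cutoff_nonneg N x))
    (HasCompactSupport.mul_left (hasCompactSupport_cutoff N)), ?_⟩
  filter_upwards [hN, (hω.tendsto x₀).eventually_le_const (show ω x₀ < W by linarith)] with x hx hxW
  have hKω : Continuous fun x => K * (1 + ω x) := by fun_prop
  have hle : ∀ o, pathIntegral X δ f o + w (X δ o)
      ≤ K * (δ + 1) + K * (A o + ω (X δ o)) := fun o => by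
    have h1 : |pathIntegral X δ f o| ≤ K * (δ + A o) := by
      rw [hA, ← hX.pathIntegral_affine hω]
      exact hX.abs_pathIntegral_le hf hKω hfK δ o
    have h2 := (le_abs_self _).trans h1
    have h3 := (le_abs_self _).trans (hwK (X δ o))
    linarith
  have iE : Integrable (fun o => Real.exp (2 * K * (δ + 1))
      * Real.exp (2 * K * (A o + ω (X δ o)))) (P x) := (hC x).1.const_mul _
  have lE : ∫ o, Real.exp (2 * K * (δ + 1)) * Real.exp (2 * K * (A o + ω (X δ o))) ∂(P x)
      ≤ C₁ := by
    rw [integral_const_mul, hC₁]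
    refine mul_le_mul_of_nonneg_left ((hC x).2.trans (Real.exp_le_exp.2 ?_)) (Real.exp_pos _).le
    gcongr
  have hsq : ∀ o, Real.exp (pathIntegral X δ f o + w (X δ o)) ^ 2
      ≤ Real.exp (2 * K * (δ + 1)) * Real.exp (2 * K * (A o + ω (X δ o))) := fun o => by
    rw [pow_two, ← Real.exp_add, ← Real.exp_add, Real.exp_le_exp]
    linarith [hle o]
  have hm : Measurable fun o => Real.exp (pathIntegral X δ f o + w (X δ o)) := (hfm.add hwm).exp
  have i1 : Integrable (fun o => Real.exp (pathIntegral X δ f o + w (X δ o))) (P x) := by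
    refine ((integrable_const (1 : ℝ)).add iE).mono' hm.aestronglyMeasurable
      (.of_forall fun o => ?_)
    rw [Real.norm_of_nonneg (Real.exp_pos _).le]
    have := hsq o
    simp only [Pi.add_apply]
    nlinarith [sq_nonneg (Real.exp (pathIntegral X δ f o + w (X δ o)) - 1),
      Real.exp_pos (pathIntegral X δ f o + w (X δ o))]
  have i2 : Integrable (fun o => Real.exp (pathIntegral X δ f o) *
      (Real.exp (w (X δ o)) * cutoff N (X δ o))) (P x) := by
    refine i1.mono' (hfm.exp.mul (hwm.exp.mul hcm)).aestronglyMeasurable (.of_forall fun o => ?_)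
    rw [← mul_assoc, ← Real.exp_add, norm_mul, Real.norm_of_nonneg (Real.exp_pos _).le,
      Real.norm_of_nonneg (cutoff_nonneg N _)]
    exact mul_le_of_le_one_right (Real.exp_pos _).le (cutoff_le_one N _)
  have i3 : Integrable (fun o => 1 - cutoff N (X δ o)) (P x) :=
    (integrable_const (1 : ℝ)).sub (hX.integrable_comp hcN.measurable (C := 1) (fun z => by
      rw [abs_of_nonneg (cutoff_nonneg N z)]; exact cutoff_le_one N z) δ x)
  have hpt : ∀ o, ‖Real.exp (pathIntegral X δ f o + w (X δ o))
      - Real.exp (pathIntegral X δ f o) * (Real.exp (w (X δ o)) * cutoff N (X δ o))‖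
      ≤ θ / 2 * (Real.exp (2 * K * (δ + 1)) * Real.exp (2 * K * (A o + ω (X δ o))))
        + 1 / (2 * θ) * (1 - cutoff N (X δ o)) := fun o => by
    have hc0 := cutoff_nonneg N (X δ o)
    have hc1 := sub_nonneg.2 (cutoff_le_one N (X δ o))
    have hs := hsq o
    rw [← mul_assoc, ← Real.exp_add, ← mul_one_sub,
      Real.norm_of_nonneg (mul_nonneg (Real.exp_pos _).le hc1)]
    obtain ⟨e, he⟩ : ∃ e, e = Real.exp (pathIntegral X δ f o + w (X δ o)) := ⟨_, rfl⟩
    rw [← he] at hs ⊢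
    have h2 : θ / 2 * e ^ 2 + 1 / (2 * θ) * (1 - cutoff N (X δ o)) ^ 2
        - e * (1 - cutoff N (X δ o)) = 1 / (2 * θ) * (θ * e - (1 - cutoff N (X δ o))) ^ 2 := by
      field_simp
      ring
    have h3 : 0 ≤ 1 / (2 * θ) * (θ * e - (1 - cutoff N (X δ o))) ^ 2 := by positivity
    have h4 : (1 - cutoff N (X δ o)) ^ 2 ≤ 1 - cutoff N (X δ o) := by nlinarith
    calc e * (1 - cutoff N (X δ o))
        ≤ θ / 2 * e ^ 2 + 1 / (2 * θ) * (1 - cutoff N (X δ o)) ^ 2 := by linarith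
      _ ≤ _ := by gcongr
  rw [← integral_sub i1 i2]
  refine (norm_integral_le_of_norm_le ((iE.const_mul (θ / 2)).add (i3.const_mul (1 / (2 * θ))))
    (.of_forall hpt)).trans ?_
  rw [integral_add' (iE.const_mul _) (i3.const_mul _), integral_const_mul (θ / 2),
    integral_const_mul (1 / (2 * θ))]
  calc _ ≤ θ / 2 * C₁ + 1 / (2 * θ) * (θ * ε) := by gcongr
    _ = ε / 2 + ε / 2 := by
        have h1 : θ / 2 * C₁ = ε / 2 := by rw [hθ]; field_simp
        rw [h1]
        field_simp
    _ = ε := add_halves ε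

end IsFellerProcess

/-! ### Exponentially tilted laws -/

theorem exp_integral_le {Ω : Type*} [MeasurableSpace Ω] {μ : Measure Ω} [IsProbabilityMeasure μ]
    {Z : Ω → ℝ} (hZ : Integrable Z μ) (he : Integrable (fun o => Real.exp (Z o)) μ) :
    Real.exp (∫ o, Z o ∂μ) ≤ ∫ o, Real.exp (Z o) ∂μ := by
  obtain ⟨c, hc⟩ : ∃ c, c = ∫ o, Z o ∂μ := ⟨_, rfl⟩
  -- The exponential lies above its tangent at `c`.
  have hpt : ∀ o, Real.exp c * (Z o - c + 1) ≤ Real.exp (Z o) := fun o => by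
    have h1 : Real.exp (Z o) = Real.exp c * Real.exp (Z o - c) := by
      rw [← Real.exp_add]
      ring_nf
    rw [h1]
    exact mul_le_mul_of_nonneg_left (Real.add_one_le_exp _) (Real.exp_pos _).le
  have hi₀ : Integrable (fun o => Z o - c) μ := hZ.sub (integrable_const c)
  have hi : Integrable (fun o => Z o - c + 1) μ := hi₀.add (integrable_const 1)
  have h2 : ∫ o, (Z o - c + 1) ∂μ = 1 := by
    rw [integral_add hi₀ (integrable_const 1),
      integral_sub hZ (integrable_const c)]
    simp [hc]
  calc Real.exp (∫ o, Z o ∂μ) = ∫ o, Real.exp c * (Z o - c + 1) ∂μ := by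
        rw [integral_const_mul, h2, mul_one, hc]
    _ ≤ _ := integral_mono (hi.const_mul _) he hpt

/-- A Cauchy–Schwarz inequality for a `[0, 1]`-valued function and an exponential weight. -/
theorem sq_integral_le_mul {Ω : Type*} [MeasurableSpace Ω] {μ : Measure Ω} [IsProbabilityMeasure μ]
    {u h : Ω → ℝ} (hu : Integrable (fun o => Real.exp (u o)) μ)
    (hu' : Integrable (fun o => Real.exp (-u o)) μ) (hh : Measurable h) (h0 : ∀ o, 0 ≤ h o)
    (h1 : ∀ o, h o ≤ 1) :
    (∫ o, h o ∂μ) ^ 2 ≤ (∫ o, Real.exp (u o) * h o ∂μ) * ∫ o, Real.exp (-u o) ∂μ := by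
  have hhn : ∀ o, ‖h o‖ ≤ 1 := fun o => by rw [Real.norm_of_nonneg (h0 o)]; exact h1 o
  have ih : Integrable h μ := Integrable.of_bound hh.aestronglyMeasurable 1 (.of_forall hhn)
  have iuh : Integrable (fun o => Real.exp (u o) * h o) μ :=
    hu.mul_bdd hh.aestronglyMeasurable (.of_forall hhn)
  have hD : 0 < ∫ o, Real.exp (-u o) ∂μ := integral_exp_pos hu'
  obtain ⟨D, hD'⟩ : ∃ D, D = ∫ o, Real.exp (-u o) ∂μ := ⟨_, rfl⟩
  obtain ⟨H, hH⟩ : ∃ H, H = ∫ o, h o ∂μ := ⟨_, rfl⟩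
  rw [← hD', ← hH]
  rw [← hD'] at hD
  obtain ⟨t, ht⟩ : ∃ t, t = H / D := ⟨_, rfl⟩
  -- Integrate `2 t h ≤ exp u * h + t ^ 2 exp (-u)` at the optimal `t = H / D`.
  have hpt : ∀ o, 2 * t * h o ≤ Real.exp (u o) * h o + t ^ 2 * Real.exp (-u o) := fun o => by
    rw [Real.exp_neg]
    have he := Real.exp_pos (u o)
    have hs : Real.exp (u o) * h o + t ^ 2 * (Real.exp (u o))⁻¹ - 2 * t * h o
        = (Real.exp (u o))⁻¹ * (h o * (Real.exp (u o) - t) ^ 2 + t ^ 2 * (1 - h o)) := by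
      field_simp
      ring
    have hs' : 0 ≤ (Real.exp (u o))⁻¹ * (h o * (Real.exp (u o) - t) ^ 2 + t ^ 2 * (1 - h o)) :=
      mul_nonneg (inv_nonneg.2 he.le) (add_nonneg (mul_nonneg (h0 o) (sq_nonneg _))
        (mul_nonneg (sq_nonneg _) (sub_nonneg.2 (h1 o))))
    linarith
  have hint := integral_mono (ih.const_mul (2 * t)) (iuh.add (hu'.const_mul (t ^ 2))) hpt
  rw [integral_add' iuh (hu'.const_mul _), integral_const_mul, integral_const_mul, ← hH, ← hD',
    ht] at hint
  have h2 : 2 * (H / D) * H - (H / D) ^ 2 * D = H ^ 2 / D := by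
    field_simp
    ring
  rw [← div_le_iff₀ hD, ← h2]
  linarith

/-- The random variable `Z` is measurable and bounded by `K (2 + A + ω(Y))`. -/
def Dominated {Ω E : Type*} [MeasurableSpace Ω] (Y : Ω → E) (A : Ω → ℝ) (ω : E → ℝ) (K : ℝ)
    (Z : Ω → ℝ) : Prop :=
  Measurable Z ∧ ∀ o, |Z o| ≤ K * (2 + A o + ω (Y o))

namespace DriftBounds

variable {Ω E : Type*} [MeasurableSpace Ω] [MeasurableSpace E] {P : E → Measure Ω} {Y : Ω → E}
  {A : Ω → ℝ} {ω : E → ℝ} {b : ℝ} {M₁ M₂ : ℝ → ℝ}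

theorem integrable_exp (h : DriftBounds P Y A ω b M₁ M₂) {K : ℝ} (hK : 0 < K) {Z : Ω → ℝ}
    (hZ : Dominated Y A ω K Z) (t : ℝ) (x : E) :
    Integrable (fun o => Real.exp (t * Z o)) (P x) := by
  have ha : 0 < (|t| + 1) * K := by positivity
  obtain ⟨C, hC⟩ := h.exists_exp_le ha
  refine ((hC x).1.const_mul (Real.exp ((|t| + 1) * K * 2))).mono'
    (hZ.1.const_mul t).exp.aestronglyMeasurable (.of_forall fun o => ?_)
  rw [Real.norm_of_nonneg (Real.exp_pos _).le, ← Real.exp_add, Real.exp_le_exp]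
  calc t * Z o ≤ |t| * |Z o| := (le_abs_self _).trans (abs_mul _ _).le
    _ ≤ (|t| + 1) * |Z o| := by nlinarith [abs_nonneg (Z o)]
    _ ≤ (|t| + 1) * (K * (2 + A o + ω (Y o))) :=
        mul_le_mul_of_nonneg_left (hZ.2 o) (by positivity)
    _ = _ := by ring

/-- Exponential moments of dominated random variables are bounded above and below by exponentials
that are affine in `ω`. -/
theorem exists_integral_exp_bounds (h : DriftBounds P Y A ω b M₁ M₂) {K : ℝ} (hK : 0 < K) (t : ℝ) :
    ∃ C, 0 ≤ C ∧ ∀ Z, Dominated Y A ω K Z → ∀ x,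
      Real.exp (-(C * (1 + ω x))) ≤ ∫ o, Real.exp (t * Z o) ∂(P x) ∧
      ∫ o, Real.exp (t * Z o) ∂(P x) ≤ Real.exp (C * (1 + ω x)) := by
  have hP := h.prob
  obtain ⟨a, haK⟩ : ∃ a, a = (|t| + 1) * K := ⟨_, rfl⟩
  have ha : 0 < a := haK ▸ by positivity
  obtain ⟨C, hC⟩ := h.exists_exp_le ha
  obtain ⟨D, hD⟩ : ∃ D, D = 2 * a + |C| := ⟨_, rfl⟩
  have hup : ∀ s : ℝ, |s| = |t| → ∀ Z, Dominated Y A ω K Z → ∀ x,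
      ∫ o, Real.exp (s * Z o) ∂(P x) ≤ Real.exp (D * (1 + ω x)) := by
    intro s hs Z hZ x
    have hω := h.weight_nonneg x
    calc ∫ o, Real.exp (s * Z o) ∂(P x)
        ≤ ∫ o, Real.exp (a * 2) * Real.exp (a * (A o + ω (Y o))) ∂(P x) := by
          refine integral_mono (h.integrable_exp hK hZ s x) ((hC x).1.const_mul _) fun o => ?_
          rw [← Real.exp_add, Real.exp_le_exp, haK]
          calc s * Z o ≤ |t| * |Z o| := (le_abs_self _).trans (by rw [abs_mul, hs])
            _ ≤ (|t| + 1) * |Z o| := by nlinarith [abs_nonneg (Z o)]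
            _ ≤ (|t| + 1) * (K * (2 + A o + ω (Y o))) :=
                mul_le_mul_of_nonneg_left (hZ.2 o) (by positivity)
            _ = _ := by ring
      _ = Real.exp (a * 2) * ∫ o, Real.exp (a * (A o + ω (Y o))) ∂(P x) := integral_const_mul _ _
      _ ≤ Real.exp (a * 2) * Real.exp (2 * a * ω x + C) :=
          mul_le_mul_of_nonneg_left (hC x).2 (Real.exp_pos _).le
      _ ≤ Real.exp (D * (1 + ω x)) := by
          rw [← Real.exp_add, Real.exp_le_exp, hD]
          nlinarith [le_abs_self C, abs_nonneg C]
  refine ⟨D, hD ▸ by positivity, fun Z hZ x => ⟨?_, hup t rfl Z hZ x⟩⟩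
  have i1 := h.integrable_exp hK hZ t x
  have i2 : Integrable (fun o => Real.exp (-(t * Z o))) (P x) := by
    simpa only [neg_mul] using h.integrable_exp hK hZ (-t) x
  have hcs := sq_integral_le_mul i1 i2 (h := fun _ => 1) measurable_const (fun _ => zero_le_one)
    fun _ => le_rfl
  simp only [mul_one, integral_const, probReal_univ, smul_eq_mul, one_pow] at hcs
  have h2 : ∫ o, Real.exp (-(t * Z o)) ∂(P x) ≤ Real.exp (D * (1 + ω x)) := by
    simpa only [neg_mul] using hup (-t) (abs_neg t) Z hZ x
  rw [Real.exp_neg, inv_le_iff_one_le_mul₀ (Real.exp_pos _)]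
  exact hcs.trans (mul_le_mul_of_nonneg_left h2 (integral_exp_pos i1).le)

theorem integrable_exp_add_weight (h : DriftBounds P Y A ω b M₁ M₂) {K : ℝ} (hK : 0 < K)
    {Z : Ω → ℝ} (hZ : Dominated Y A ω K Z) (t : ℝ) {θ : ℝ} (hθ : 0 < θ) (x : E) :
    Integrable (fun o => Real.exp (t * Z o + θ * ω (Y o))) (P x) := by
  have hωm : Measurable fun o => ω (Y o) := h.measurable_weight.comp h.measurable_state
  refine ((h.integrable_exp hK hZ (2 * t) x).add (h.exp_weight (2 * θ) (by positivity) x).1).mono'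
    ((hZ.1.const_mul t).add (hωm.const_mul θ)).exp.aestronglyMeasurable (.of_forall fun o => ?_)
  rw [Real.norm_of_nonneg (Real.exp_pos _).le]
  simp only [Pi.add_apply]
  rcases le_total (t * Z o) (θ * ω (Y o)) with hle | hle
  · refine (Real.exp_le_exp.2 ?_).trans (le_add_of_nonneg_left (Real.exp_pos _).le)
    linarith
  · refine (Real.exp_le_exp.2 ?_).trans (le_add_of_nonneg_right (Real.exp_pos _).le)
    linarith

theorem isProbabilityMeasure_tilted (h : DriftBounds P Y A ω b M₁ M₂) {K : ℝ} (hK : 0 < K)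
    {Z : Ω → ℝ} (hZ : Dominated Y A ω K Z) (t : ℝ) (x : E) :
    IsProbabilityMeasure ((P x).tilted fun o => t * Z o) := by
  have hP := h.prob
  exact MeasureTheory.isProbabilityMeasure_tilted (h.integrable_exp hK hZ t x)

theorem integrable_weight_tilted (h : DriftBounds P Y A ω b M₁ M₂) {K : ℝ} (hK : 0 < K)
    {Z : Ω → ℝ} (hZ : Dominated Y A ω K Z) (t : ℝ) (x : E) :
    Integrable (fun o => ω (Y o)) ((P x).tilted fun o => t * Z o) := by
  rw [integrable_tilted_iff (h.integrable_exp hK hZ t x)]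
  have hωm : Measurable fun o => ω (Y o) := h.measurable_weight.comp h.measurable_state
  refine (h.integrable_exp_add_weight hK hZ t one_pos x).mono'
    ((hZ.1.const_mul t).exp.smul hωm).aestronglyMeasurable (.of_forall fun o => ?_)
  rw [smul_eq_mul, norm_mul, Real.norm_of_nonneg (Real.exp_pos _).le,
    Real.norm_of_nonneg (h.weight_nonneg _), Real.exp_add, one_mul]
  refine mul_le_mul_of_nonneg_left ?_ (Real.exp_pos _).le
  linarith [Real.add_one_le_exp (ω (Y o))]

/-- Tilting by a dominated random variable preserves the geometric drift. By Jensen's inequality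
`θ E_Q ω(Y) ≤ log E_Q exp (θ ω(Y))`, and for large `θ` the cost `C (1 + ω) / θ` of the change of
measure is negligible with respect to the drift rate of the original law. -/
theorem exists_tilted_drift (h : DriftBounds P Y A ω b M₁ M₂) {K : ℝ} (hK : 0 < K) (t : ℝ) :
    ∃ b' M, 0 < b' ∧ b' < 1 ∧ 0 ≤ M ∧ ∀ Z, Dominated Y A ω K Z → ∀ x,
      ∫ o, ω (Y o) ∂((P x).tilted fun o => t * Z o) ≤ b' * ω x + M := by
  have hP := h.prob
  have hb0 := h.rate_pos
  have hb1 := h.rate_lt_one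
  obtain ⟨C, hC0, hC⟩ := h.exists_integral_exp_bounds hK t
  obtain ⟨D, hD0, hD⟩ := h.exists_integral_exp_bounds hK (2 * t)
  obtain ⟨G, hG⟩ : ∃ G, G = C + D / 2 + 1 := ⟨_, rfl⟩
  have hG0 : 0 < G := hG ▸ by positivity
  obtain ⟨θ, hθ⟩ : ∃ θ, θ = 2 * G / (1 - b) := ⟨_, rfl⟩
  have hθ0 : 0 < θ := hθ ▸ div_pos (by positivity) (by linarith)
  have hGθ : G / θ = (1 - b) / 2 := by
    rw [hθ]
    have : 1 - b ≠ 0 := by linarith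
    field_simp
  refine ⟨(1 + b) / 2, (1 - b) / 2 + |M₂ (2 * θ)|, by linarith, by linarith,
    add_nonneg (by linarith) (abs_nonneg _), fun Z hZ x => ?_⟩
  have hω := h.weight_nonneg x
  have := h.isProbabilityMeasure_tilted hK hZ t x
  have iZ := h.integrable_exp hK hZ t x
  have iZ2 := h.integrable_exp hK hZ (2 * t) x
  have iω2 := (h.exp_weight (2 * θ) (by positivity) x).1
  have iZω := h.integrable_exp_add_weight hK hZ t hθ0 x
  have iQ := h.integrable_weight_tilted hK hZ t x
  have ieQ : Integrable (fun o => Real.exp (θ * ω (Y o))) ((P x).tilted fun o => t * Z o) := by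
    rw [integrable_tilted_iff iZ]
    simpa only [smul_eq_mul, ← Real.exp_add] using iZω
  have hJ := exp_integral_le (iQ.const_mul θ) ieQ
  rw [integral_const_mul, integral_exp_tilted] at hJ
  simp only [Pi.add_apply] at hJ
  obtain ⟨c₁, hc₁⟩ : ∃ c₁, c₁ = D * (1 + ω x) := ⟨_, rfl⟩
  obtain ⟨c₂, hc₂⟩ : ∃ c₂, c₂ = 2 * θ * (b * ω x + M₂ (2 * θ)) := ⟨_, rfl⟩
  have hnum : ∫ o, Real.exp (t * Z o + θ * ω (Y o)) ∂(P x) ≤ Real.exp ((c₁ + c₂) / 2) := by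
    obtain ⟨q, hq⟩ : ∃ q, q = (c₂ - c₁) / 2 := ⟨_, rfl⟩
    have hpt : ∀ o, Real.exp (t * Z o + θ * ω (Y o))
        ≤ Real.exp q / 2 * Real.exp (2 * t * Z o) + Real.exp (-q) / 2 *
          Real.exp (2 * θ * ω (Y o)) := fun o => by
      have e1 : Real.exp q * Real.exp (2 * t * Z o) = Real.exp (q / 2 + t * Z o) ^ 2 := by
        rw [pow_two, ← Real.exp_add, ← Real.exp_add]
        ring_nf
      have e2 : Real.exp (-q) * Real.exp (2 * θ * ω (Y o))
          = Real.exp (-(q / 2) + θ * ω (Y o)) ^ 2 := by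
        rw [pow_two, ← Real.exp_add, ← Real.exp_add]
        ring_nf
      have e3 : Real.exp (t * Z o + θ * ω (Y o))
          = Real.exp (q / 2 + t * Z o) * Real.exp (-(q / 2) + θ * ω (Y o)) := by
        rw [← Real.exp_add]
        ring_nf
      rw [e3, div_mul_eq_mul_div, div_mul_eq_mul_div, e1, e2]
      nlinarith [sq_nonneg (Real.exp (q / 2 + t * Z o) - Real.exp (-(q / 2) + θ * ω (Y o)))]
    calc ∫ o, Real.exp (t * Z o + θ * ω (Y o)) ∂(P x)
        ≤ ∫ o, (Real.exp q / 2 * Real.exp (2 * t * Z o) + Real.exp (-q) / 2 *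
          Real.exp (2 * θ * ω (Y o))) ∂(P x) :=
          integral_mono iZω ((iZ2.const_mul _).add (iω2.const_mul _)) hpt
      _ = Real.exp q / 2 * ∫ o, Real.exp (2 * t * Z o) ∂(P x)
          + Real.exp (-q) / 2 * ∫ o, Real.exp (2 * θ * ω (Y o)) ∂(P x) := by
          rw [integral_add (iZ2.const_mul _) (iω2.const_mul _), integral_const_mul,
            integral_const_mul]
      _ ≤ Real.exp q / 2 * Real.exp c₁ + Real.exp (-q) / 2 * Real.exp c₂ := by
          gcongr
          · rw [hc₁]
            exact (hD Z hZ x).2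
          · rw [hc₂]
            exact (h.exp_weight (2 * θ) (by positivity) x).2
      _ = Real.exp ((c₁ + c₂) / 2) := by
          rw [div_mul_eq_mul_div, div_mul_eq_mul_div, ← Real.exp_add, ← Real.exp_add, hq]
          ring_nf
  have hden := (hC Z hZ x).1
  have hlog : θ * ∫ o, ω (Y o) ∂((P x).tilted fun o => t * Z o)
      ≤ (c₁ + c₂) / 2 + C * (1 + ω x) := by
    rw [← Real.exp_le_exp]
    refine hJ.trans ?_
    rw [div_le_iff₀ (integral_exp_pos iZ)]
    refine hnum.trans ?_
    calc Real.exp ((c₁ + c₂) / 2)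
        = Real.exp ((c₁ + c₂) / 2 + C * (1 + ω x)) * Real.exp (-(C * (1 + ω x))) := by
          rw [← Real.exp_add]
          ring_nf
      _ ≤ _ := mul_le_mul_of_nonneg_left hden (Real.exp_pos _).le
  have hle : ∫ o, ω (Y o) ∂((P x).tilted fun o => t * Z o)
      ≤ G / θ * (1 + ω x) + (b * ω x + M₂ (2 * θ)) := by
    have h1 : θ * (G / θ * (1 + ω x) + (b * ω x + M₂ (2 * θ)))
        = G * (1 + ω x) + θ * (b * ω x + M₂ (2 * θ)) := by
      field_simp
    refine le_of_mul_le_mul_left ?_ hθ0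
    rw [h1]
    refine hlog.trans ?_
    rw [hc₁, hc₂, hG]
    nlinarith
  rw [hGθ] at hle
  linarith [le_abs_self (M₂ (2 * θ))]

/-- A minorization of the law of the terminal state survives tilting in a quadratic form, by the
Cauchy–Schwarz inequality. -/
theorem exists_tilted_minorization (h : DriftBounds P Y A ω b M₁ M₂) {K : ℝ} (hK : 0 < K) (t : ℝ)
    {R d : ℝ} (hd : 0 < d) {ν : Measure E} [IsProbabilityMeasure ν]
    (hν : ∀ x, ω x ≤ R → ∀ B : Set E, MeasurableSet B → ENNReal.ofReal d * ν B ≤ P x (Y ⁻¹' B)) :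
    ∃ κ > 0, ∀ Z, Dominated Y A ω K Z → ∀ x, ω x ≤ R → ∀ g : E → ℝ, Measurable g →
      (∀ y, 0 ≤ g y) → (∀ y, g y ≤ 1) →
      κ * (∫ y, g y ∂ν) ^ 2 ≤ ∫ o, g (Y o) ∂((P x).tilted fun o => t * Z o) := by
  have hP := h.prob
  obtain ⟨C, hC0, hC⟩ := h.exists_integral_exp_bounds hK t
  obtain ⟨D, hD0, hD⟩ := h.exists_integral_exp_bounds hK (-t)
  refine ⟨d ^ 2 / (Real.exp (C * (1 + R)) * Real.exp (D * (1 + R))), by positivity,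
    fun Z hZ x hx g hg g0 g1 => ?_⟩
  have hgY : Measurable fun o => g (Y o) := hg.comp h.measurable_state
  have hgb : ∀ y, ‖g y‖ ≤ 1 := fun y => by rw [Real.norm_of_nonneg (g0 y)]; exact g1 y
  have igY : Integrable (fun o => g (Y o)) (P x) :=
    Integrable.of_bound hgY.aestronglyMeasurable 1 (.of_forall fun o => hgb _)
  have ig : Integrable g ν := Integrable.of_bound hg.aestronglyMeasurable 1 (.of_forall hgb)
  have hmin : d * ∫ y, g y ∂ν ≤ ∫ o, g (Y o) ∂(P x) := by
    have hle : ENNReal.ofReal d • ν ≤ (P x).map Y := by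
      refine Measure.le_iff.2 fun B hB => ?_
      rw [Measure.map_apply h.measurable_state hB]
      exact hν x hx B hB
    have h1 : ∫ y, g y ∂(ENNReal.ofReal d • ν) ≤ ∫ y, g y ∂((P x).map Y) :=
      integral_mono_measure hle (.of_forall g0)
        ((integrable_map_measure hg.aestronglyMeasurable
          h.measurable_state.aemeasurable).2 igY)
    rwa [integral_smul_measure, ENNReal.toReal_ofReal hd.le, smul_eq_mul,
      integral_map h.measurable_state.aemeasurable hg.aestronglyMeasurable] at h1
  have hν0 : 0 ≤ ∫ y, g y ∂ν := integral_nonneg g0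
  have i1 := h.integrable_exp hK hZ t x
  have i2 : Integrable (fun o => Real.exp (-(t * Z o))) (P x) := by
    simpa only [neg_mul] using h.integrable_exp hK hZ (-t) x
  have hcs := sq_integral_le_mul i1 i2 hgY (fun o => g0 _) fun o => g1 _
  have hN := (hC Z hZ x).2
  have hN0 : 0 < ∫ o, Real.exp (t * Z o) ∂(P x) := integral_exp_pos i1
  have hI : ∫ o, Real.exp (-(t * Z o)) ∂(P x) ≤ Real.exp (D * (1 + R)) := by
    have := (hD Z hZ x).2
    simp only [neg_mul] at this
    refine this.trans (Real.exp_le_exp.2 ?_)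
    gcongr
  have hQ : ∫ o, g (Y o) ∂((P x).tilted fun o => t * Z o)
      = (∫ o, Real.exp (t * Z o) * g (Y o) ∂(P x)) / ∫ o, Real.exp (t * Z o) ∂(P x) := by
    rw [integral_tilted, ← integral_div]
    refine integral_congr_ae (.of_forall fun o => ?_)
    simp only [smul_eq_mul]
    ring
  have hJ0 : 0 ≤ ∫ o, Real.exp (t * Z o) * g (Y o) ∂(P x) :=
    integral_nonneg fun o => mul_nonneg (Real.exp_pos _).le (g0 _)
  rw [hQ, le_div_iff₀ hN0, div_mul_eq_mul_div, div_mul_eq_mul_div, div_le_iff₀ (by positivity)]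
  have hsq : d ^ 2 * (∫ y, g y ∂ν) ^ 2
      ≤ (∫ o, Real.exp (t * Z o) * g (Y o) ∂(P x)) * Real.exp (D * (1 + R)) := by
    rw [← mul_pow]
    exact (pow_le_pow_left₀ (mul_nonneg hd.le hν0) hmin 2).trans
      (hcs.trans (mul_le_mul_of_nonneg_left hI hJ0))
  have hN' : ∫ o, Real.exp (t * Z o) ∂(P x) ≤ Real.exp (C * (1 + R)) := by
    refine hN.trans (Real.exp_le_exp.2 ?_)
    gcongr
  calc d ^ 2 * (∫ y, g y ∂ν) ^ 2 * ∫ o, Real.exp (t * Z o) ∂(P x)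
      ≤ ((∫ o, Real.exp (t * Z o) * g (Y o) ∂(P x)) * Real.exp (D * (1 + R)))
        * Real.exp (C * (1 + R)) := mul_le_mul hsq hN' hN0.le (by positivity)
    _ = _ := by ring

end DriftBounds

/-! ### Contraction of tilted expectations in a weighted span seminorm -/

/-- A function of weighted span at most `s` is within `s (1 + β ω)` of a constant. -/
theorem exists_abs_sub_const_le {E : Type*} [Nonempty E] {ω g : E → ℝ} {β s : ℝ}
    (hg : ∀ x y, g x - g y ≤ s * (2 + β * ω x + β * ω y)) :
    ∃ k, ∀ x, |g x - k| ≤ s * (1 + β * ω x) := by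
  have hle : ∀ x y, g x - s * (1 + β * ω x) ≤ g y + s * (1 + β * ω y) := fun x y => by
    linarith [hg x y]
  have hbdd : BddAbove (Set.range fun x => g x - s * (1 + β * ω x)) :=
    ⟨g (Classical.arbitrary E) + s * (1 + β * ω (Classical.arbitrary E)), by
      rintro _ ⟨x, rfl⟩
      exact hle x _⟩
  refine ⟨⨆ x, (g x - s * (1 + β * ω x)), fun x => abs_le.2 ⟨?_, ?_⟩⟩
  · have := ciSup_le fun y => hle y x
    linarith
  · have : g x - s * (1 + β * ω x) ≤ ⨆ x, (g x - s * (1 + β * ω x)) := le_ciSup hbdd x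
    linarith

/-- A function bounded by `s (1 + v)` in absolute value is the sum of an affine image of a
`[0, 1]`-valued function and of a remainder bounded by `s v`. -/
theorem abs_sub_affine_clamp_le {s v u : ℝ} (hs : 0 < s) (hv : 0 ≤ v) (hu : |u| ≤ s * (1 + v)) :
    |u - s * (2 * max 0 (min 1 ((u / s + 1) / 2)) - 1)| ≤ s * v := by
  obtain ⟨z, hz⟩ : ∃ z, z = u / s := ⟨_, rfl⟩
  have hus : u = s * z := by rw [hz]; field_simp
  rw [← hz]
  rw [hus, abs_mul, abs_of_pos hs] at hu
  have hz1 : |z| ≤ 1 + v := le_of_mul_le_mul_left hu hs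
  rw [hus, ← mul_sub, abs_mul, abs_of_pos hs]
  refine mul_le_mul_of_nonneg_left ?_ hs.le
  obtain ⟨h1, h2⟩ := abs_le.1 hz1
  rcases le_total z (-1) with hc | hc
  · rw [max_eq_left ((min_le_right _ _).trans (by linarith)), abs_le]
    constructor <;> linarith
  · rcases le_total z 1 with hc' | hc'
    · rw [min_eq_right (by linarith), max_eq_right (by linarith)]
      ring_nf
      simpa using hv
    · rw [min_eq_left (by linarith), max_eq_right zero_le_one, abs_le]
      constructor <;> linarith

/-- Two laws that dominate, quadratically, a common probability measure give close expectations to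
functions bounded by `s (1 + β ω)` up to a constant. -/
theorem integral_sub_integral_le_of_minorization {Ω E : Type*} [MeasurableSpace Ω]
    [MeasurableSpace E] {Q₁ Q₂ : Measure Ω} [IsProbabilityMeasure Q₁] [IsProbabilityMeasure Q₂]
    {Y : Ω → E} (hY : Measurable Y) {ω : E → ℝ} (hω : ∀ x, 0 ≤ ω x)
    (i₁ : Integrable (fun o => ω (Y o)) Q₁) (i₂ : Integrable (fun o => ω (Y o)) Q₂)
    {ν : Measure E} [IsProbabilityMeasure ν] {κ : ℝ} (hκ : 0 ≤ κ)
    (h₁ : ∀ h : E → ℝ, Measurable h → (∀ y, 0 ≤ h y) → (∀ y, h y ≤ 1) →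
      κ * (∫ y, h y ∂ν) ^ 2 ≤ ∫ o, h (Y o) ∂Q₁)
    (h₂ : ∀ h : E → ℝ, Measurable h → (∀ y, 0 ≤ h y) → (∀ y, h y ≤ 1) →
      κ * (∫ y, h y ∂ν) ^ 2 ≤ ∫ o, h (Y o) ∂Q₂)
    {g : E → ℝ} (hg : Measurable g) {s β k : ℝ} (hs : 0 < s) (hβ : 0 ≤ β)
    (hgk : ∀ x, |g x - k| ≤ s * (1 + β * ω x)) :
    ∫ o, g (Y o) ∂Q₁ - ∫ o, g (Y o) ∂Q₂
      ≤ s * (2 - κ + β * (∫ o, ω (Y o) ∂Q₁ + ∫ o, ω (Y o) ∂Q₂)) := by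
  obtain ⟨h, hh⟩ : ∃ h : E → ℝ, ∀ y, h y = max 0 (min 1 (((g y - k) / s + 1) / 2)) :=
    ⟨_, fun _ => rfl⟩
  have hm : Measurable h := by
    rw [show h = fun y => max 0 (min 1 (((g y - k) / s + 1) / 2)) from funext hh]
    fun_prop
  have h0 : ∀ y, 0 ≤ h y := fun y => hh y ▸ le_max_left _ _
  have h1 : ∀ y, h y ≤ 1 := fun y => hh y ▸ max_le zero_le_one (min_le_left _ _)
  have hrem : ∀ y, |g y - k - s * (2 * h y - 1)| ≤ s * (β * ω y) := fun y => by
    rw [hh]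
    exact abs_sub_affine_clamp_le hs (mul_nonneg hβ (hω y)) (hgk y)
  have hhY : Measurable fun o => h (Y o) := hm.comp hY
  have hbd : ∀ o, ‖h (Y o)‖ ≤ 1 := fun o => by rw [Real.norm_of_nonneg (h0 _)]; exact h1 _
  have ih : ∀ Q : Measure Ω, IsProbabilityMeasure Q → Integrable (fun o => h (Y o)) Q :=
    fun Q _ => Integrable.of_bound hhY.aestronglyMeasurable 1 (.of_forall hbd)
  have iaff : ∀ Q : Measure Ω, IsProbabilityMeasure Q →
      Integrable (fun o => k + s * (2 * h (Y o) - 1)) Q := fun Q _ =>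
    (integrable_const k).add ((((ih Q ‹_›).const_mul 2).sub (integrable_const 1)).const_mul s)
  have eaff : ∀ Q : Measure Ω, IsProbabilityMeasure Q →
      ∫ o, (k + s * (2 * h (Y o) - 1)) ∂Q = k + s * (2 * ∫ o, h (Y o) ∂Q - 1) := fun Q _ => by
    have j1 : Integrable (fun o => 2 * h (Y o)) Q := (ih Q ‹_›).const_mul 2
    have j2 : Integrable (fun o => 2 * h (Y o) - 1) Q := j1.sub (integrable_const 1)
    rw [integral_add (integrable_const k) (j2.const_mul s), integral_const_mul,
      integral_sub j1 (integrable_const 1), integral_const_mul]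
    simp
  have ig : ∀ Q : Measure Ω, IsProbabilityMeasure Q → Integrable (fun o => ω (Y o)) Q →
      Integrable (fun o => g (Y o)) Q := fun Q _ iω => by
    have j : Integrable (fun o => |k| + s * (1 + β * ω (Y o))) Q :=
      (integrable_const _).add (((integrable_const 1).add (iω.const_mul β)).const_mul s)
    refine j.mono' (hg.comp hY).aestronglyMeasurable (.of_forall fun o => ?_)
    have h2 := hgk (Y o)
    have h3 := abs_add_le (g (Y o) - k) k
    rw [sub_add_cancel] at h3
    rw [Real.norm_eq_abs]
    linarith
  have up : ∫ o, g (Y o) ∂Q₁ ≤ k + s * (2 * ∫ o, h (Y o) ∂Q₁ - 1)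
      + s * (β * ∫ o, ω (Y o) ∂Q₁) := by
    have j : Integrable (fun o => s * (β * ω (Y o))) Q₁ := (i₁.const_mul β).const_mul s
    have hle := integral_mono (ig Q₁ ‹_› i₁) ((iaff Q₁ ‹_›).add j) fun o => by
      have := (abs_le.1 (hrem (Y o))).2
      simp only [Pi.add_apply]
      linarith
    rwa [integral_add' (iaff Q₁ ‹_›) j, eaff Q₁ ‹_›, integral_const_mul, integral_const_mul] at hle
  have low : k + s * (2 * ∫ o, h (Y o) ∂Q₂ - 1) - s * (β * ∫ o, ω (Y o) ∂Q₂)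
      ≤ ∫ o, g (Y o) ∂Q₂ := by
    have j : Integrable (fun o => s * (β * ω (Y o))) Q₂ := (i₂.const_mul β).const_mul s
    have hle := integral_mono ((iaff Q₂ ‹_›).sub j) (ig Q₂ ‹_› i₂) fun o => by
      have := (abs_le.1 (hrem (Y o))).1
      simp only [Pi.sub_apply]
      linarith
    rwa [integral_sub' (iaff Q₂ ‹_›) j, eaff Q₂ ‹_›, integral_const_mul, integral_const_mul] at hle
  -- The two laws put mass on `1 - h` and `h` respectively.
  have hmass : ∫ o, h (Y o) ∂Q₁ - ∫ o, h (Y o) ∂Q₂ ≤ 1 - κ / 2 := by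
    have e1 := h₁ (fun y => 1 - h y) (hm.const_sub 1) (fun y => sub_nonneg.2 (h1 y))
      fun y => by linarith [h0 y]
    have e2 := h₂ h hm h0 h1
    have iν : Integrable h ν := Integrable.of_bound hm.aestronglyMeasurable 1
      (.of_forall fun y => by rw [Real.norm_of_nonneg (h0 y)]; exact h1 y)
    rw [integral_sub (integrable_const 1) iν, integral_sub (integrable_const 1) (ih Q₁ ‹_›)] at e1
    simp only [integral_const, probReal_univ, smul_eq_mul, mul_one] at e1
    nlinarith [mul_nonneg hκ (sq_nonneg (2 * (∫ y, h y ∂ν) - 1))]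
  nlinarith

namespace DriftBounds

variable {Ω E : Type*} [MeasurableSpace Ω] [MeasurableSpace E] {P : E → Measure Ω} {Y : Ω → E}
  {A : Ω → ℝ} {ω : E → ℝ} {b : ℝ} {M₁ M₂ : ℝ → ℝ}

/-- Harris-type contraction for tilted laws: expectations of a function of weighted span at most `s`
under two tilted laws differ by at most `L s (2 + β p + β q)`, where `p` and `q` control the weights
of the starting points up to the level `R₀`. When `p + q` is large the drift gives the contraction;
otherwise the minorization gives it, for `β` small. -/
theorem exists_tilted_contraction (h : DriftBounds P Y A ω b M₁ M₂) {K : ℝ} (hK : 0 < K) (t : ℝ)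
    {R₀ : ℝ} (hR₀ : 0 ≤ R₀)
    (hminor : ∀ R : ℝ, 0 < R → ∃ d : ℝ, 0 < d ∧ ∃ ν : Measure E, IsProbabilityMeasure ν ∧
      ∀ x, ω x ≤ R → ∀ B : Set E, MeasurableSet B → ENNReal.ofReal d * ν B ≤ P x (Y ⁻¹' B)) :
    ∃ β L : ℝ, 0 < β ∧ 0 < L ∧ L < 1 ∧ ∀ Z₁ Z₂, Dominated Y A ω K Z₁ → Dominated Y A ω K Z₂ →
      ∀ (g : E → ℝ) (s : ℝ), Measurable g → 0 < s →
      (∀ x y, g x - g y ≤ s * (2 + β * ω x + β * ω y)) →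
      ∀ (x y : E) (p q : ℝ), 0 ≤ p → 0 ≤ q → ω x ≤ max p R₀ → ω y ≤ max q R₀ →
      ∫ o, g (Y o) ∂((P x).tilted fun o => t * Z₁ o)
        - ∫ o, g (Y o) ∂((P y).tilted fun o => t * Z₂ o) ≤ L * (s * (2 + β * p + β * q)) := by
  obtain ⟨b₁, M, hb0, hb1, hM0, hdrift⟩ := h.exists_tilted_drift hK t
  obtain ⟨M', hM'⟩ : ∃ M', M' = M + b₁ * R₀ := ⟨_, rfl⟩
  have hM'0 : 0 ≤ M' := hM' ▸ by positivity
  obtain ⟨R, hR⟩ : ∃ R, R = 4 * M' / (1 - b₁) + 1 := ⟨_, rfl⟩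
  have h1b : 0 < 1 - b₁ := by linarith
  have hR0 : 0 < R := hR ▸ by positivity
  have hRM : 2 * M' ≤ (1 - b₁) / 2 * R := by
    have : (1 - b₁) / 2 * R = 2 * M' + (1 - b₁) / 2 := by
      rw [hR]
      field_simp
      ring
    linarith
  obtain ⟨d, hd, ν, hνp, hν⟩ := hminor (max R R₀) (lt_max_of_lt_left hR0)
  obtain ⟨κ, hκ, hκmin⟩ := h.exists_tilted_minorization hK t hd hν
  obtain ⟨β, hβ⟩ : ∃ β, β = κ / (4 * M' + 1) := ⟨_, rfl⟩
  have hβ0 : 0 < β := hβ ▸ by positivity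
  have hβM : 2 * β * M' ≤ κ / 2 := by
    rw [hβ, mul_div_assoc', div_mul_eq_mul_div, div_le_div_iff₀ (by positivity) two_pos]
    nlinarith
  obtain ⟨b₂, hb₂⟩ : ∃ b₂, b₂ = (1 + b₁) / 2 := ⟨_, rfl⟩
  obtain ⟨L₁, hL₁⟩ : ∃ L₁, L₁ = (2 + β * b₂ * R) / (2 + β * R) := ⟨_, rfl⟩
  have hden : 0 < 2 + β * R := by positivity
  have hb₂0 : 0 < b₂ := by linarith
  have hb₂1 : b₂ < 1 := by linarith
  have hL₁1 : L₁ < 1 := by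
    rw [hL₁, div_lt_one hden]
    nlinarith [mul_pos hβ0 hR0]
  have hL₁b : b₂ ≤ L₁ := by
    rw [hL₁, le_div_iff₀ hden]
    nlinarith
  refine ⟨β, max L₁ (1 - κ / 4), hβ0, (hb₂0.trans_le hL₁b).trans_le (le_max_left _ _),
    max_lt hL₁1 (by linarith), fun Z₁ Z₂ hZ₁ hZ₂ g s hg hs hspan x y p q hp hq hxp hyq => ?_⟩
  have hP1 := h.isProbabilityMeasure_tilted hK hZ₁ t x
  have hP2 := h.isProbabilityMeasure_tilted hK hZ₂ t y
  have hEω1 : ∫ o, ω (Y o) ∂((P x).tilted fun o => t * Z₁ o) ≤ b₁ * p + M' := by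
    have hmax : max p R₀ ≤ p + R₀ := max_le (by linarith) (by linarith)
    have := hdrift Z₁ hZ₁ x
    rw [hM']
    nlinarith
  have hEω2 : ∫ o, ω (Y o) ∂((P y).tilted fun o => t * Z₂ o) ≤ b₁ * q + M' := by
    have hmax : max q R₀ ≤ q + R₀ := max_le (by linarith) (by linarith)
    have := hdrift Z₂ hZ₂ y
    rw [hM']
    nlinarith
  have iω1 := h.integrable_weight_tilted hK hZ₁ t x
  have iω2 := h.integrable_weight_tilted hK hZ₂ t y
  obtain ⟨k, hk⟩ : ∃ k, ∀ z, |g z - k| ≤ s * (1 + β * ω z) := by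
    have : Nonempty E := ⟨x⟩
    exact exists_abs_sub_const_le hspan
  have hω := h.weight_nonneg
  have hpq : 2 + β * p + β * q = 2 + β * (p + q) := by ring
  rw [hpq, mul_left_comm]
  rcases le_total (p + q) R with hpqR | hpqR
  · have hxR : ω x ≤ max R R₀ := hxp.trans (max_le_max_right _ (by linarith))
    have hyR : ω y ≤ max R R₀ := hyq.trans (max_le_max_right _ (by linarith))
    refine (integral_sub_integral_le_of_minorization h.measurable_state hω iω1 iω2 hκ.le
      (hκmin Z₁ hZ₁ x hxR) (hκmin Z₂ hZ₂ y hyR) hg hs hβ0.le hk).trans ?_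
    refine mul_le_mul_of_nonneg_left ?_ hs.le
    have hS : 0 ≤ β * (p + q) := by positivity
    have h1 : β * (∫ o, ω (Y o) ∂((P x).tilted fun o => t * Z₁ o)
        + ∫ o, ω (Y o) ∂((P y).tilted fun o => t * Z₂ o)) ≤ β * (b₁ * (p + q) + 2 * M') :=
      mul_le_mul_of_nonneg_left (by linarith) hβ0.le
    have h2 : (1 - κ / 4) * 2 ≤ max L₁ (1 - κ / 4) * 2 :=
      mul_le_mul_of_nonneg_right (le_max_right _ _) zero_le_two
    have h3 : b₁ * (β * (p + q)) ≤ max L₁ (1 - κ / 4) * (β * (p + q)) :=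
      mul_le_mul_of_nonneg_right ((by linarith : b₁ ≤ L₁).trans (le_max_left _ _)) hS
    linarith
  · refine (integral_sub_integral_le_of_minorization (ν := ν) (κ := 0) h.measurable_state hω
      iω1 iω2 le_rfl (fun f _ f0 _ => ?_) (fun f _ f0 _ => ?_) hg hs hβ0.le hk).trans ?_
    · rw [zero_mul]
      exact integral_nonneg fun o => f0 _
    · rw [zero_mul]
      exact integral_nonneg fun o => f0 _
    refine mul_le_mul_of_nonneg_left ?_ hs.le
    have h1 : β * (∫ o, ω (Y o) ∂((P x).tilted fun o => t * Z₁ o)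
        + ∫ o, ω (Y o) ∂((P y).tilted fun o => t * Z₂ o)) ≤ β * (b₂ * (p + q)) := by
      refine mul_le_mul_of_nonneg_left ?_ hβ0.le
      have : (1 - b₁) / 2 * R ≤ (1 - b₁) / 2 * (p + q) :=
        mul_le_mul_of_nonneg_left hpqR (by linarith)
      rw [hb₂]
      linarith
    have h2 : L₁ * (2 + β * (p + q)) ≤ max L₁ (1 - κ / 4) * (2 + β * (p + q)) :=
      mul_le_mul_of_nonneg_right (le_max_left _ _) (by positivity)
    have h3 : L₁ * (2 + β * R) = 2 + β * b₂ * R := by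
      rw [hL₁]
      field_simp
    have h4 : b₂ * (β * (p + q - R)) ≤ L₁ * (β * (p + q - R)) :=
      mul_le_mul_of_nonneg_right hL₁b (mul_nonneg hβ0.le (sub_nonneg.2 hpqR))
    linarith

end DriftBounds

/-! ### The certainty equivalent of a step and the Bellman operator -/

/-- The real-valued certainty equivalent `(1/γ) log E_x exp (γ (F + w(Y)))`, for `γ ≠ 0`. -/
def certaintyEquivalent {Ω E : Type*} [MeasurableSpace Ω] (P : E → Measure Ω) (Y : Ω → E)
    (F : Ω → ℝ) (γ : ℝ) (w : E → ℝ) (x : E) : ℝ :=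
  1 / γ * Real.log (∫ o, Real.exp (γ * (F o + w (Y o))) ∂(P x))

/-- The better of not shifting, worth `m x`, and of the best shift to a point `ξ` of `U`, worth
`m ξ + c x ξ`. -/
def shiftMax {E : Type*} (U : Set E) (c : E → U → ℝ) (m : E → ℝ) (x : E) : ℝ :=
  max (m x) (⨆ ξ : U, (m ξ + c x ξ))

section ShiftMax

variable {E : Type*} {U : Set E} {c : E → U → ℝ} {m : E → ℝ}

theorem bddAbove_range_add_cost (hc : ∀ x ξ, c x ξ ≤ 0) {C : ℝ} (hm : ∀ ξ ∈ U, m ξ ≤ C) (x : E) :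
    BddAbove (Set.range fun ξ : U => m ξ + c x ξ) :=
  ⟨C, by
    rintro _ ⟨ξ, rfl⟩
    linarith [hc x ξ, hm ξ ξ.2]⟩

theorem le_shiftMax (x : E) : m x ≤ shiftMax U c m x := le_max_left _ _

theorem add_cost_le_shiftMax (hc : ∀ x ξ, c x ξ ≤ 0) {C : ℝ} (hm : ∀ ξ ∈ U, m ξ ≤ C) (x : E)
    (ξ : U) : m ξ + c x ξ ≤ shiftMax U c m x :=
  (le_ciSup (bddAbove_range_add_cost hc hm x) ξ).trans (le_max_right _ _)

theorem shiftMax_le [Nonempty U] {x : E} {r : ℝ} (h1 : m x ≤ r) (h2 : ∀ ξ : U, m ξ + c x ξ ≤ r) :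
    shiftMax U c m x ≤ r :=
  max_le h1 (ciSup_le h2)

theorem shiftMax_add_const [Nonempty U] (hc : ∀ x ξ, c x ξ ≤ 0) {C : ℝ} (hm : ∀ ξ ∈ U, m ξ ≤ C)
    (k : ℝ) (x : E) : shiftMax U c (fun y => m y + k) x = shiftMax U c m x + k := by
  have hm' : ∀ ξ ∈ U, m ξ + k ≤ C + k := fun ξ hξ => by linarith [hm ξ hξ]
  apply le_antisymm
  · refine shiftMax_le (by linarith [le_shiftMax (U := U) (c := c) (m := m) x]) fun ξ => ?_
    linarith [add_cost_le_shiftMax hc hm x ξ]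
  · rw [← le_sub_iff_add_le]
    refine shiftMax_le ?_ fun ξ => ?_
    · have : m x + k ≤ shiftMax U c (fun y => m y + k) x :=
        le_shiftMax (U := U) (c := c) (m := fun y => m y + k) x
      linarith
    · have := add_cost_le_shiftMax hc hm' x ξ
      linarith

end ShiftMax

namespace DriftBounds

variable {Ω E : Type*} [MeasurableSpace Ω] [MeasurableSpace E] {P : E → Measure Ω} {Y : Ω → E}
  {A F : Ω → ℝ} {ω : E → ℝ} {b : ℝ} {M₁ M₂ : ℝ → ℝ} {κ K γ : ℝ}

theorem dominated (h : DriftBounds P Y A ω b M₁ M₂) (hF : Measurable F)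
    (hFA : ∀ o, |F o| ≤ κ * (1 + A o)) (hκK : κ ≤ K) {w : E → ℝ} (hw : Measurable w)
    (hwK : ∀ x, |w x| ≤ K * (1 + ω x)) : Dominated Y A ω K fun o => F o + w (Y o) := by
  refine ⟨hF.add (hw.comp h.measurable_state), fun o => ?_⟩
  have h1 : κ * (1 + A o) ≤ K * (1 + A o) :=
    mul_le_mul_of_nonneg_right hκK (by linarith [h.acc_nonneg o])
  linarith [abs_add_le (F o) (w (Y o)), hFA o, hwK (Y o)]

theorem integral_exp_pos_of_dominated (h : DriftBounds P Y A ω b M₁ M₂) (hK : 0 < K) {Z : Ω → ℝ}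
    (hZ : Dominated Y A ω K Z) (t : ℝ) (x : E) : 0 < ∫ o, Real.exp (t * Z o) ∂(P x) := by
  have hP := h.prob
  exact integral_exp_pos (h.integrable_exp hK hZ t x)

theorem certaintyEquivalent_add_const (h : DriftBounds P Y A ω b M₁ M₂) (hK : 0 < K) (hγ : γ < 0)
    {w : E → ℝ} (hZ : Dominated Y A ω K fun o => F o + w (Y o)) (k : ℝ) (x : E) :
    certaintyEquivalent P Y F γ (fun y => w y + k) x = certaintyEquivalent P Y F γ w x + k := by
  have hI := h.integral_exp_pos_of_dominated hK hZ γ x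
  have h1 : ∀ o, Real.exp (γ * (F o + (w (Y o) + k)))
      = Real.exp (γ * k) * Real.exp (γ * (F o + w (Y o))) := fun o => by
    rw [← Real.exp_add]
    ring_nf
  rw [certaintyEquivalent, certaintyEquivalent]
  simp_rw [h1]
  rw [integral_const_mul, Real.log_mul (Real.exp_pos _).ne' hI.ne', Real.log_exp]
  field_simp [hγ.ne]
  ring

theorem certaintyEquivalent_mono (h : DriftBounds P Y A ω b M₁ M₂) (hK : 0 < K) (hγ : γ < 0)
    {w₁ w₂ : E → ℝ} (hZ₁ : Dominated Y A ω K fun o => F o + w₁ (Y o))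
    (hZ₂ : Dominated Y A ω K fun o => F o + w₂ (Y o)) (hle : ∀ y, w₁ y ≤ w₂ y) (x : E) :
    certaintyEquivalent P Y F γ w₁ x ≤ certaintyEquivalent P Y F γ w₂ x := by
  refine mul_le_mul_of_nonpos_left (Real.log_le_log (h.integral_exp_pos_of_dominated hK hZ₂ γ x)
    (integral_mono (h.integrable_exp hK hZ₂ γ x) (h.integrable_exp hK hZ₁ γ x) fun o => ?_))
    (one_div_nonpos.2 hγ.le)
  rw [Real.exp_le_exp]
  exact mul_le_mul_of_nonpos_left (by linarith [hle (Y o)]) hγ.le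

theorem exists_abs_certaintyEquivalent_le (h : DriftBounds P Y A ω b M₁ M₂) (hK : 0 < K)
    (γ : ℝ) :
    ∃ C, 0 ≤ C ∧ ∀ w : E → ℝ, Dominated Y A ω K (fun o => F o + w (Y o)) → ∀ x,
      |certaintyEquivalent P Y F γ w x| ≤ C * (1 + ω x) := by
  obtain ⟨C, hC0, hC⟩ := h.exists_integral_exp_bounds hK γ
  refine ⟨|1 / γ| * C, by positivity, fun w hZ x => ?_⟩
  have hI := h.integral_exp_pos_of_dominated hK hZ γ x
  rw [certaintyEquivalent, abs_mul, mul_assoc]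
  refine mul_le_mul_of_nonneg_left (abs_le.2 ⟨?_, ?_⟩) (abs_nonneg _)
  · exact (Real.le_log_iff_exp_le hI).2 (hC _ hZ x).1
  · exact (Real.log_le_iff_le_exp hI).2 (hC _ hZ x).2

/-- A lower bound on `w` up to a constant gives a lower bound on its certainty equivalent, with
constants that do not depend on any upper bound for `w`. -/
theorem exists_le_certaintyEquivalent (h : DriftBounds P Y A ω b M₁ M₂) (hF : Measurable F)
    (hFA : ∀ o, |F o| ≤ κ * (1 + A o)) (hκ : 0 < κ) (hγ : γ < 0) {C : ℝ} (hC : 0 ≤ C) :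
    ∃ D, 0 ≤ D ∧ ∀ (w : E → ℝ) (k K : ℝ), Measurable w → (∀ x, |w x| ≤ K * (1 + ω x)) →
      (∀ x, k - C * (1 + ω x) ≤ w x) →
      ∀ x, k - D * (1 + ω x) ≤ certaintyEquivalent P Y F γ w x := by
  have hω := h.weight_nonneg
  have hK₀ : 0 < κ + C := by positivity
  obtain ⟨D, hD0, hD⟩ := h.exists_abs_certaintyEquivalent_le (F := F) hK₀ γ
  refine ⟨D, hD0, fun w k K hw hwK hlow x => ?_⟩
  have hm : Measurable fun y => -(C * (1 + ω y)) := by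
    have := h.measurable_weight
    fun_prop
  have hb : ∀ y, |(-(C * (1 + ω y)))| ≤ C * (1 + ω y) := fun y => by
    rw [abs_neg, abs_of_nonneg (mul_nonneg hC (by linarith [hω y]))]
  have hZ₀ : Dominated Y A ω (κ + C) fun o => F o + -(C * (1 + ω (Y o))) :=
    h.dominated hF hFA (by linarith) (w := fun y => -(C * (1 + ω y))) hm fun y =>
      (hb y).trans (mul_le_mul_of_nonneg_right (by linarith) (by linarith [hω y]))
  obtain ⟨K', hK'⟩ : ∃ K', K' = κ + C + |K| + |k| := ⟨_, rfl⟩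
  have hK'0 : 0 < K' := hK' ▸ by positivity
  have hZ₁ : Dominated Y A ω K' fun o => F o + (-(C * (1 + ω (Y o))) + k) := by
    refine h.dominated hF hFA (by rw [hK']; linarith [abs_nonneg K, abs_nonneg k])
      (w := fun y => -(C * (1 + ω y)) + k) (hm.add_const k) fun y => ?_
    have h1 := abs_add_le (-(C * (1 + ω y))) k
    rw [hK']
    nlinarith [hb y, hω y, abs_nonneg K, abs_nonneg k, mul_nonneg hκ.le (hω y),
      mul_nonneg (abs_nonneg K) (hω y), mul_nonneg (abs_nonneg k) (hω y)]
  have hZ₂ : Dominated Y A ω K' fun o => F o + w (Y o) := by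
    refine h.dominated hF hFA (by rw [hK']; linarith [abs_nonneg K, abs_nonneg k]) hw fun y => ?_
    refine (hwK y).trans (mul_le_mul_of_nonneg_right ?_ (by linarith [hω y]))
    rw [hK']
    linarith [le_abs_self K, abs_nonneg k]
  have hmono := h.certaintyEquivalent_mono (F := F) hK'0 hγ
    (w₁ := fun y => -(C * (1 + ω y)) + k) hZ₁ hZ₂ (fun y => by linarith [hlow y]) x
  rw [h.certaintyEquivalent_add_const (F := F) hK₀ hγ (w := fun y => -(C * (1 + ω y))) hZ₀ k x]
    at hmono
  have := (abs_le.1 (hD (fun y => -(C * (1 + ω y))) hZ₀ x)).1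
  linarith

/-- Since `γ < 0`, the certainty equivalent is at most the expectation. -/
theorem certaintyEquivalent_le_of_le_affine (h : DriftBounds P Y A ω b M₁ M₂) (hF : Measurable F)
    (hFA : ∀ o, |F o| ≤ κ * (1 + A o)) (hκ : 0 < κ) (hγ : γ < 0) (hκK : κ ≤ K) {w : E → ℝ}
    (hw : Measurable w) (hwK : ∀ x, |w x| ≤ K * (1 + ω x)) {a B : ℝ} (hB : 0 ≤ B)
    (hup : ∀ x, w x ≤ a + B * ω x) (x : E) :
    certaintyEquivalent P Y F γ w x
      ≤ κ * (1 + (ω x + M₁ 0)) + (a + B * (b * ω x + M₂ 0)) := by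
  have hP := h.prob
  have hZ := h.dominated hF hFA hκK hw hwK
  have hI := h.integral_exp_pos_of_dominated (hκ.trans_le hκK) hZ γ x
  have hA := h.mean_acc x
  have hW := h.mean_weight x
  have iF : Integrable F (P x) := ((integrable_const 1).add hA.1 |>.const_mul κ).mono'
    hF.aestronglyMeasurable (.of_forall fun o => hFA o)
  have iw : Integrable (fun o => w (Y o)) (P x) :=
    ((integrable_const 1).add hW.1 |>.const_mul K).mono'
      (hw.comp h.measurable_state).aestronglyMeasurable (.of_forall fun o => hwK (Y o))
  have i1 : Integrable (fun o => κ * (1 + A o)) (P x) :=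
    ((integrable_const 1).add hA.1).const_mul κ
  have i2 : Integrable (fun o => a + B * ω (Y o)) (P x) :=
    (integrable_const a).add (hW.1.const_mul B)
  have hJ := exp_integral_le ((iF.add iw).const_mul γ)
    (h.integrable_exp (hκ.trans_le hκK) hZ γ x)
  have hlog : γ * ∫ o, (F o + w (Y o)) ∂(P x)
      ≤ Real.log (∫ o, Real.exp (γ * (F o + w (Y o))) ∂(P x)) := by
    rw [Real.le_log_iff_exp_le hI, ← integral_const_mul]
    exact hJ
  have hce : certaintyEquivalent P Y F γ w x ≤ ∫ o, (F o + w (Y o)) ∂(P x) := by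
    have h1 := mul_le_mul_of_nonpos_left hlog (one_div_nonpos.2 hγ.le)
    rwa [← mul_assoc, one_div_mul_cancel hγ.ne, one_mul] at h1
  refine hce.trans ?_
  calc ∫ o, (F o + w (Y o)) ∂(P x) ≤ ∫ o, (κ * (1 + A o) + (a + B * ω (Y o))) ∂(P x) :=
        integral_mono (iF.add iw) (i1.add i2) fun o =>
          add_le_add ((le_abs_self _).trans (hFA o)) (hup _)
    _ = κ * (1 + ∫ o, A o ∂(P x)) + (a + B * ∫ o, ω (Y o) ∂(P x)) := by
        rw [integral_add i1 i2, integral_const_mul, integral_add (integrable_const 1) hA.1,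
          integral_add (integrable_const a) (hW.1.const_mul B), integral_const_mul]
        simp
    _ ≤ _ := by
        gcongr
        · exact hA.2
        · exact hW.2

/-- Since `γ < 0`, the certainty equivalent is a soft minimum: on sublevel sets of `ω`, from which
the set `U` is reached with probability bounded below, it is controlled by the values of `w`
on `U`. -/
theorem exists_certaintyEquivalent_le_of_minorization (h : DriftBounds P Y A ω b M₁ M₂)
    (hF : Measurable F) (hFA : ∀ o, |F o| ≤ κ * (1 + A o)) (hκ : 0 < κ) (hγ : γ < 0)
    {U : Set E} (hU : MeasurableSet U) {R d : ℝ} (hd : 0 < d) {ν : Measure E}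
    [IsProbabilityMeasure ν] (hνU : 0 < ν U)
    (hν : ∀ x, ω x ≤ R → ∀ B : Set E, MeasurableSet B → ENNReal.ofReal d * ν B ≤ P x (Y ⁻¹' B)) :
    ∃ C, 0 ≤ C ∧ ∀ (w : E → ℝ) (k K : ℝ), κ ≤ K → Measurable w →
      (∀ x, |w x| ≤ K * (1 + ω x)) → (∀ ξ ∈ U, w ξ ≤ k) → ∀ x, ω x ≤ R →
      certaintyEquivalent P Y F γ w x ≤ k + C := by
  have hP := h.prob
  have hF' : Dominated Y A ω κ F := by
    refine ⟨hF, fun o => (hFA o).trans (mul_le_mul_of_nonneg_left ?_ hκ.le)⟩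
    linarith [h.weight_nonneg (Y o)]
  obtain ⟨D, hD0, hD⟩ := h.exists_integral_exp_bounds hκ (-γ)
  obtain ⟨p, hp⟩ : ∃ p, p = d * ν.real U := ⟨_, rfl⟩
  have hp0 : 0 < p := hp ▸ mul_pos hd (ENNReal.toReal_pos hνU.ne' (measure_ne_top _ _))
  refine ⟨|1 / γ * (2 * Real.log p - D * (1 + R))|, abs_nonneg _,
    fun w k K hκK hw hwK hwU x hx => ?_⟩
  have hZ := h.dominated hF hFA hκK hw hwK
  have iZ := h.integrable_exp (hκ.trans_le hκK) hZ γ x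
  have hI := h.integral_exp_pos_of_dominated (hκ.trans_le hκK) hZ γ x
  have hm : Measurable (U.indicator fun _ => (1 : ℝ)) := measurable_const.indicator hU
  have hind0 : ∀ y, 0 ≤ U.indicator (fun _ => (1 : ℝ)) y := fun y =>
    Set.indicator_nonneg (fun _ _ => zero_le_one) y
  have hind1 : ∀ y, U.indicator (fun _ => (1 : ℝ)) y ≤ 1 := fun y =>
    Set.indicator_le_self' (fun _ _ => zero_le_one) y
  have hreach : p ≤ ∫ o, U.indicator (fun _ => (1 : ℝ)) (Y o) ∂(P x) := by
    have h1 : (fun o => U.indicator (fun _ => (1 : ℝ)) (Y o))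
        = (Y ⁻¹' U).indicator fun _ => (1 : ℝ) := rfl
    rw [h1, integral_indicator_const _ (h.measurable_state hU), smul_eq_mul, mul_one, hp]
    have h2 := ENNReal.toReal_mono (measure_ne_top _ _) (hν x hx U hU)
    rwa [ENNReal.toReal_mul, ENNReal.toReal_ofReal hd.le] at h2
  have i1 := h.integrable_exp hκ hF' γ x
  have i2 : Integrable (fun o => Real.exp (-(γ * F o))) (P x) := by
    simpa only [neg_mul] using h.integrable_exp hκ hF' (-γ) x
  have hcs := sq_integral_le_mul i1 i2 (h := fun o => U.indicator (fun _ => (1 : ℝ)) (Y o))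
    (hm.comp h.measurable_state) (fun o => hind0 _) fun o => hind1 _
  have hden : ∫ o, Real.exp (-(γ * F o)) ∂(P x) ≤ Real.exp (D * (1 + R)) := by
    have := (hD F hF' x).2
    simp only [neg_mul] at this
    refine this.trans (Real.exp_le_exp.2 ?_)
    gcongr
  have hpt : ∀ o, Real.exp (γ * k) *
      (Real.exp (γ * F o) * U.indicator (fun _ => (1 : ℝ)) (Y o))
      ≤ Real.exp (γ * (F o + w (Y o))) := fun o => by
    by_cases ho : Y o ∈ U
    · rw [Set.indicator_of_mem ho, mul_one, ← Real.exp_add, Real.exp_le_exp]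
      nlinarith [hwU _ ho]
    · rw [Set.indicator_of_notMem ho, mul_zero, mul_zero]
      exact (Real.exp_pos _).le
  have i3 : Integrable (fun o => Real.exp (γ * F o) * U.indicator (fun _ => (1 : ℝ)) (Y o))
      (P x) := i1.mul_bdd (c := 1) (hm.comp h.measurable_state).aestronglyMeasurable
    (.of_forall fun o => by rw [Real.norm_of_nonneg (hind0 _)]; exact hind1 _)
  have hlow := integral_mono (i3.const_mul (Real.exp (γ * k))) iZ hpt
  rw [integral_const_mul] at hlow
  have hp2 : p ^ 2 * Real.exp (-(D * (1 + R)))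
      ≤ ∫ o, Real.exp (γ * F o) * U.indicator (fun _ => (1 : ℝ)) (Y o) ∂(P x) := by
    rw [Real.exp_neg, ← div_eq_mul_inv, div_le_iff₀ (Real.exp_pos _)]
    refine (pow_le_pow_left₀ hp0.le hreach 2).trans (hcs.trans ?_)
    exact mul_le_mul_of_nonneg_left hden
      (integral_nonneg fun o => mul_nonneg (Real.exp_pos _).le (hind0 _))
  have hlog : γ * k + (2 * Real.log p - D * (1 + R))
      ≤ Real.log (∫ o, Real.exp (γ * (F o + w (Y o))) ∂(P x)) := by
    rw [Real.le_log_iff_exp_le hI]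
    calc Real.exp (γ * k + (2 * Real.log p - D * (1 + R)))
        = Real.exp (γ * k) * (p ^ 2 * Real.exp (-(D * (1 + R)))) := by
          rw [Real.exp_add, sub_eq_add_neg, Real.exp_add, two_mul, Real.exp_add,
            Real.exp_log hp0, pow_two]
      _ ≤ _ := (mul_le_mul_of_nonneg_left hp2 (Real.exp_pos _).le).trans hlow
  have h1 := mul_le_mul_of_nonpos_left hlog (one_div_nonpos.2 hγ.le)
  rw [mul_add, ← mul_assoc, one_div_mul_cancel hγ.ne, one_mul] at h1
  exact h1.trans (by linarith [le_abs_self (1 / γ * (2 * Real.log p - D * (1 + R)))])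

/-- The certainty equivalent is concave for `γ < 0`: its increment is at most the expectation of the
increment under the law tilted at the base point. -/
theorem certaintyEquivalent_sub_le (h : DriftBounds P Y A ω b M₁ M₂) (hK : 0 < K) (hγ : γ < 0)
    {w₁ w₂ : E → ℝ} (hw₁ : Measurable w₁) (hw₂ : Measurable w₂)
    (hK₁ : ∀ x, |w₁ x| ≤ K * (1 + ω x)) (hK₂ : ∀ x, |w₂ x| ≤ K * (1 + ω x))
    (hZ₁ : Dominated Y A ω K fun o => F o + w₁ (Y o))
    (hZ₂ : Dominated Y A ω K fun o => F o + w₂ (Y o)) (x : E) :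
    certaintyEquivalent P Y F γ w₁ x - certaintyEquivalent P Y F γ w₂ x
      ≤ ∫ o, (w₁ (Y o) - w₂ (Y o)) ∂((P x).tilted fun o => γ * (F o + w₂ (Y o))) := by
  have hQ := h.isProbabilityMeasure_tilted hK hZ₂ γ x
  have iω := h.integrable_weight_tilted hK hZ₂ γ x
  have iZ₂ := h.integrable_exp hK hZ₂ γ x
  have hI₁ := h.integral_exp_pos_of_dominated hK hZ₁ γ x
  have hI₂ := h.integral_exp_pos_of_dominated hK hZ₂ γ x
  have hYm := h.measurable_state
  have ig : Integrable (fun o => w₁ (Y o) - w₂ (Y o))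
      ((P x).tilted fun o => γ * (F o + w₂ (Y o))) := by
    refine (((integrable_const 1).add iω).const_mul (2 * K)).mono'
      ((hw₁.comp hYm).sub (hw₂.comp hYm)).aestronglyMeasurable (.of_forall fun o => ?_)
    have := abs_sub (w₁ (Y o)) (w₂ (Y o))
    rw [Real.norm_eq_abs]
    simp only [Pi.add_apply]
    linarith [hK₁ (Y o), hK₂ (Y o)]
  have heq : ∀ o, Real.exp (γ * (F o + w₂ (Y o))) * Real.exp (γ * (w₁ (Y o) - w₂ (Y o)))
      = Real.exp (γ * (F o + w₁ (Y o))) := fun o => by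
    rw [← Real.exp_add]
    ring_nf
  have ie : Integrable (fun o => Real.exp (γ * (w₁ (Y o) - w₂ (Y o))))
      ((P x).tilted fun o => γ * (F o + w₂ (Y o))) := by
    rw [integrable_tilted_iff iZ₂]
    simp only [smul_eq_mul, heq]
    exact h.integrable_exp hK hZ₁ γ x
  have hJ := exp_integral_le (ig.const_mul γ) ie
  rw [integral_const_mul, integral_exp_tilted] at hJ
  simp only [Pi.add_apply, Real.exp_add, heq] at hJ
  have hlog : γ * ∫ o, (w₁ (Y o) - w₂ (Y o)) ∂((P x).tilted fun o => γ * (F o + w₂ (Y o)))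
      ≤ Real.log (∫ o, Real.exp (γ * (F o + w₁ (Y o))) ∂(P x))
        - Real.log (∫ o, Real.exp (γ * (F o + w₂ (Y o))) ∂(P x)) := by
    rw [← Real.log_div hI₁.ne' hI₂.ne', Real.le_log_iff_exp_le (div_pos hI₁ hI₂)]
    exact hJ
  have h1 := mul_le_mul_of_nonpos_left hlog (one_div_nonpos.2 hγ.le)
  rw [← mul_assoc, one_div_mul_cancel hγ.ne, one_mul, mul_sub] at h1
  exact h1

end DriftBounds

/-! ### Contraction and invariant bounds for the Bellman operator -/

/-- Two-sided bounds, relative to a constant `k`, that the Bellman operator preserves: shifting to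
`U` gives the lower bound, and `k` bounds the function on `U`. -/
def BellmanBounds {E : Type*} (ω : E → ℝ) (U : Set E) (C a B : ℝ) (w : E → ℝ) : Prop :=
  ∃ k, (∀ x, k - C * (1 + ω x) ≤ w x) ∧ (∀ x, w x ≤ k + a + B * ω x) ∧ ∀ ξ ∈ U, w ξ ≤ k

namespace DriftBounds

variable {Ω E : Type*} [MeasurableSpace Ω] [MeasurableSpace E] {P : E → Measure Ω} {Y : Ω → E}
  {A F : Ω → ℝ} {ω : E → ℝ} {b : ℝ} {M₁ M₂ : ℝ → ℝ} {κ K γ : ℝ} {U : Set E} {c : E → U → ℝ}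
  {R₀ : ℝ}

theorem exists_certaintyEquivalent_le_on (h : DriftBounds P Y A ω b M₁ M₂) (hK : 0 < K)
    (γ : ℝ) (hR₀ : ∀ ξ ∈ U, ω ξ ≤ R₀) {w : E → ℝ}
    (hZ : Dominated Y A ω K fun o => F o + w (Y o)) :
    ∃ C, ∀ ξ ∈ U, certaintyEquivalent P Y F γ w ξ ≤ C := by
  obtain ⟨C, hC0, hC⟩ := h.exists_abs_certaintyEquivalent_le (F := F) hK γ
  refine ⟨C * (1 + R₀), fun ξ hξ => ((le_abs_self _).trans (hC w hZ ξ)).trans ?_⟩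
  exact mul_le_mul_of_nonneg_left (by linarith [hR₀ ξ hξ]) hC0

/-- On functions of bounded weighted norm, the Bellman operator contracts a weighted span
seminorm. -/
theorem exists_bellman_contraction (h : DriftBounds P Y A ω b M₁ M₂) (hF : Measurable F)
    (hFA : ∀ o, |F o| ≤ κ * (1 + A o)) (hκ : 0 < κ) (hκK : κ ≤ K) (hγ : γ < 0) [Nonempty U]
    (hc : ∀ x ξ, c x ξ ≤ 0) (hR₀0 : 0 ≤ R₀) (hR₀ : ∀ ξ ∈ U, ω ξ ≤ R₀)
    (hminor : ∀ R : ℝ, 0 < R → ∃ d : ℝ, 0 < d ∧ ∃ ν : Measure E, IsProbabilityMeasure ν ∧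
      ∀ x, ω x ≤ R → ∀ B : Set E, MeasurableSet B → ENNReal.ofReal d * ν B ≤ P x (Y ⁻¹' B)) :
    ∃ β L : ℝ, 0 < β ∧ 0 < L ∧ L < 1 ∧ ∀ w₁ w₂ : E → ℝ, Measurable w₁ → Measurable w₂ →
      (∀ x, |w₁ x| ≤ K * (1 + ω x)) → (∀ x, |w₂ x| ≤ K * (1 + ω x)) → ∀ s : ℝ, 0 < s →
      (∀ x y, (w₁ x - w₂ x) - (w₁ y - w₂ y) ≤ s * (2 + β * ω x + β * ω y)) →
      ∀ x y, (shiftMax U c (certaintyEquivalent P Y F γ w₁) x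
          - shiftMax U c (certaintyEquivalent P Y F γ w₂) x)
        - (shiftMax U c (certaintyEquivalent P Y F γ w₁) y
          - shiftMax U c (certaintyEquivalent P Y F γ w₂) y)
        ≤ L * (s * (2 + β * ω x + β * ω y)) := by
  have hK : 0 < K := hκ.trans_le hκK
  obtain ⟨β, L, hβ, hL0, hL1, hcon⟩ := h.exists_tilted_contraction hK γ hR₀0 hminor
  refine ⟨β, L, hβ, hL0, hL1, fun w₁ w₂ hw₁ hw₂ hK₁ hK₂ s hs hspan x y => ?_⟩
  have hZ₁ := h.dominated hF hFA hκK hw₁ hK₁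
  have hZ₂ := h.dominated hF hFA hκK hw₂ hK₂
  obtain ⟨C₁, hC₁⟩ := h.exists_certaintyEquivalent_le_on hK γ hR₀ hZ₁
  obtain ⟨C₂, hC₂⟩ := h.exists_certaintyEquivalent_le_on hK γ hR₀ hZ₂
  have hω := h.weight_nonneg
  have key : ∀ p q, ω p ≤ max (ω x) R₀ → ω q ≤ max (ω y) R₀ →
      (certaintyEquivalent P Y F γ w₁ p - certaintyEquivalent P Y F γ w₂ p)
        - (certaintyEquivalent P Y F γ w₁ q - certaintyEquivalent P Y F γ w₂ q)
        ≤ L * (s * (2 + β * ω x + β * ω y)) := by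
    intro p q hp hq
    have e1 := h.certaintyEquivalent_sub_le hK hγ hw₁ hw₂ hK₁ hK₂ hZ₁ hZ₂ p
    have e2 := h.certaintyEquivalent_sub_le hK hγ hw₂ hw₁ hK₂ hK₁ hZ₂ hZ₁ q
    have e3 := hcon _ _ hZ₂ hZ₁ (fun z => w₁ z - w₂ z) s (hw₁.sub hw₂) hs hspan p q _ _
      (hω x) (hω y) hp hq
    have e4 : ∫ o, (w₂ (Y o) - w₁ (Y o)) ∂((P q).tilted fun o => γ * (F o + w₁ (Y o)))
        = -∫ o, (w₁ (Y o) - w₂ (Y o)) ∂((P q).tilted fun o => γ * (F o + w₁ (Y o))) := by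
      rw [← integral_neg]
      refine integral_congr_ae (.of_forall fun o => ?_)
      simp only [neg_sub]
    linarith
  have hx : ω x ≤ max (ω x) R₀ := le_max_left _ _
  have hy : ω y ≤ max (ω y) R₀ := le_max_left _ _
  have hUx : ∀ ξ : U, ω ξ ≤ max (ω x) R₀ := fun ξ => (hR₀ ξ ξ.2).trans (le_max_right _ _)
  have hUy : ∀ ξ : U, ω ξ ≤ max (ω y) R₀ := fun ξ => (hR₀ ξ ξ.2).trans (le_max_right _ _)
  have t2x := le_shiftMax (U := U) (c := c) (m := certaintyEquivalent P Y F γ w₂) x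
  have t1y := le_shiftMax (U := U) (c := c) (m := certaintyEquivalent P Y F γ w₁) y
  have s2x := add_cost_le_shiftMax hc hC₂ x
  have s1y := add_cost_le_shiftMax hc hC₁ y
  -- Compare an action from `x` with every action from `y`.
  have hstep : ∀ (p : E) (r : ℝ), ω p ≤ max (ω x) R₀ →
      certaintyEquivalent P Y F γ w₂ p + r
        ≤ shiftMax U c (certaintyEquivalent P Y F γ w₂) x →
      certaintyEquivalent P Y F γ w₁ p + r ≤ L * (s * (2 + β * ω x + β * ω y))
        + shiftMax U c (certaintyEquivalent P Y F γ w₂) x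
        + shiftMax U c (certaintyEquivalent P Y F γ w₁) y
        - shiftMax U c (certaintyEquivalent P Y F γ w₂) y := by
    intro p r hp hr
    have h2 : shiftMax U c (certaintyEquivalent P Y F γ w₂) y
        ≤ L * (s * (2 + β * ω x + β * ω y))
          + shiftMax U c (certaintyEquivalent P Y F γ w₂) x
          + shiftMax U c (certaintyEquivalent P Y F γ w₁) y
          - (certaintyEquivalent P Y F γ w₁ p + r) := by
      refine shiftMax_le ?_ fun ξ => ?_
      · linarith [key p y hp hy]
      · linarith [key p ξ hp (hUy ξ), s1y ξ]
    linarith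
  have h1 := shiftMax_le (U := U) (c := c) (m := certaintyEquivalent P Y F γ w₁) (x := x)
    (by simpa using hstep x 0 hx (by simpa using t2x)) fun ξ => hstep ξ (c x ξ) (hUx ξ) (s2x ξ)
  linarith

/-- The Bellman operator has constants for which it preserves `BellmanBounds`. Far away the drift
closes the upper bound; on sublevel sets of `ω` it follows from the soft-minimum property of the
certainty equivalent and from `w ≤ k` on `U`. -/
theorem exists_bellmanBounds (h : DriftBounds P Y A ω b M₁ M₂) (hF : Measurable F)
    (hFA : ∀ o, |F o| ≤ κ * (1 + A o)) (hκ : 0 < κ) (hγ : γ < 0) [Nonempty U]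
    (hU : MeasurableSet U) (hc : ∀ x ξ, c x ξ ≤ 0) {C : ℝ} (hC : 0 ≤ C)
    (hcC : ∀ x ξ, -(C * (1 + ω x)) ≤ c x ξ) (hR₀0 : 0 ≤ R₀) (hR₀ : ∀ ξ ∈ U, ω ξ ≤ R₀)
    (hminor : ∀ R : ℝ, 0 < R → ∃ d : ℝ, 0 < d ∧ ∃ ν : Measure E, IsProbabilityMeasure ν ∧
      0 < ν U ∧
      ∀ x, ω x ≤ R → ∀ B : Set E, MeasurableSet B → ENNReal.ofReal d * ν B ≤ P x (Y ⁻¹' B)) :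
    ∃ a B : ℝ, 0 ≤ a ∧ 0 ≤ B ∧ ∀ (w : E → ℝ) (K : ℝ), κ ≤ K → Measurable w →
      (∀ x, |w x| ≤ K * (1 + ω x)) → BellmanBounds ω U C a B w →
      BellmanBounds ω U C a B (shiftMax U c (certaintyEquivalent P Y F γ w)) := by
  have hω := h.weight_nonneg
  have hb1 : 0 < 1 - b := by linarith [h.rate_lt_one]
  obtain ⟨D, hD0, hD⟩ := h.exists_le_certaintyEquivalent hF hFA hκ hγ hC
  obtain ⟨B, hB⟩ : ∃ B, B = 2 * κ / (1 - b) := ⟨_, rfl⟩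
  have hB0 : 0 ≤ B := hB ▸ by positivity
  have hBb : κ + B * b = B - κ := by
    rw [hB]
    field_simp
    ring
  obtain ⟨G, hG⟩ : ∃ G, G = D * (1 + R₀) := ⟨_, rfl⟩
  have hG0 : 0 ≤ G := hG ▸ by positivity
  obtain ⟨H, hH⟩ : ∃ H, H = κ * (1 + M₁ 0) + B * M₂ 0 := ⟨_, rfl⟩
  obtain ⟨R, hR⟩ : ∃ R, R = (G + |H|) / κ + 1 := ⟨_, rfl⟩
  have hRpos : 0 < R := hR ▸ by positivity
  have hRκ : G + |H| ≤ κ * R := by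
    rw [hR, mul_add, mul_div_cancel₀ _ hκ.ne']
    linarith
  obtain ⟨d, hd, ν, hνp, hνU, hν⟩ := hminor R hRpos
  obtain ⟨J, hJ0, hJ⟩ := h.exists_certaintyEquivalent_le_of_minorization hF hFA hκ hγ hU hd hνU hν
  refine ⟨G + J, B, add_nonneg hG0 hJ0, hB0, fun w K hκK hw hwK ⟨k, hlow, hup, hUk⟩ => ?_⟩
  have hK : 0 < K := hκ.trans_le hκK
  have hZ := h.dominated hF hFA hκK hw hwK
  obtain ⟨C₁, hC₁⟩ := h.exists_certaintyEquivalent_le_on hK γ hR₀ hZ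
  obtain ⟨m, hm⟩ : ∃ m, m = certaintyEquivalent P Y F γ w := ⟨_, rfl⟩
  rw [← hm] at hC₁ ⊢
  have hbdd : BddAbove (Set.range fun ξ : U => m ξ) := ⟨C₁, by
    rintro _ ⟨ξ, rfl⟩
    exact hC₁ ξ ξ.2⟩
  -- The new constant is the best certainty equivalent on `U`.
  obtain ⟨k', hk'⟩ : ∃ k', k' = ⨆ ξ : U, m ξ := ⟨_, rfl⟩
  have hle : ∀ ξ : U, m ξ ≤ k' := fun ξ => hk' ▸ le_ciSup hbdd ξ
  have hkk' : k - G ≤ k' := by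
    obtain ⟨ξ⟩ := ‹Nonempty U›
    have h1 := hD w k K hw hwK hlow ξ
    rw [← hm] at h1
    have h2 : D * (1 + ω ξ) ≤ G := by
      rw [hG]
      exact mul_le_mul_of_nonneg_left (by linarith [hR₀ ξ ξ.2]) hD0
    linarith [hle ξ]
  have hmup : ∀ x, m x ≤ k' + (G + J) + B * ω x := fun x => by
    have hBω : 0 ≤ B * ω x := mul_nonneg hB0 (hω x)
    rcases le_total (ω x) R with hx | hx
    · have h1 := hJ w k K hκK hw hwK hUk x hx
      rw [← hm] at h1
      linarith
    · have h1 := h.certaintyEquivalent_le_of_le_affine hF hFA hκ hγ hκK hw hwK hB0 hup x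
      rw [← hm] at h1
      have h2 : κ * R ≤ κ * ω x := mul_le_mul_of_nonneg_left hx hκ.le
      have h3 : κ * ω x + B * b * ω x = B * ω x - κ * ω x := by
        rw [← add_mul, hBb, sub_mul]
      linarith [le_abs_self H]
  refine ⟨k', fun x => ?_, fun x => ?_, fun ξ hξ => ?_⟩
  · rw [sub_le_iff_le_add, hk']
    refine ciSup_le fun ξ => ?_
    linarith [add_cost_le_shiftMax hc hC₁ x ξ, hcC x ξ]
  · refine shiftMax_le (hmup x) fun ξ => ?_
    linarith [hle ξ, hc x ξ, mul_nonneg hB0 (hω x)]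
  · refine shiftMax_le (hle ⟨ξ, hξ⟩) fun ζ => ?_
    linarith [hle ζ, hc ξ ζ]

end DriftBounds

/-! ### Fixed points modulo constants of span contractions -/

/-- `T` commutes with the addition of constants and, on each weighted ball of continuous functions,
contracts a weighted span seminorm; the weight `β` and the rate `L` may depend on the radius. -/
structure LocalSpanContraction {E : Type*} [TopologicalSpace E] (ω : E → ℝ)
    (T : (E → ℝ) → E → ℝ) : Prop where
  add_const : ∀ (K : ℝ) (w : E → ℝ), Continuous w → (∀ x, |w x| ≤ K * (1 + ω x)) →
    ∀ k x, T (fun y => w y + k) x = T w x + k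
  contraction : ∀ K : ℝ, ∃ β L : ℝ, 0 < β ∧ 0 < L ∧ L < 1 ∧ ∀ w₁ w₂ : E → ℝ,
    Continuous w₁ → Continuous w₂ → (∀ x, |w₁ x| ≤ K * (1 + ω x)) →
    (∀ x, |w₂ x| ≤ K * (1 + ω x)) → ∀ s : ℝ, 0 < s →
    (∀ x y, (w₁ x - w₂ x) - (w₁ y - w₂ y) ≤ s * (2 + β * ω x + β * ω y)) →
    ∀ x y, (T w₁ x - T w₂ x) - (T w₁ y - T w₂ y) ≤ L * (s * (2 + β * ω x + β * ω y))

/-- The difference of two functions in a weighted ball has finite weighted span. -/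
theorem span_le_of_abs_le {E : Type*} {ω w₁ w₂ : E → ℝ} (hω : ∀ x, 0 ≤ ω x) {K β : ℝ}
    (hK : 0 ≤ K) (hβ : 0 < β) (h₁ : ∀ x, |w₁ x| ≤ K * (1 + ω x))
    (h₂ : ∀ x, |w₂ x| ≤ K * (1 + ω x)) (x y : E) :
    (w₁ x - w₂ x) - (w₁ y - w₂ y) ≤ (2 * K * (1 + 1 / β)) * (2 + β * ω x + β * ω y) := by
  have e1 := abs_le.1 (h₁ x)
  have e2 := abs_le.1 (h₂ x)
  have e3 := abs_le.1 (h₁ y)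
  have e4 := abs_le.1 (h₂ y)
  have e5 : (2 * K * (1 + 1 / β)) * (2 + β * ω x + β * ω y)
      = 2 * K * (2 + ω x + ω y) + 2 * K * (2 / β + β * ω x + β * ω y) := by
    field_simp
    ring
  have e6 : 0 ≤ 2 * K * (2 / β + β * ω x + β * ω y) := by
    have := hω x
    have := hω y
    positivity
  linarith

/-- Two solutions of `T v = v + l` agree up to a constant. -/
theorem LocalSpanContraction.unique {E : Type*} [TopologicalSpace E] [Nonempty E] {ω : E → ℝ}
    {T : (E → ℝ) → E → ℝ} (hT : LocalSpanContraction ω T) (hω : ∀ x, 0 ≤ ω x) {v v' : E → ℝ}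
    {l l' K : ℝ} (hv : Continuous v) (hv' : Continuous v') (hK : ∀ x, |v x| ≤ K * (1 + ω x))
    (hK' : ∀ x, |v' x| ≤ K * (1 + ω x)) (h : ∀ x, T v x = v x + l)
    (h' : ∀ x, T v' x = v' x + l') : l' = l ∧ ∃ k, ∀ x, v' x = v x + k := by
  have x₀ : E := Classical.arbitrary E
  obtain ⟨β, L, hβ, hL0, hL1, hcon⟩ := hT.contraction K
  have hK0 : 0 ≤ K := by
    have := (abs_nonneg _).trans (hK x₀)
    have := hω x₀
    by_contra hneg
    nlinarith
  obtain ⟨s, hs⟩ : ∃ s, s = 2 * K * (1 + 1 / β) + 1 := ⟨_, rfl⟩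
  have hs0 : 0 < s := hs ▸ by positivity
  have hstep : ∀ (n : ℕ) x y, (v' x - v x) - (v' y - v y)
      ≤ (s * L ^ n) * (2 + β * ω x + β * ω y) := by
    intro n
    induction n with
    | zero =>
      intro x y
      have h1 := span_le_of_abs_le hω hK0 hβ hK' hK x y
      have h2 : 0 ≤ 2 + β * ω x + β * ω y := by
        have := hω x
        have := hω y
        positivity
      rw [hs, pow_zero, mul_one, add_mul]
      linarith
    | succ n ih =>
      intro x y
      have h1 := hcon v' v hv' hv hK' hK (s * L ^ n) (by positivity) ih x y
      rw [h, h, h', h'] at h1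
      rw [pow_succ]
      linarith
  have hzero : ∀ x y, (v' x - v x) - (v' y - v y) ≤ 0 := fun x y => by
    have h1 : Tendsto (fun n : ℕ => (s * L ^ n) * (2 + β * ω x + β * ω y)) atTop (𝓝 0) := by
      have := ((tendsto_pow_atTop_nhds_zero_of_lt_one hL0.le hL1).const_mul s).mul_const
        (2 + β * ω x + β * ω y)
      simpa using this
    exact ge_of_tendsto' h1 fun n => hstep n x y
  have hk : ∀ x, v' x = v x + (v' x₀ - v x₀) := fun x => by
    linarith [hzero x x₀, hzero x₀ x]
  refine ⟨?_, _, hk⟩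
  have h1 : v' = fun x => v x + (v' x₀ - v x₀) := funext hk
  have h2 := hT.add_const K v hv hK (v' x₀ - v x₀) x₀
  rw [← h1, h, h'] at h2
  linarith

/-- A local span contraction that preserves continuity and a class `S` of functions, uniformly
bounded in the weighted norm up to constants, has a fixed point up to a constant. The iterates,
normalized at a point, form a Cauchy sequence in the weighted norm. -/
theorem LocalSpanContraction.exists_fixed {E : Type*} [TopologicalSpace E] [Nonempty E] {ω : E → ℝ}
    {T : (E → ℝ) → E → ℝ} (hT : LocalSpanContraction ω T) (hωc : Continuous ω)
    (hω : ∀ x, 0 ≤ ω x)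
    (hTc : ∀ (K : ℝ) (w : E → ℝ), Continuous w → (∀ x, |w x| ≤ K * (1 + ω x)) → Continuous (T w))
    {S : (E → ℝ) → Prop} (hS0 : S fun _ => 0)
    (hST : ∀ (K : ℝ) (w : E → ℝ), Continuous w → (∀ x, |w x| ≤ K * (1 + ω x)) → S w → S (T w))
    {K₁ : ℝ} (hK₁ : 0 < K₁) (hSb : ∀ w, S w → ∃ k, ∀ x, |w x - k| ≤ K₁ * (1 + ω x)) :
    ∃ (v : E → ℝ) (l K : ℝ), Continuous v ∧ (∀ x, |v x| ≤ K * (1 + ω x)) ∧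
      ∀ x, T v x = v x + l := by
  have x₀ : E := Classical.arbitrary E
  obtain ⟨w, hw⟩ : ∃ w : ℕ → E → ℝ, w = fun n => T^[n] fun _ => 0 := ⟨_, rfl⟩
  have hw0 : w 0 = fun _ => 0 := by rw [hw]; rfl
  have hwS : ∀ n, w (n + 1) = T (w n) := fun n => by
    rw [hw]
    exact Function.iterate_succ_apply' T n _
  have hbound : ∀ n, S (w n) → ∃ K, ∀ x, |w n x| ≤ K * (1 + ω x) := fun n hn => by
    obtain ⟨k, hk⟩ := hSb _ hn
    refine ⟨|k| + K₁, fun x => ?_⟩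
    have h1 := abs_add_le (w n x - k) k
    rw [sub_add_cancel] at h1
    nlinarith [hk x, abs_nonneg k, hω x, mul_nonneg (abs_nonneg k) (hω x)]
  have hwprop : ∀ n, Continuous (w n) ∧ S (w n) := fun n => by
    induction n with
    | zero =>
      rw [hw0]
      exact ⟨continuous_const, hS0⟩
    | succ n ih =>
      obtain ⟨K, hK⟩ := hbound n ih.2
      rw [hwS]
      exact ⟨hTc K _ ih.1 hK, hST K _ ih.1 hK ih.2⟩
  obtain ⟨K, hKdef⟩ : ∃ K, K = K₁ * (2 + ω x₀) := ⟨_, rfl⟩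
  have hK0 : 0 < K := hKdef ▸ mul_pos hK₁ (by linarith [hω x₀])
  obtain ⟨v, hv⟩ : ∃ v : ℕ → E → ℝ, ∀ n x, v n x = w n x + -w n x₀ := ⟨_, fun _ _ => rfl⟩
  have hv' : ∀ n, v n = fun x => w n x + -w n x₀ := fun n => funext (hv n)
  have hvc : ∀ n, Continuous (v n) := fun n => by
    rw [hv']
    exact (hwprop n).1.add_const _
  have hvK : ∀ n x, |v n x| ≤ K * (1 + ω x) := fun n x => by
    obtain ⟨k, hk⟩ := hSb _ (hwprop n).2
    have e1 := abs_le.1 (hk x)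
    have e2 := abs_le.1 (hk x₀)
    have e3 : K₁ * (1 + ω x) + K₁ * (1 + ω x₀) ≤ K * (1 + ω x) := by
      rw [hKdef]
      nlinarith [mul_nonneg hK₁.le (mul_nonneg (hω x₀) (hω x)), mul_nonneg hK₁.le (hω x)]
    rw [hv, abs_le]
    constructor <;> linarith
  have hvx₀ : ∀ n, v n x₀ = 0 := fun n => by rw [hv, add_neg_cancel]
  -- `T` maps each normalized iterate to the next one, up to a constant.
  have hTv : ∀ n x, T (v n) x = v (n + 1) x + (w (n + 1) x₀ - w n x₀) := fun n x => by
    obtain ⟨K', hK'⟩ := hbound n (hwprop n).2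
    rw [hv', hT.add_const K' _ (hwprop n).1 hK', hv, hwS]
    ring
  obtain ⟨β, L, hβ, hL0, hL1, hcon⟩ := hT.contraction K
  obtain ⟨s, hs⟩ : ∃ s, s = 2 * K * (1 + 1 / β) := ⟨_, rfl⟩
  have hs0 : 0 < s := hs ▸ by positivity
  have hspan : ∀ (n : ℕ) x y, (v (n + 1) x - v n x) - (v (n + 1) y - v n y)
      ≤ (s * L ^ n) * (2 + β * ω x + β * ω y) := by
    intro n
    induction n with
    | zero =>
      intro x y
      rw [pow_zero, mul_one, hs]
      exact span_le_of_abs_le hω hK0.le hβ (hvK 1) (hvK 0) x y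
    | succ n ih =>
      intro x y
      have h1 := hcon _ _ (hvc (n + 1)) (hvc n) (hvK (n + 1)) (hvK n) (s * L ^ n)
        (by positivity) ih x y
      rw [hTv, hTv, hTv, hTv] at h1
      rw [pow_succ]
      linarith
  obtain ⟨W, hW⟩ : ∃ W : E → ℝ, ∀ x, W x = s * (2 + β * ω x + β * ω x₀) := ⟨_, fun _ => rfl⟩
  have hW0 : ∀ x, 0 ≤ W x := fun x => by
    have := hω x
    have := hω x₀
    rw [hW]
    positivity
  have hdist : ∀ x (n : ℕ), dist (v n x) (v (n + 1) x) ≤ W x * L ^ n := fun x n => by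
    have h1 := hspan n x x₀
    have h2 := hspan n x₀ x
    rw [hvx₀, hvx₀] at h1 h2
    rw [dist_comm, Real.dist_eq, hW, abs_le]
    constructor <;> linarith
  have hlim : ∀ x, ∃ a, Tendsto (fun n => v n x) atTop (𝓝 a) := fun x =>
    cauchySeq_tendsto_of_complete (cauchySeq_of_le_geometric L (W x) hL1 (hdist x))
  choose u hu using hlim
  have hdu : ∀ x (n : ℕ), |v n x - u x| ≤ W x * L ^ n / (1 - L) := fun x n =>
    dist_le_of_le_geometric_of_tendsto L (W x) hL1 (hdist x) (hu x) n
  have hL1' : 0 < 1 - L := by linarith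
  have hpow : Tendsto (fun n : ℕ => L ^ n) atTop (𝓝 0) :=
    tendsto_pow_atTop_nhds_zero_of_lt_one hL0.le hL1
  have huK : ∀ x, |u x| ≤ K * (1 + ω x) := fun x =>
    le_of_tendsto' (hu x).abs fun n => hvK n x
  have huc : Continuous u := by
    refine continuous_of_forall_exists_abs_sub_le fun x ε hε => ?_
    have hWc : Continuous W := by
      rw [show W = fun x => s * (2 + β * ω x + β * ω x₀) from funext hW]
      fun_prop
    have h1 : Tendsto (fun n : ℕ => (W x + 1) * L ^ n / (1 - L)) atTop (𝓝 0) := by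
      simpa using (hpow.const_mul (W x + 1)).div_const (1 - L)
    obtain ⟨n, hn⟩ := (h1.eventually_lt_const hε).exists
    refine ⟨v n, hvc n, ?_⟩
    filter_upwards [(hWc.tendsto x).eventually_le_const (show W x < W x + 1 by linarith)] with y hy
    rw [abs_sub_comm]
    refine ((hdu y n).trans ?_).trans hn.le
    gcongr
  refine ⟨u, T u x₀ - u x₀, K, huc, huK, fun x => ?_⟩
  -- The span of `u - v n` tends to zero, hence so does that of `T u - T (v n)`.
  obtain ⟨q, hq⟩ : ∃ q, q = s * (2 + β * ω x₀) / (1 - L) := ⟨_, rfl⟩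
  have hq0 : 0 < q := by
    have := hω x₀
    rw [hq]
    positivity
  have hspan' : ∀ (n : ℕ) y z, (u y - v n y) - (u z - v n z)
      ≤ (q * L ^ n) * (2 + β * ω y + β * ω z) := fun n y z => by
    have e1 := (abs_le.1 (hdu y n)).1
    have e2 := (abs_le.1 (hdu z n)).2
    have e3 : W y * L ^ n / (1 - L) + W z * L ^ n / (1 - L)
        = (s * L ^ n / (1 - L)) * (4 + β * ω y + β * ω z + 2 * (β * ω x₀)) := by
      rw [hW, hW]
      ring
    have e4 : (q * L ^ n) * (2 + β * ω y + β * ω z)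
        = (s * L ^ n / (1 - L)) * ((2 + β * ω x₀) * (2 + β * ω y + β * ω z)) := by
      rw [hq]
      ring
    have hy : 0 ≤ β * ω y := mul_nonneg hβ.le (hω y)
    have hz : 0 ≤ β * ω z := mul_nonneg hβ.le (hω z)
    have h0 : 0 ≤ β * ω x₀ := mul_nonneg hβ.le (hω x₀)
    have e5 : (s * L ^ n / (1 - L)) * (4 + β * ω y + β * ω z + 2 * (β * ω x₀))
        ≤ (s * L ^ n / (1 - L)) * ((2 + β * ω x₀) * (2 + β * ω y + β * ω z)) := by
      refine mul_le_mul_of_nonneg_left ?_ (by positivity)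
      nlinarith [mul_nonneg h0 hy, mul_nonneg h0 hz]
    linarith
  have hle : ∀ y z, (T u y - u y) - (T u z - u z) ≤ 0 := fun y z => by
    have h1 : Tendsto (fun n : ℕ => L * ((q * L ^ n) * (2 + β * ω y + β * ω z))
        + (v (n + 1) y - v (n + 1) z) - (u y - u z)) atTop
        (𝓝 (L * ((q * 0) * (2 + β * ω y + β * ω z)) + (u y - u z) - (u y - u z))) :=
      (((((hpow.const_mul q).mul_const _).const_mul L).add
        (((tendsto_add_atTop_iff_nat 1).2 (hu y)).sub
          ((tendsto_add_atTop_iff_nat 1).2 (hu z)))).sub_const _)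
    simp only [mul_zero, zero_mul, zero_add, sub_self] at h1
    refine ge_of_tendsto' h1 fun n => ?_
    have h2 := hcon u (v n) huc (hvc n) huK (hvK n) (q * L ^ n) (by positivity) (hspan' n) y z
    rw [hTv, hTv] at h2
    linarith
  linarith [hle x x₀, hle x₀ x]

/-! ### The weighted space, and the Bellman equation in real form -/

theorem HasFiniteWeightedNorm.exists_abs_le {E : Type*} {ω g : E → ℝ} (hω : ∀ x, 0 ≤ ω x)
    (hg : HasFiniteWeightedNorm ω g) : ∃ K, 0 < K ∧ ∀ x, |g x| ≤ K * (1 + ω x) := by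
  obtain ⟨K, hK⟩ := hg
  refine ⟨|K| + 1, by positivity, fun x => ?_⟩
  have h1 : 0 < 1 + ω x := by linarith [hω x]
  have h2 : |g x| / (1 + ω x) ≤ K := hK ⟨x, rfl⟩
  rw [div_le_iff₀ h1] at h2
  exact h2.trans (mul_le_mul_of_nonneg_right (by linarith [le_abs_self K]) h1.le)

theorem hasFiniteWeightedNorm_of_abs_le {E : Type*} {ω g : E → ℝ} (hω : ∀ x, 0 ≤ ω x) {K : ℝ}
    (hg : ∀ x, |g x| ≤ K * (1 + ω x)) : HasFiniteWeightedNorm ω g := by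
  refine ⟨K, ?_⟩
  rintro _ ⟨x, rfl⟩
  exact (div_le_iff₀ (by linarith [hω x])).2 (hg x)

theorem ShiftCostCondition.exists_le {E : Type*} [TopologicalSpace E] {ω : E → ℝ} {U : Set E}
    {c : E → U → ℝ} (hc : ShiftCostCondition ω U c) (hU : IsCompact U) (hω : ∀ x, 0 ≤ ω x) :
    ∃ C, 0 ≤ C ∧ ∀ x ξ, -(C * (1 + ω x)) ≤ c x ξ := by
  have := isCompact_iff_compactSpace.1 hU
  obtain ⟨hcont, -, hnorm⟩ := hc
  obtain ⟨C, hC0, hC⟩ := hnorm.exists_abs_le hω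
  refine ⟨C, hC0.le, fun x ξ => (abs_le.1 (hC x)).1.trans (ciInf_le ?_ ξ)⟩
  exact (isCompact_range (hcont.comp (Continuous.prodMk_right x))).bddBelow

/-- The maximum over shifts is the same in the reals and in the extended reals: the supremum is over
a nonempty set that is bounded above. -/
theorem coe_shiftMax {E : Type*} {U : Set E} [Nonempty U] {c : E → U → ℝ} {m : E → ℝ}
    (hc : ∀ x ξ, c x ξ ≤ 0) {C : ℝ} (hm : ∀ ξ ∈ U, m ξ ≤ C) (x : E) :
    max (m x : EReal) (⨆ ξ : U, ((m ξ : EReal) + (c x ξ : EReal)))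
      = ((shiftMax U c m x : ℝ) : EReal) := by
  obtain ⟨M, hM⟩ : ∃ M : EReal,
    M = max (m x : EReal) (⨆ ξ : U, ((m ξ : EReal) + (c x ξ : EReal))) := ⟨_, rfl⟩
  have hle : M ≤ ((shiftMax U c m x : ℝ) : EReal) := by
    rw [hM]
    refine max_le (EReal.coe_le_coe_iff.2 (le_shiftMax x)) (iSup_le fun ξ => ?_)
    rw [← EReal.coe_add, EReal.coe_le_coe_iff]
    exact add_cost_le_shiftMax hc hm x ξ
  have h1 : (m x : EReal) ≤ M := hM ▸ le_max_left _ _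
  have h2 : ∀ ξ : U, ((m ξ + c x ξ : ℝ) : EReal) ≤ M := fun ξ => by
    rw [EReal.coe_add, hM]
    exact (le_iSup (fun ξ : U => (m ξ : EReal) + (c x ξ : EReal)) ξ).trans (le_max_right _ _)
  rw [← hM]
  refine le_antisymm hle ?_
  lift M to ℝ using ⟨ne_top_of_le_ne_top (EReal.coe_ne_top _) hle,
    ne_bot_of_le_ne_bot (EReal.coe_ne_bot _) h1⟩
  exact EReal.coe_le_coe_iff.2
    (shiftMax_le (EReal.coe_le_coe_iff.1 h1) fun ξ => EReal.coe_le_coe_iff.1 (h2 ξ))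

theorem continuous_shiftMax {E : Type*} [TopologicalSpace E] {U : Set E} (hU : IsCompact U)
    {c : E → U → ℝ} (hc : Continuous fun p : E × U => c p.1 p.2) {m : E → ℝ}
    (hm : Continuous m) : Continuous (shiftMax U c m) := by
  have := isCompact_iff_compactSpace.1 hU
  refine hm.max ?_
  have h1 : Continuous (Function.uncurry fun (x : E) (ξ : U) => m ξ + c x ξ) :=
    (hm.comp (continuous_subtype_val.comp continuous_snd)).add hc
  have h2 := isCompact_univ.continuous_sSup (f := fun (x : E) (ξ : U) => m ξ + c x ξ) h1
  simpa only [Set.image_univ, sSup_range] using h2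

theorem entropicUtility_eq_coe {Ω : Type*} [MeasurableSpace Ω] {P : Measure Ω} {γ : ℝ}
    (hγ : γ ≠ 0) {Z : Ω → ℝ} (hZ : Integrable (fun o => Real.exp (γ * Z o)) P)
    (hpos : 0 < ∫ o, Real.exp (γ * Z o) ∂P) :
    entropicUtility P γ Z = ((1 / γ * Real.log (∫ o, Real.exp (γ * Z o) ∂P) : ℝ) : EReal) := by
  rw [entropicUtility, if_neg hγ,
    ← ofReal_integral_eq_lintegral_ofReal hZ (.of_forall fun o => (Real.exp_pos _).le),
    ENNReal.log_ofReal_of_pos hpos, ← EReal.coe_mul]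

section Bellman

variable {Ω E : Type*} [MeasurableSpace Ω] [MeasurableSpace E] {X : ℝ≥0 → Ω → E}
  {P : E → Measure Ω} {δ : ℝ≥0} {f ω : E → ℝ} {b : ℝ} {M₁ M₂ : ℝ → ℝ} {γ K : ℝ}

theorem stepValue_eq_coe (hD : DriftBounds P (X δ) (pathIntegral X δ ω) ω b M₁ M₂)
    (hγ : γ ≠ 0) (hK : 0 < K) {w : E → ℝ}
    (hZ : Dominated (X δ) (pathIntegral X δ ω) ω K fun o => pathIntegral X δ f o + w (X δ o))
    (x : E) : stepValue X P δ f γ w x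
      = ((certaintyEquivalent P (X δ) (pathIntegral X δ f) γ w x : ℝ) : EReal) :=
  entropicUtility_eq_coe hγ (hD.integrable_exp hK hZ γ x)
    (hD.integral_exp_pos_of_dominated hK hZ γ x)

/-- For data of finite weighted norm both sides of the Bellman equation are finite, and the equation
says that `w` is a fixed point, up to the constant `l`, of the real-valued Bellman operator. -/
theorem solvesBellman_iff (hD : DriftBounds P (X δ) (pathIntegral X δ ω) ω b M₁ M₂)
    (hγ : γ ≠ 0) (hK : 0 < K) {U : Set E} [Nonempty U] {c : E → U → ℝ} (hc : ∀ x ξ, c x ξ ≤ 0)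
    {R₀ : ℝ} (hR₀ : ∀ ξ ∈ U, ω ξ ≤ R₀) {w : E → ℝ}
    (hZ : Dominated (X δ) (pathIntegral X δ ω) ω K fun o => pathIntegral X δ f o + w (X δ o))
    (l : ℝ) : SolvesBellman X P δ f U c γ w l ↔
      ∀ x, shiftMax U c (certaintyEquivalent P (X δ) (pathIntegral X δ f) γ w) x = w x + l := by
  obtain ⟨C, hC⟩ := hD.exists_certaintyEquivalent_le_on (F := pathIntegral X δ f) hK γ hR₀ hZ
  refine forall_congr' fun x => ?_
  simp_rw [stepValue_eq_coe hD hγ hK hZ]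
  rw [coe_shiftMax hc hC x, EReal.coe_eq_coe_iff, eq_comm]

end Bellman

namespace IsFellerProcess

variable {Ω E : Type*} [mΩ : MeasurableSpace Ω] [NormedAddCommGroup E] [ProperSpace E]
  [MeasurableSpace E] [BorelSpace E] {𝓕 : Filtration ℝ≥0 mΩ} {X : ℝ≥0 → Ω → E}
  {P : E → Measure Ω} {δ : ℝ≥0} {f ω : E → ℝ} {b : ℝ} {M₁ M₂ : ℝ → ℝ} {γ K κ : ℝ}

theorem continuous_certaintyEquivalent (hX : IsFellerProcess 𝓕 X P) (hω : Continuous ω)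
    (hD : DriftBounds P (X δ) (pathIntegral X δ ω) ω b M₁ M₂) (hγ : γ ≠ 0) (hf : Continuous f)
    {w : E → ℝ} (hw : Continuous w) (hK : 0 < K) (hfK : ∀ x, |f x| ≤ K * (1 + ω x))
    (hwK : ∀ x, |w x| ≤ K * (1 + ω x))
    (hZ : Dominated (X δ) (pathIntegral X δ ω) ω κ fun o => pathIntegral X δ f o + w (X δ o))
    (hκ : 0 < κ) :
    Continuous (certaintyEquivalent P (X δ) (pathIntegral X δ f) γ w) := by
  have hscale : ∀ {g : E → ℝ}, (∀ x, |g x| ≤ K * (1 + ω x)) →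
      ∀ x, |γ * g x| ≤ (|γ| * K) * (1 + ω x) := fun hg x => by
    rw [abs_mul, mul_assoc]
    exact mul_le_mul_of_nonneg_left (hg x) (abs_nonneg _)
  have h1 := hX.continuous_integral_exp hω hD (f := fun x => γ * f x) (w := fun x => γ * w x)
    (hf.const_mul γ) (hw.const_mul γ) (K := |γ| * K) (mul_pos (abs_pos.2 hγ) hK)
    (hscale hfK) (hscale hwK)
  have h2 : ∀ o, pathIntegral X δ (fun x => γ * f x) o = γ * pathIntegral X δ f o := fun o =>
    intervalIntegral.integral_const_mul _ _
  simp_rw [h2, ← mul_add] at h1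
  exact (h1.log fun x => (hD.integral_exp_pos_of_dominated hκ hZ γ x).ne').const_mul _

theorem exists_abs_pathIntegral_le (hX : IsFellerProcess 𝓕 X P) (hω : Continuous ω)
    (hω0 : ∀ x, 0 ≤ ω x) (hf : MemWeightedSpace ω f) (δ : ℝ≥0) :
    ∃ κ, 0 < κ ∧ (∀ x, |f x| ≤ κ * (1 + ω x)) ∧
      ∀ o, |pathIntegral X δ f o| ≤ κ * (1 + pathIntegral X δ ω o) := by
  obtain ⟨K, hK0, hK⟩ := hf.2.exists_abs_le hω0
  have hA0 : ∀ o, 0 ≤ pathIntegral X δ ω o := fun o =>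
    intervalIntegral.integral_nonneg δ.coe_nonneg fun s _ => hω0 _
  refine ⟨K * (1 + δ), by positivity, fun x => (hK x).trans ?_, fun o => ?_⟩
  · exact mul_le_mul_of_nonneg_right (by nlinarith [δ.coe_nonneg]) (by linarith [hω0 x])
  · have h1 := hX.abs_pathIntegral_le hf.1 (by fun_prop) hK δ o
    rw [hX.pathIntegral_affine hω] at h1
    refine h1.trans ?_
    rw [mul_assoc]
    exact mul_le_mul_of_nonneg_left (by
      nlinarith [hA0 o, δ.coe_nonneg, mul_nonneg δ.coe_nonneg (hA0 o)]) hK0.le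

end IsFellerProcess

theorem LocalMinorization.nonempty {Ω E : Type*} [MeasurableSpace Ω] [MeasurableSpace E]
    {X : ℝ≥0 → Ω → E} {P : E → Measure Ω} {δ : ℝ≥0} {ω : E → ℝ} {U : Set E}
    (h : LocalMinorization X P δ ω U) : U.Nonempty := by
  obtain ⟨_, -, ν, -, hν, -⟩ := h 1 one_pos
  exact nonempty_of_measure_ne_zero hν.ne'

theorem BellmanBounds.exists_abs_sub_le {E : Type*} {ω : E → ℝ} {U : Set E} {C a B : ℝ}
    {w : E → ℝ} (h : BellmanBounds ω U C a B w) (hω : ∀ x, 0 ≤ ω x) (hC : 0 ≤ C) (ha : 0 ≤ a)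
    (hB : 0 ≤ B) : ∃ k, ∀ x, |w x - k| ≤ (C + a + B + 1) * (1 + ω x) := by
  obtain ⟨k, h1, h2, -⟩ := h
  refine ⟨k, fun x => abs_le.2 ⟨?_, ?_⟩⟩ <;>
    nlinarith [h1 x, h2 x, hω x, mul_nonneg hC (hω x), mul_nonneg ha (hω x),
      mul_nonneg hB (hω x)]

end

theorem proposition3 {n : ℕ} {Ω : Type*} [mΩ : MeasurableSpace Ω]
    (𝓕 : Filtration ℝ≥0 mΩ) (X : ℝ≥0 → Ω → EuclideanSpace ℝ (Fin n))
    (P : EuclideanSpace ℝ (Fin n) → Measure Ω) (hX : IsFellerProcess 𝓕 X P)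
    (δ : ℝ≥0) (hδ : 0 < δ)
    (U : Set (EuclideanSpace ℝ (Fin n))) (hU : IsCompact U)
    (ω : EuclideanSpace ℝ (Fin n) → ℝ) (hω : Continuous ω) (hω_nonneg : ∀ x, 0 ≤ ω x)
    (f : EuclideanSpace ℝ (Fin n) → ℝ) (c : EuclideanSpace ℝ (Fin n) → U → ℝ)
    (γ : ℝ) (hγ : γ < 0)
    (hf : MemWeightedSpace ω f)
    (hc : ShiftCostCondition ω U c)
    (hdrift : GeometricDrift X P δ ω)
    (hminor : LocalMinorization X P δ ω U) :
    ∃ (w : EuclideanSpace ℝ (Fin n) → ℝ) (l : ℝ),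
      MemWeightedSpace ω w ∧ SolvesBellman X P δ f U c γ w l ∧
      ∀ (w' : EuclideanSpace ℝ (Fin n) → ℝ) (l' : ℝ),
        MemWeightedSpace ω w' → SolvesBellman X P δ f U c γ w' l' →
          l' = l ∧ ∃ k : ℝ, ∀ x, w' x = w x + k := by
  obtain ⟨b, M₁, M₂, hD⟩ := hX.exists_driftBounds hω hω_nonneg hdrift
  obtain ⟨κ, hκ, hfκ, hFA⟩ := hX.exists_abs_pathIntegral_le hω hω_nonneg hf δ
  obtain ⟨C, hC, hcC⟩ := hc.exists_le hU hω_nonneg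
  have hc0 : ∀ x ξ, c x ξ ≤ 0 := fun x ξ => by
    obtain ⟨-, ⟨c₀, hc₀, h⟩, -⟩ := hc
    exact (h x ξ).trans hc₀.le
  have hUne : Nonempty U := hminor.nonempty.to_subtype
  obtain ⟨R, hR⟩ := (hU.image hω).bddAbove
  have hR₀0 : 0 ≤ |R| := abs_nonneg R
  have hR₀ : ∀ ξ ∈ U, ω ξ ≤ |R| := fun ξ hξ => (hR ⟨ξ, hξ, rfl⟩).trans (le_abs_self R)
  have hF : Measurable (pathIntegral X δ f) := hX.measurable_pathIntegral hf.1.measurable δ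
  -- Any radius of a weighted ball may be enlarged to one that also accommodates `f`.
  have hgrow : ∀ {K : ℝ} {w : EuclideanSpace ℝ (Fin n) → ℝ}, (∀ x, |w x| ≤ K * (1 + ω x)) →
      ∀ x, |w x| ≤ max K κ * (1 + ω x) := fun h x =>
    (h x).trans (mul_le_mul_of_nonneg_right (le_max_left _ _) (by linarith [hω_nonneg x]))
  have hpos : ∀ K : ℝ, 0 < max K κ := fun K => hκ.trans_le (le_max_right _ _)
  have hdom : ∀ {K : ℝ} {w : EuclideanSpace ℝ (Fin n) → ℝ}, Continuous w →
      (∀ x, |w x| ≤ K * (1 + ω x)) →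
      Dominated (X δ) (pathIntegral X δ ω) ω (max K κ)
        fun o => pathIntegral X δ f o + w (X δ o) := fun hw h =>
    hD.dominated hF hFA (le_max_right _ _) hw.measurable (hgrow h)
  obtain ⟨T, hT⟩ : ∃ T : (EuclideanSpace ℝ (Fin n) → ℝ) → EuclideanSpace ℝ (Fin n) → ℝ,
    ∀ w, T w = shiftMax U c (certaintyEquivalent P (X δ) (pathIntegral X δ f) γ w) :=
    ⟨_, fun _ => rfl⟩
  have hTspan : LocalSpanContraction ω T := by
    refine ⟨fun K w hw hK k x => ?_, fun K => ?_⟩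
    · obtain ⟨C', hC'⟩ := hD.exists_certaintyEquivalent_le_on (hpos K) γ hR₀ (hdom hw hK)
      rw [hT, hT, ← shiftMax_add_const hc0 hC']
      congr 1
      funext y
      exact hD.certaintyEquivalent_add_const (hpos K) hγ (hdom hw hK) k y
    · obtain ⟨β, L, hβ, hL0, hL1, h⟩ := hD.exists_bellman_contraction (K := max K κ) hF hFA hκ
        (le_max_right _ _) hγ hc0 hR₀0 hR₀ fun R hR => by
          obtain ⟨d, hd, ν, hν, -, h⟩ := hminor R hR
          exact ⟨d, hd, ν, hν, h⟩
      refine ⟨β, L, hβ, hL0, hL1, fun w₁ w₂ hw₁ hw₂ h₁ h₂ => ?_⟩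
      rw [hT, hT]
      exact h w₁ w₂ hw₁.measurable hw₂.measurable (hgrow h₁) (hgrow h₂)
  have hTcont : ∀ (K : ℝ) (w : EuclideanSpace ℝ (Fin n) → ℝ), Continuous w →
      (∀ x, |w x| ≤ K * (1 + ω x)) → Continuous (T w) := fun K w hw hK => by
    rw [hT]
    refine continuous_shiftMax hU hc.1 (hX.continuous_certaintyEquivalent hω hD hγ.ne hf.1 hw
      (hpos K) (fun x => (hfκ x).trans ?_) (hgrow hK) (hdom hw hK) (hpos K))
    exact mul_le_mul_of_nonneg_right (le_max_right _ _) (by linarith [hω_nonneg x])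
  have hsolves : ∀ {K : ℝ} {w : EuclideanSpace ℝ (Fin n) → ℝ} (l : ℝ), Continuous w →
      (∀ x, |w x| ≤ K * (1 + ω x)) →
      (SolvesBellman X P δ f U c γ w l ↔ ∀ x, T w x = w x + l) := fun l hw hK => by
    rw [hT]
    exact solvesBellman_iff hD hγ.ne (hpos _) hc0 hR₀ (hdom hw hK) l
  -- The iterates of `T` from `0` stay in a set that is bounded up to constants.
  obtain ⟨a, B, ha, hB, hinv⟩ := hD.exists_bellmanBounds hF hFA hκ hγ hU.measurableSet hc0 hC hcC
    hR₀0 hR₀ hminor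
  obtain ⟨w, l, K, hw, hK, hfix⟩ := hTspan.exists_fixed (S := BellmanBounds ω U C a B)
    (K₁ := C + a + B + 1) hω hω_nonneg hTcont
    ⟨0, fun x => by nlinarith [hω_nonneg x, mul_nonneg hC (hω_nonneg x)],
      fun x => by linarith [mul_nonneg hB (hω_nonneg x)], fun _ _ => le_rfl⟩
    (fun K w hw hK h => by
      rw [hT]
      exact hinv w (max K κ) (le_max_right _ _) hw.measurable (hgrow hK) h)
    (by positivity) (fun w h => h.exists_abs_sub_le hω_nonneg hC ha hB)
  refine ⟨w, l, ⟨hw, hasFiniteWeightedNorm_of_abs_le hω_nonneg hK⟩, (hsolves l hw hK).2 hfix,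
    fun w' l' hw' hsol => ?_⟩
  obtain ⟨K', -, hK'⟩ := hw'.2.exists_abs_le hω_nonneg
  refine hTspan.unique (K := max K K') hω_nonneg hw hw'.1 (fun x => ?_) (fun x => ?_) hfix
    ((hsolves l' hw'.1 hK').1 hsol)
  · exact (hK x).trans (mul_le_mul_of_nonneg_right (le_max_left _ _) (by linarith [hω_nonneg x]))
  · exact (hK' x).trans
      (mul_le_mul_of_nonneg_right (le_max_right _ _) (by linarith [hω_nonneg x]))
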